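/- Let $G$ be a maximal outerplanar graph with $n\ge 3$ vertices. (So $G$ has a standard planar embedding in which all vertices lie on the outer face and all interior faces are triangles.) Its dual tree $T$ has one vertex for each interior face, two of them being adjacent if the faces share an edge. Then $$\tfrac12\,pw(T)\;\le\; bd^{\mathrm{free}}(G)\;\le\; ud^{\mathrm{free}}(G)\;\le\; rpw^{\mathrm{free}}(T)\;\le\;\max\{1,\,2\,pw(T)\},$$ and consequently $bd^{\mathrm{free}}(G)\le \log_2(n+1)$. All these parameters are finite. They are defined as follows, where a maximum over the empty set is $0$. **Pathwidth.** For a tree $T$, $pw(T)=0$ if $T$ is a single node, and otherwise $pw(T)=1+\min_P\max_{T'}pw(T')$, where $P$ ranges over all paths in $T$ and $T'$ over the components of $T-P$. For a tree $T$ with root $r$, $rpw(T,r)=0$ if $T$ is empty, and otherwise $rpw(T,r)=1+\min_P\max_{T'}rpw(T')$, where $P$ ranges over the paths in $T$ that end at $r$ and $T'$ over the components of $T-P$, each rooted at its vertex whose parent lies on $P$. Further, $rpw^{\mathrm{free}}(T)=\min_r rpw(T,r)$. **Cutting edges and outerplanar paths.** An edge $(u,v)$ of a maximal outerplanar graph $H$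 is a cutting edge if $H-\{u,v\}$ is disconnected. The cut-components of $H$ at a cutting edge $(u,v)$ are the subgraphs induced by $u$, $v$ and one component of $H-\{u,v\}$. An outerplanar path is a maximal outerplanar graph (on at least $3$ vertices) whose dual tree is a path. It connects $e$ and $e'$ if $e$ is incident to the first and $e'$ to the last face of that path. **Umbrellas and bonnets.** Let $(u,v)$ be a non-cutting edge of $H$. An umbrella of $H$ with cap $(u,v)$ is a subgraph $U=P\cup F_1\cup F_2$ of $H$ such that: 1. $P$ is an outerplanar path that connects $(u,v)$ to some other non-cutting edge of $H$. 2. Each of $F_1$, $F_2$ is empty or an outerplanar path; $F_1$ contains only $u$ and neighbours of $u$, and $F_2$ contains only $v$ and neighbours of $v$. 3. $F_1$ and $F_2$ are edge-disjoint; $F_1$, if non-empty, has exactly one edge in common with $P$, and this edge is incident to $u$; likewise for $F_2$ and $v$. 4. All neighbours in $H$ of $u$ and of $v$ belong to $U$. A bonnet is defined in the same way, except that (1) is replaced by: $P$ is an outerplanar path that connects two distinct non-cutting edges of $H$ and contains $u$, $v$ and their common neighbour. **Systems and depth.** An anchor-edge of $U$ in $H$ is an edge of $U$ that is a cutting edge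 of $H$ but not of $U$. The hanging subgraph at an anchor-edge is the cut-component of $H$ at that edge that does not contain the cap. An umbrella (bonnet) system on $H$ with root-edge $(u,v)$ consists of an umbrella (bonnet) $U_0$ of $H$ with cap $(u,v)$ and, for each anchor-edge $(a,b)$ of $U_0$, an umbrella (bonnet) system on the hanging subgraph at $(a,b)$ with root-edge $(a,b)$. Its depth is one plus the maximum depth of these hanging systems. Finally, $ud^{\mathrm{free}}(G)$ (respectively $bd^{\mathrm{free}}(G)$) is the minimum depth of an umbrella (respectively bonnet) system on $G$, over all systems and all choices of a non-cutting edge of $G$ as root-edge. -/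

import Mathlib

/-! ### Maximal outerplanar graphs and their dual trees -/

/-- `K` is outerplanar: its vertices can be placed along a circle (read off from a starting point,
this is a linear order) such that no two edges, drawn as chords, cross. -/
def IsOuterplanar {W : Type*} (K : SimpleGraph W) : Prop :=
  ∃ f : W → ℕ, Function.Injective f ∧
    ∀ a b c d : W, f a < f b → f b < f c → f c < f d → ¬ (K.Adj a c ∧ K.Adj b d)

/-- `K` is outerplanar and no edge can be added on the same vertex set without losing this. -/
def IsMaximalOuterplanar {W : Type*} (K : SimpleGraph W) : Prop :=
  Maximal (fun K' : SimpleGraph W => IsOuterplanar K') K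

/-- The interior faces of a maximal outerplanar graph. All vertices lie on the outer face and all
interior faces are triangles, so the interior faces are exactly the triangles of the graph. -/
abbrev Face {V : Type*} (K : SimpleGraph V) : Type _ := {t : Finset V // K.IsNClique 3 t}

/-- The edge `e` of `K` is incident to the interior face `t`. -/
def EdgeOfFace {V : Type*} (K : SimpleGraph V) (e : Sym2 V) (t : Face K) : Prop :=
  e ∈ K.edgeSet ∧ ∀ x ∈ e, x ∈ t.1

/-- The (weak) dual graph: one vertex for each interior face, two different faces being adjacent
if they share an edge. For a maximal outerplanar graph this is a tree. -/
def dualTree {V : Type*} (K : SimpleGraph V) : SimpleGraph (Face K) where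
  Adj s t := s ≠ t ∧ ∃ e : Sym2 V, EdgeOfFace K e s ∧ EdgeOfFace K e t
  symm := ⟨fun _ _ h => ⟨h.1.symm, h.2.imp fun _ he => ⟨he.2, he.1⟩⟩⟩
  loopless := ⟨fun _ h => h.1 rfl⟩

/-! ### Pathwidth and rooted pathwidth of a tree -/

/-- `P` is the vertex set of a path of `T` that lies inside `A` and leads from `x` to `y`. -/
def IsPathSet {W : Type*} (T : SimpleGraph W) (A P : Set W) (x y : W) : Prop :=
  ∃ p : T.Walk x y, p.IsPath ∧ {z | z ∈ p.support} = P ∧ P ⊆ A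

/-- `C` is the vertex set of a connected component of the subgraph of `T` induced by `B`. -/
def IsComponentSet {W : Type*} (T : SimpleGraph W) (B C : Set W) : Prop :=
  ∃ K : (T.induce B).ConnectedComponent, C = Subtype.val '' K.supp

theorem IsPathSet.ncard_diff_lt {W : Type*} [Finite W] {T : SimpleGraph W} {A P C : Set W}
    {x y : W} (hP : IsPathSet T A P x y) (hC : IsComponentSet T (A \ P) C) :
    C.ncard < A.ncard := by
  obtain ⟨p, -, hs, hPA⟩ := hP
  obtain ⟨K, rfl⟩ := hC
  have hx : x ∈ P := hs ▸ p.start_mem_support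
  refine Set.ncard_lt_ncard ⟨?_, ?_⟩ (Set.toFinite _)
  · rintro _ ⟨z, -, rfl⟩
    exact z.2.1
  · intro h
    obtain ⟨z, -, hz⟩ := h (hPA hx)
    exact z.2.2 (hz ▸ hx)

open Classical in
/-- Pathwidth of the subtree of `T` with vertex set `A`: it is `0` for a single node, and otherwise
`1 + min_P max_{T'} pw(T')` over the paths `P` in the subtree and the components `T'` that remain
after deleting the vertices of `P` (the maximum over no components being `0`). -/
noncomputable def pathwidthOn {W : Type*} [Finite W] (T : SimpleGraph W) (A : Set W) : ℕ∞ :=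
  if A.Subsingleton then 0 else
    1 + ⨅ P : {P : Set W // ∃ x y, IsPathSet T A P x y},
      ⨆ C : {C : Set W // IsComponentSet T (A \ P.1) C}, pathwidthOn T C.1
termination_by A.ncard
decreasing_by
  obtain ⟨P, x, y, hP⟩ := P
  exact hP.ncard_diff_lt C.2

/-- The pathwidth of a tree `T`. -/
noncomputable def pathwidth {W : Type*} [Finite W] (T : SimpleGraph W) : ℕ∞ :=
  pathwidthOn T Set.univ

open Classical in
/-- Rooted pathwidth of the subtree of `T` with vertex set `A` and root `r`: it is `0` for the
empty tree, and otherwise `1 + min_P max_{T'} rpw(T')` over the paths `P` that end at the root and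
the components `T'` that remain after deleting the vertices of `P`. The root of `T'` is the vertex
`c` of `T'` whose parent lies on `P`. -/
noncomputable def rootedPathwidthOn {W : Type*} [Finite W] (T : SimpleGraph W) (A : Set W)
    (r : W) : ℕ∞ :=
  if A = ∅ then 0 else
    1 + ⨅ P : {P : Set W // ∃ x, IsPathSet T A P x r},
      ⨆ C : {C : Set W // IsComponentSet T (A \ P.1) C},
        ⨆ c : {c : W // c ∈ C.1 ∧ ∃ p ∈ P.1, T.Adj p c}, rootedPathwidthOn T C.1 c.1
termination_by A.ncard
decreasing_by
  obtain ⟨P, x, hP⟩ := P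
  exact hP.ncard_diff_lt C.2

/-- The rooted pathwidth of a tree, minimized over the choice of the root. -/
noncomputable def freeRootedPathwidth {W : Type*} [Finite W] (T : SimpleGraph W) : ℕ∞ :=
  ⨅ r : W, rootedPathwidthOn T Set.univ r

/-! ### Cutting edges and outerplanar paths

All graphs that occur below are subgraphs of one fixed graph `G`. -/

section Umbrellas

variable {V : Type*} {G : SimpleGraph V}

/-- `e = (u,v)` is an edge of `H` for which `H - {u,v}` is disconnected. -/
def IsCuttingEdge (H : G.Subgraph) (e : Sym2 V) : Prop :=
  e ∈ H.edgeSet ∧ ¬ (H.deleteVerts {x | x ∈ e}).coe.Preconnected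

/-- `e = (u,v)` is an edge of `H` that is not a cutting edge. -/
def IsNonCuttingEdge (H : G.Subgraph) (e : Sym2 V) : Prop :=
  e ∈ H.edgeSet ∧ ¬ IsCuttingEdge H e

/-- `S` is a cut-component of `H` at the edge `e = (a,b)`: the subgraph of `H` induced by `a`, `b`
and one connected component of `H - {a,b}`. -/
def IsCutComponent (H : G.Subgraph) (e : Sym2 V) (S : G.Subgraph) : Prop :=
  ∃ K : (H.deleteVerts {x | x ∈ e}).coe.ConnectedComponent,
    S = H.induce ({x | x ∈ e} ∪ Subtype.val '' K.supp)

/-- `P` is a maximal outerplanar graph whose dual tree is a (non-empty) path. -/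
def IsOuterplanarPath (P : G.Subgraph) : Prop :=
  IsMaximalOuterplanar P.coe ∧
    ∃ k : ℕ, Nonempty (SimpleGraph.pathGraph (k + 1) ≃g dualTree P.spanningCoe)

/-- `P` is an outerplanar path, with faces `f_0, …, f_k` in the order of its dual path, and it
connects `e` and `e'`: the edge `e` is incident to `f_0` and `e'` is incident to `f_k`. -/
def ConnectsEdges (P : G.Subgraph) (e e' : Sym2 V) : Prop :=
  IsMaximalOuterplanar P.coe ∧
    ∃ (k : ℕ) (f : SimpleGraph.pathGraph (k + 1) ≃g dualTree P.spanningCoe),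
      EdgeOfFace P.spanningCoe e (f 0) ∧ EdgeOfFace P.spanningCoe e' (f (Fin.last k))

/-! ### Umbrellas, bonnets and systems thereof -/

/-- `F` is a fan at `u` in `H`, attached to `P`: it is empty, or it is an outerplanar path that
contains only `u` and neighbours of `u` and has exactly one edge in common with `P`, which is
incident to `u`. -/
def IsFan (H P : G.Subgraph) (u : V) (F : G.Subgraph) : Prop :=
  F = ⊥ ∨
    (IsOuterplanarPath F ∧ F ≤ H ∧ F.verts ⊆ insert u (H.neighborSet u) ∧
      ∃ e : Sym2 V, u ∈ e ∧ F.edgeSet ∩ P.edgeSet = {e})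

/-- `U` is the union of `P`, a fan at `u` and a fan at `v`, the fans being edge-disjoint, and it
contains all neighbours of `u` and of `v` in `H`. -/
def IsUnionWithFans (H P : G.Subgraph) (u v : V) (U : G.Subgraph) : Prop :=
  ∃ F₁ F₂ : G.Subgraph, U = P ⊔ F₁ ⊔ F₂ ∧ IsFan H P u F₁ ∧ IsFan H P v F₂ ∧
    Disjoint F₁.edgeSet F₂.edgeSet ∧ H.neighborSet u ∪ H.neighborSet v ⊆ U.verts

/-- `U` is an umbrella of `H` whose cap is the non-cutting edge `c = (u,v)` of `H`: the handle `P`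
connects `(u,v)` to some other non-cutting edge. -/
def IsUmbrella (H : G.Subgraph) (c : Sym2 V) (U : G.Subgraph) : Prop :=
  IsNonCuttingEdge H c ∧ ∃ (u v : V) (P : G.Subgraph), c = s(u, v) ∧ P ≤ H ∧
    (∃ e : Sym2 V, e ≠ c ∧ IsNonCuttingEdge H e ∧ ConnectsEdges P c e) ∧
    IsUnionWithFans H P u v U

/-- `U` is a bonnet of `H` whose cap is the non-cutting edge `c = (u,v)` of `H`: the ribbon `P`
connects two non-cutting edges and contains `u`, `v` and their common neighbour. -/
def IsBonnet (H : G.Subgraph) (c : Sym2 V) (U : G.Subgraph) : Prop :=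
  IsNonCuttingEdge H c ∧ ∃ (u v : V) (P : G.Subgraph), c = s(u, v) ∧ P ≤ H ∧
    (∃ e e' : Sym2 V, e ≠ e' ∧ IsNonCuttingEdge H e ∧ IsNonCuttingEdge H e' ∧
      ConnectsEdges P e e') ∧
    (∃ w : V, H.Adj u w ∧ H.Adj v w ∧ {u, v, w} ⊆ P.verts) ∧
    IsUnionWithFans H P u v U

/-- `e` is an anchor-edge of `U` in `H`: an edge of `U` that is a cutting edge of `H` but not
of `U`. -/
def IsAnchorEdge (H U : G.Subgraph) (e : Sym2 V) : Prop :=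
  e ∈ U.edgeSet ∧ IsCuttingEdge H e ∧ ¬ IsCuttingEdge U e

/-- `S` is the hanging subgraph at the anchor-edge `e` of `U` in `H`: the cut-component of `H`
at `e` that does not contain the cap `c`. -/
def IsHangingSubgraph (H : G.Subgraph) (c : Sym2 V) (U : G.Subgraph) (e : Sym2 V)
    (S : G.Subgraph) : Prop :=
  IsAnchorEdge H U e ∧ IsCutComponent H e S ∧ c ∉ S.edgeSet

/-- A system on `H` with root-edge `c` whose members are of the kind `IsPiece` (umbrellas or
bonnets): a root piece `U` with cap `c`, and for each anchor-edge `e` of `U` a system on the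
hanging subgraph `S` at `e`, with root-edge `e`. -/
inductive CapSystem (IsPiece : G.Subgraph → Sym2 V → G.Subgraph → Prop) :
    G.Subgraph → Sym2 V → Type _
  | mk (H : G.Subgraph) (c : Sym2 V) (U : G.Subgraph) (hU : IsPiece H c U)
      (sub : ∀ (e : Sym2 V) (S : G.Subgraph), IsHangingSubgraph H c U e S →
        CapSystem IsPiece S e) : CapSystem IsPiece H c

/-- The depth of a system: one more than the maximal depth of its hanging systems (so it is `1`
if there are none). -/
noncomputable def CapSystem.depth {IsPiece : G.Subgraph → Sym2 V → G.Subgraph → Prop} :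
    {H : G.Subgraph} → {c : Sym2 V} → CapSystem IsPiece H c → ℕ∞
  | _, _, .mk _ _ _ _ sub => 1 + ⨆ e, ⨆ S, ⨆ h, (sub e S h).depth

/-- Umbrella systems on `H` with root-edge `c`. -/
abbrev UmbrellaSystem (H : G.Subgraph) (c : Sym2 V) : Type _ := CapSystem IsUmbrella H c

/-- Bonnet systems on `H` with root-edge `c`. -/
abbrev BonnetSystem (H : G.Subgraph) (c : Sym2 V) : Type _ := CapSystem IsBonnet H c

/-- The rooted umbrella depth: the minimum depth of an umbrella system on `H` with
root-edge `c`. -/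
noncomputable def umbrellaDepth (H : G.Subgraph) (c : Sym2 V) : ℕ∞ :=
  ⨅ 𝒰 : UmbrellaSystem H c, 𝒰.depth

/-- The rooted bonnet depth: the minimum depth of a bonnet system on `H` with root-edge `c`. -/
noncomputable def bonnetDepth (H : G.Subgraph) (c : Sym2 V) : ℕ∞ :=
  ⨅ 𝒰 : BonnetSystem H c, 𝒰.depth

end Umbrellas

/-- The free umbrella depth of `G`: the minimum of the rooted umbrella depth over all root-edges,
that is, over all non-cutting edges of `G`. -/
noncomputable def freeUmbrellaDepth {V : Type*} (G : SimpleGraph V) : ℕ∞ :=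
  ⨅ c : {c : Sym2 V // IsNonCuttingEdge (⊤ : G.Subgraph) c}, umbrellaDepth (⊤ : G.Subgraph) c.1

/-- The free bonnet depth of `G`: the minimum of the rooted bonnet depth over all root-edges. -/
noncomputable def freeBonnetDepth {V : Type*} (G : SimpleGraph V) : ℕ∞ :=
  ⨅ c : {c : Sym2 V // IsNonCuttingEdge (⊤ : G.Subgraph) c}, bonnetDepth (⊤ : G.Subgraph) c.1

/-! Order the vertices along the outer face by an injective `f : V → ℤ` such that no two edges
cross. Maximality turns this into a triangulated polygon: an edge `ab` with a vertex under it has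
exactly one apex `w` under it. So the faces under `ab` form a binary tree, made of the face `awb`,
the faces under `aw` and the faces under `wb`. A rotation of the order turns any given non-cutting
edge into the outermost edge. Hanging subgraphs are then the interval subgraphs under chords, the
faces under a chord form a subtree of the dual tree, and everything becomes a recursion over
intervals.

Lower bound: in the dual tree the faces of a bonnet form a path with at most two further paths
attached to it. A component left by the first path hangs on it by a single edge and therefore meets
at most one of the other two. Hence removing a bonnet costs two levels of pathwidth
(`pathwidthOn_le_of_two_fans`). What remains lies under anchor-edges (`exists_edge_of_component`,
`not_isCuttingEdge_of_connectedSet`), so induction on the depth applies. The comparison of bonnet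
and umbrella depth holds because every umbrella is a bonnet.

Upper bounds: the Strahler number of the binary tree (`StrahlerLE`) mediates. If it is at most `k +
1`, each face has a lower edge of number at most `k`. Following the other lower edge gives a chain
of faces from `ab` to an outer edge, the handle. The faces at `a` and at `b` that the handle misses
form the two fans. Every edge of this umbrella either has a vertex of the umbrella under it, and
then is no anchor-edge, or carries a part of number at most `k` (`StrahlerLE.exists_umbrella`). So
umbrella depth is at most the Strahler number. That number is at most the rooted pathwidth, provided
that the root face has an outer edge, which is arranged by moving the root to a leaf
(`exists_leaf_rootedPathwidthOn_le`). It is also at most logarithmic in the number of vertices, and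
all finiteness claims follow from this.

Finally, rooted pathwidth is at most `2 * pw + 1` for every root
(`rootedPathwidthOn_le_of_pathwidthOn_le`). Rooting at an end of an optimal path saves the extra
one. -/

/-! ### Connected sets, components and paths in a graph -/

section TreeWidths

variable {W : Type*} {T : SimpleGraph W}

/-- `x` and `y` are joined by a walk of `T` that stays inside `B`. -/
def JoinedWithin (T : SimpleGraph W) (B : Set W) (x y : W) : Prop :=
  ∃ p : T.Walk x y, ∀ z ∈ p.support, z ∈ B

/-- Any two vertices of `A` are joined by a walk inside `A`. -/
def ConnectedSet (T : SimpleGraph W) (A : Set W) : Prop :=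
  ∀ x ∈ A, ∀ y ∈ A, JoinedWithin T A x y

namespace JoinedWithin

variable {B B' : Set W} {x y z : W}

theorem refl (hx : x ∈ B) : JoinedWithin T B x x :=
  ⟨.nil, by simpa using hx⟩

theorem symm (h : JoinedWithin T B x y) : JoinedWithin T B y x := by
  obtain ⟨p, hp⟩ := h
  exact ⟨p.reverse, by simpa using hp⟩

theorem trans (h : JoinedWithin T B x y) (h' : JoinedWithin T B y z) : JoinedWithin T B x z := by
  obtain ⟨p, hp⟩ := h
  obtain ⟨q, hq⟩ := h'
  refine ⟨p.append q, fun v hv => ?_⟩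
  rcases SimpleGraph.Walk.mem_support_append_iff _ _ |>.1 hv with h | h
  exacts [hp _ h, hq _ h]

theorem of_adj (hx : x ∈ B) (hy : y ∈ B) (h : T.Adj x y) : JoinedWithin T B x y :=
  ⟨h.toWalk, by simp [hx, hy]⟩

theorem mono (hB : B ⊆ B') (h : JoinedWithin T B x y) : JoinedWithin T B' x y :=
  h.imp fun _ hp z hz => hB (hp z hz)

theorem left_mem (h : JoinedWithin T B x y) : x ∈ B :=
  h.elim fun p hp => hp _ p.start_mem_support

theorem right_mem (h : JoinedWithin T B x y) : y ∈ B :=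
  h.elim fun p hp => hp _ p.end_mem_support

/-- A set containing `x` and closed under adjacency within `B` contains all vertices joined to
`x`. -/
theorem mem_of_closed {C : Set W} (h : JoinedWithin T B x y) (hx : x ∈ C)
    (hC : ∀ a b, a ∈ C → b ∈ B → T.Adj a b → b ∈ C) : y ∈ C := by
  obtain ⟨p, hp⟩ := h
  induction p with
  | nil => exact hx
  | cons hadj q ih =>
    refine ih (hC _ _ hx (hp _ (by simp)) hadj) fun z hz => hp z ?_
    simp [hz]

/-- All vertices on a walk inside `B` are joined to its start, so the walk stays in a closed
set. -/
theorem within_of_closed {C : Set W} (h : JoinedWithin T B x y) (hx : x ∈ C)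
    (hC : ∀ a b, a ∈ C → b ∈ B → T.Adj a b → b ∈ C) : JoinedWithin T (B ∩ C) x y := by
  obtain ⟨p, hp⟩ := h
  refine ⟨p, ?_⟩
  induction p with
  | nil => simpa using ⟨hp _ (by simp), hx⟩
  | cons hadj q ih =>
    intro z hz
    rw [SimpleGraph.Walk.support_cons, List.mem_cons] at hz
    rcases hz with rfl | hz
    · exact ⟨hp _ (by simp), hx⟩
    · exact ih (hC _ _ hx (hp _ (by simp)) hadj) (fun z hz => hp z (by simp [hz])) z hz

end JoinedWithin

theorem isComponentSet_iff {B C : Set W} :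
    IsComponentSet T B C ↔ ∃ x ∈ B, C = {y | JoinedWithin T B x y} := by
  have key : ∀ x y : B, (T.induce B).Reachable x y ↔ JoinedWithin T B x y := by
    intro x y
    constructor
    · rintro ⟨p⟩
      induction p with
      | nil => exact .refl (Subtype.coe_prop _)
      | cons hadj q ih => exact (JoinedWithin.of_adj (Subtype.coe_prop _) (Subtype.coe_prop _)
          (SimpleGraph.induce_adj.1 hadj)).trans ih
    · rintro ⟨p, hp⟩
      exact ⟨p.induce B hp⟩
  constructor
  · rintro ⟨K, rfl⟩
    induction K using SimpleGraph.ConnectedComponent.ind with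
    | h x =>
      refine ⟨x, x.2, ?_⟩
      ext y
      constructor
      · rintro ⟨y, hy, rfl⟩
        rw [SimpleGraph.ConnectedComponent.mem_supp_iff, SimpleGraph.ConnectedComponent.eq] at hy
        exact (key _ _).1 hy.symm
      · intro hy
        refine ⟨⟨y, hy.right_mem⟩, ?_, rfl⟩
        rw [SimpleGraph.ConnectedComponent.mem_supp_iff, SimpleGraph.ConnectedComponent.eq]
        exact ((key ⟨x, x.2⟩ ⟨y, hy.right_mem⟩).2 hy).symm
  · rintro ⟨x, hx, rfl⟩
    refine ⟨(T.induce B).connectedComponentMk ⟨x, hx⟩, ?_⟩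
    ext y
    constructor
    · intro hy
      refine ⟨⟨y, hy.right_mem⟩, ?_, rfl⟩
      rw [SimpleGraph.ConnectedComponent.mem_supp_iff, SimpleGraph.ConnectedComponent.eq]
      exact ((key ⟨x, hx⟩ ⟨y, hy.right_mem⟩).2 hy).symm
    · rintro ⟨y, hy, rfl⟩
      rw [SimpleGraph.ConnectedComponent.mem_supp_iff, SimpleGraph.ConnectedComponent.eq] at hy
      exact (key ⟨x, hx⟩ y).1 hy.symm

theorem isComponentSet_of_mem {B : Set W} {x : W} (hx : x ∈ B) :
    IsComponentSet T B {y | JoinedWithin T B x y} :=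
  isComponentSet_iff.2 ⟨x, hx, rfl⟩

namespace IsComponentSet

variable {B C : Set W}

theorem nonempty (h : IsComponentSet T B C) : C.Nonempty := by
  obtain ⟨x, hx, rfl⟩ := isComponentSet_iff.1 h
  exact ⟨x, .refl hx⟩

theorem subset (h : IsComponentSet T B C) : C ⊆ B := by
  obtain ⟨x, hx, rfl⟩ := isComponentSet_iff.1 h
  exact fun y hy => hy.right_mem

theorem eq_of_mem (h : IsComponentSet T B C) {x : W} (hx : x ∈ C) :
    C = {y | JoinedWithin T B x y} := by
  obtain ⟨z, hz, rfl⟩ := isComponentSet_iff.1 h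
  ext y
  exact ⟨fun hy => hx.symm.trans hy, fun hy => hx.trans hy⟩

theorem mem_of_adj (h : IsComponentSet T B C) {x y : W} (hx : x ∈ C) (hy : y ∈ B)
    (hxy : T.Adj x y) : y ∈ C := by
  rw [h.eq_of_mem hx]
  exact .of_adj (h.subset hx) hy hxy

theorem connectedSet (h : IsComponentSet T B C) : ConnectedSet T C := by
  intro x hx y hy
  have hy' := hy
  rw [h.eq_of_mem hx] at hy'
  exact (hy'.within_of_closed hx fun a b ha hb hab => h.mem_of_adj ha hb hab).mono
    Set.inter_subset_right

/-- A connected subset of `B` that meets a component lies inside it. -/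
theorem subset_of_connectedSet (h : IsComponentSet T B C) {D : Set W} (hD : ConnectedSet T D)
    (hDB : D ⊆ B) {x : W} (hxD : x ∈ D) (hxC : x ∈ C) : D ⊆ C := by
  intro y hy
  rw [h.eq_of_mem hxC]
  exact (hD x hxD y hy).mono hDB

/-- A component of a part without edges to the rest is a component of the whole. -/
theorem of_closed {B' : Set W} (h : IsComponentSet T B C) (hB : B ⊆ B')
    (hcl : ∀ x ∈ B, ∀ y ∈ B', T.Adj x y → y ∈ B) : IsComponentSet T B' C := by
  obtain ⟨x, hx⟩ := h.nonempty
  refine isComponentSet_iff.2 ⟨x, hB (h.subset hx), ?_⟩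
  rw [h.eq_of_mem hx]
  ext y
  refine ⟨fun hy => hy.mono hB, fun hy => ?_⟩
  exact (hy.within_of_closed (h.subset hx) fun a b ha hb hab => hcl a ha b hb hab).mono
    Set.inter_subset_right

/-- A connected set without edges to the rest is a component. -/
theorem of_connectedSet (hC : ConnectedSet T C) (hne : C.Nonempty) (hCB : C ⊆ B)
    (hcl : ∀ x ∈ C, ∀ y ∈ B, T.Adj x y → y ∈ C) : IsComponentSet T B C := by
  obtain ⟨x, hx⟩ := hne
  refine isComponentSet_iff.2 ⟨x, hCB hx, ?_⟩
  ext y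
  exact ⟨fun hy => (hC x hx y hy).mono hCB,
    fun hy => hy.mem_of_closed hx fun a b ha hb => hcl a ha b hb⟩

end IsComponentSet

/-- A connected nonempty subset of `B` lies inside some component of `B`. -/
theorem ConnectedSet.exists_component {B D : Set W} (hD : ConnectedSet T D) (hne : D.Nonempty)
    (hDB : D ⊆ B) : ∃ C, IsComponentSet T B C ∧ D ⊆ C := by
  obtain ⟨x, hx⟩ := hne
  exact ⟨_, isComponentSet_of_mem (hDB hx), fun y hy => (hD x hx y hy).mono hDB⟩

namespace IsPathSet

variable {A A' P : Set W} {x y z : W}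

theorem start_mem (h : IsPathSet T A P x y) : x ∈ P := by
  obtain ⟨p, -, rfl, -⟩ := h
  exact p.start_mem_support

theorem end_mem (h : IsPathSet T A P x y) : y ∈ P := by
  obtain ⟨p, -, rfl, -⟩ := h
  exact p.end_mem_support

theorem subset (h : IsPathSet T A P x y) : P ⊆ A := h.choose_spec.2.2

theorem mono (h : IsPathSet T A P x y) (hA : P ⊆ A') : IsPathSet T A' P x y :=
  h.imp fun _ hp => ⟨hp.1, hp.2.1, hA⟩

theorem symm (h : IsPathSet T A P x y) : IsPathSet T A P y x := by
  obtain ⟨p, hp, hs, hA⟩ := h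
  exact ⟨p.reverse, hp.reverse, by simpa using hs, hA⟩

theorem nil (hx : x ∈ A) : IsPathSet T A {x} x x :=
  ⟨.nil, .nil, by simp, by simpa using hx⟩

theorem cons (hxy : T.Adj x y) (hx : x ∈ A) (hxP : x ∉ P) (h : IsPathSet T A P y z) :
    IsPathSet T A (insert x P) x z := by
  obtain ⟨p, hp, rfl, hA⟩ := h
  refine ⟨.cons hxy p, (SimpleGraph.Walk.cons_isPath_iff _ _).2 ⟨hp, hxP⟩, ?_, ?_⟩
  · ext; simp
  · exact Set.insert_subset hx hA

theorem eq_or_cons (h : IsPathSet T A P x z) :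
    (x = z ∧ P = {x}) ∨ ∃ y P', T.Adj x y ∧ x ∉ P' ∧ P = insert x P' ∧ IsPathSet T A P' y z := by
  obtain ⟨p, hp, rfl, hA⟩ := h
  cases p with
  | nil => left; simp
  | cons hadj q =>
    right
    rw [SimpleGraph.Walk.cons_isPath_iff] at hp
    refine ⟨_, {z | z ∈ q.support}, hadj, hp.2, by ext; simp, q, hp.1, rfl, ?_⟩
    intro z hz
    exact hA (by simp [show z ∈ q.support from hz])

theorem induction {motive : Set W → W → Prop} (h : IsPathSet T A P x z)
    (nil : z ∈ A → motive {z} z)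
    (cons : ∀ x y P, T.Adj x y → x ∈ A → x ∉ P → IsPathSet T A P y z → motive P y →
      motive (insert x P) x) : motive P x := by
  obtain ⟨p, hp, rfl, hA⟩ := h
  induction p with
  | nil => simpa using nil (hA (by simp))
  | @cons x y z hadj q ih =>
    rw [SimpleGraph.Walk.cons_isPath_iff] at hp
    have hA' : {z | z ∈ q.support} ⊆ A := fun z hz => hA (by simp [show z ∈ q.support from hz])
    have h2 := cons x y _ hadj (hA (by simp)) hp.2 ⟨q, hp.1, rfl, hA'⟩ (ih nil cons hp.1 hA')
    convert h2 using 1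
    ext; simp

theorem connectedSet (h : IsPathSet T A P x y) : ConnectedSet T P := by
  have key : ∀ z ∈ P, JoinedWithin T P z y := by
    refine h.induction (motive := fun P _ => ∀ z ∈ P, JoinedWithin T P z y) ?_ ?_
    · rintro - z rfl
      exact .refl rfl
    · intro a b P hab _ _ hP ih z hz
      have hb : JoinedWithin T (insert a P) b y := (ih b hP.start_mem).mono (Set.subset_insert _ _)
      rcases hz with rfl | hz
      · exact (JoinedWithin.of_adj (by simp) hb.left_mem hab).trans hb
      · exact (ih z hz).mono (Set.subset_insert _ _)
  intro a ha b hb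
  exact (key a ha).trans (key b hb).symm

/-- A walk inside `B` shortens to a path, and a forest has only one path between two vertices. -/
theorem subset_of_joinedWithin (hT : T.IsAcyclic) {B : Set W} (h : IsPathSet T A P x y)
    (hB : JoinedWithin T B x y) : P ⊆ B := by
  classical
  obtain ⟨p, hp, rfl, -⟩ := h
  obtain ⟨q, hq⟩ := hB
  intro z hz
  have := (hT.subsingleton_path x y).elim ⟨p, hp⟩ ⟨q.bypass, q.bypass_isPath⟩
  rw [Subtype.mk.injEq] at this
  subst this
  exact hq z (q.support_bypass_subset_support hz)

end IsPathSet

theorem JoinedWithin.exists_isPathSet {A : Set W} {x y : W} (h : JoinedWithin T A x y) :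
    ∃ P, IsPathSet T A P x y := by
  classical
  obtain ⟨q, hq⟩ := h
  exact ⟨_, q.bypass, q.bypass_isPath, rfl, fun z hz => hq z (q.support_bypass_subset_support hz)⟩

theorem IsPathSet.append {A P P' : Set W} {x y x' y' : W} (hP : IsPathSet T A P x y)
    (hP' : IsPathSet T A P' x' y') (hadj : T.Adj y x') (hd : Disjoint P P') :
    IsPathSet T A (P ∪ P') x y' := by
  revert hd
  refine hP.induction (motive := fun P x => Disjoint P P' → IsPathSet T A (P ∪ P') x y') ?_ ?_
  · intro hy hd
    rw [Set.singleton_union]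
    exact hP'.cons hadj hy (Set.disjoint_singleton_left.1 hd)
  · intro a b P hab ha haP _ ih hd
    rw [Set.disjoint_insert_left] at hd
    rw [Set.insert_union]
    exact (ih hd.2).cons hab ha (by simp [haP, hd.1])

/-- Cutting off the part of a path before it first enters `B`. -/
theorem IsPathSet.trim_start {A B P : Set W} {x y : W} (h : IsPathSet T A P x y)
    (hne : (B ∩ P).Nonempty) :
    ∃ x' ∈ B, ∃ P', IsPathSet T A P' x' y ∧ P' ⊆ P ∧ B ∩ P' = B ∩ P ∧ (x ∈ B → x' = x) ∧
      (x ∉ B → ∃ w ∈ P, w ∉ B ∧ T.Adj w x') := by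
  revert hne
  refine h.induction (motive := fun P x => (B ∩ P).Nonempty →
    ∃ x' ∈ B, ∃ P', IsPathSet T A P' x' y ∧ P' ⊆ P ∧ B ∩ P' = B ∩ P ∧ (x ∈ B → x' = x) ∧
      (x ∉ B → ∃ w ∈ P, w ∉ B ∧ T.Adj w x')) ?_ ?_
  · rintro hy ⟨z, hzB, rfl⟩
    exact ⟨z, hzB, {z}, .nil hy, subset_rfl, rfl, fun _ => rfl, fun h => absurd hzB h⟩
  · intro a b P hab ha haP hP ih hne
    by_cases haB : a ∈ B
    · exact ⟨a, haB, _, hP.cons hab ha haP, subset_rfl, rfl, fun _ => rfl, fun h => absurd haB h⟩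
    · have hBP : B ∩ insert a P = B ∩ P := by
        ext z
        simp only [Set.mem_inter_iff, Set.mem_insert_iff]
        constructor
        · rintro ⟨hz, rfl | h⟩
          exacts [absurd hz haB, ⟨hz, h⟩]
        · exact fun h => ⟨h.1, .inr h.2⟩
      rw [hBP] at hne
      obtain ⟨x', hx', P', hP', hsub, heq, h1, h2⟩ := ih hne
      refine ⟨x', hx', P', hP', hsub.trans (Set.subset_insert _ _), heq.trans hBP.symm,
        fun h => absurd h haB, fun _ => ?_⟩
      by_cases hb : b ∈ B
      · exact ⟨a, by simp, haB, by rw [h1 hb]; exact hab⟩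
      · obtain ⟨w, hw, hwB, hadj⟩ := h2 hb
        exact ⟨w, .inr hw, hwB, hadj⟩

/-- In a forest, a path meets a connected set in a path. -/
theorem IsPathSet.inter_connectedSet (hT : T.IsAcyclic) {A B P : Set W} {x y : W}
    (h : IsPathSet T A P x y) (hB : ConnectedSet T B) (hne : (B ∩ P).Nonempty) :
    ∃ x' y', IsPathSet T B (B ∩ P) x' y' ∧ (x ∈ B → x' = x) ∧
      (x ∉ B → ∃ w ∈ P, w ∉ B ∧ T.Adj w x') := by
  -- Both ends are cut back until they lie in `B`. Since `B` joins them, uniqueness of paths puts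
  -- the trimmed path inside `B`, and trimming has lost no point of `B`.
  obtain ⟨x', hx', P', hP', -, heq, h1, h2⟩ := h.trim_start hne
  obtain ⟨y', hy', P'', hP'', -, heq', -, -⟩ := hP'.symm.trim_start (heq ▸ hne)
  have hsub := hP''.subset_of_joinedWithin hT (hB y' hy' x' hx')
  rw [Set.inter_eq_self_of_subset_right hsub, heq] at heq'
  subst heq'
  exact ⟨x', y', (hP''.mono hsub).symm, h1, h2⟩

/-- In a forest, disjoint connected sets are joined by at most one edge. -/
theorem ConnectedSet.adj_unique (hT : T.IsAcyclic) {C Q : Set W} (hC : ConnectedSet T C)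
    (hQ : ConnectedSet T Q) (hd : Disjoint C Q) {c₁ c₂ q₁ q₂ : W} (hc₁ : c₁ ∈ C) (hc₂ : c₂ ∈ C)
    (hq₁ : q₁ ∈ Q) (hq₂ : q₂ ∈ Q) (h₁ : T.Adj q₁ c₁) (h₂ : T.Adj q₂ c₂) : c₁ = c₂ := by
  -- The path from `q₁` to `c₁` and on inside `C` to `c₂` must run along the route through `Q` that
  -- meets `C` only in `c₂`. As `c₁` lies on it, `c₁` is `c₂`.
  obtain ⟨P, hP⟩ := (hC c₁ hc₁ c₂ hc₂).exists_isPathSet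
  have hq : q₁ ∉ P := fun h => hd.notMem_of_mem_left (hP.subset h) hq₁
  have hP' := (hP.mono (Set.subset_insert q₁ P)).cons h₁ (by simp) hq
  have hj : JoinedWithin T (insert c₂ Q) q₁ c₂ :=
    ((hQ q₁ hq₁ q₂ hq₂).mono (Set.subset_insert _ _)).trans
      (.of_adj (by simp [hq₂]) (by simp) h₂)
  rcases hP'.subset_of_joinedWithin hT hj (.inr hP.start_mem) with h | h
  · exact h
  · exact absurd h (hd.notMem_of_mem_left hc₁)

/-! ### Pathwidth and rooted pathwidth of trees -/

theorem ENat.exists_natCast_of_one_add_le {a : ℕ∞} {k : ℕ} (h : 1 + a ≤ ((k + 1 : ℕ) : ℕ∞)) :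
    a ≤ k := by
  push_cast at h
  rw [add_comm] at h
  exact (ENat.add_le_add_iff_right ENat.one_ne_top).1 h

/-- An infimum in `ℕ∞` is attained unless the index set is empty, and then it is `⊤`. So a finite
bound always comes with a witness. -/
theorem iInf_le_natCast_iff {ι : Type*} {g : ι → ℕ∞} {k : ℕ} :
    ⨅ i, g i ≤ (k : ℕ∞) ↔ ∃ i, g i ≤ k := by
  constructor
  · intro h
    cases isEmpty_or_nonempty ι
    · exact absurd h (by rw [iInf_of_isEmpty]; simp)
    · obtain ⟨i, hi⟩ := ciInf_mem g
      exact ⟨i, hi.trans_le h⟩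
  · rintro ⟨i, hi⟩
    exact (iInf_le _ i).trans hi

variable [Finite W]

theorem pathwidthOn_le_zero_iff {A : Set W} : pathwidthOn T A ≤ 0 ↔ A.Subsingleton := by
  rw [pathwidthOn]
  split_ifs with h <;> simp [h]

theorem pathwidthOn_le_succ_iff {A : Set W} {k : ℕ} : pathwidthOn T A ≤ (k + 1 : ℕ) ↔
    A.Subsingleton ∨ ∃ P x y, IsPathSet T A P x y ∧
      ∀ C, IsComponentSet T (A \ P) C → pathwidthOn T C ≤ k := by
  rw [pathwidthOn]
  split_ifs with h
  · simp [h]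
  · simp only [h, false_or]
    constructor
    · intro h
      obtain ⟨⟨P, x, y, hP⟩, h⟩ := iInf_le_natCast_iff.1 (ENat.exists_natCast_of_one_add_le h)
      exact ⟨P, x, y, hP, fun C hC => (le_iSup_of_le ⟨C, hC⟩ le_rfl).trans h⟩
    · rintro ⟨P, x, y, hP, h⟩
      push_cast
      rw [add_comm]
      gcongr
      exact iInf_le_of_le ⟨P, x, y, hP⟩ (iSup_le fun C => h C.1 C.2)

theorem rootedPathwidthOn_le_zero_iff {A : Set W} {r : W} :
    rootedPathwidthOn T A r ≤ 0 ↔ A = ∅ := by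
  rw [rootedPathwidthOn]
  split_ifs with h <;> simp [h]

theorem rootedPathwidthOn_le_succ_iff {A : Set W} {r : W} {k : ℕ} :
    rootedPathwidthOn T A r ≤ (k + 1 : ℕ) ↔ A = ∅ ∨ ∃ P x, IsPathSet T A P x r ∧
      ∀ C, IsComponentSet T (A \ P) C → ∀ c ∈ C, ∀ p ∈ P, T.Adj p c →
        rootedPathwidthOn T C c ≤ k := by
  rw [rootedPathwidthOn]
  split_ifs with h
  · simp [h]
  · simp only [h, false_or]
    constructor
    · intro h
      obtain ⟨⟨P, x, hP⟩, h⟩ := iInf_le_natCast_iff.1 (ENat.exists_natCast_of_one_add_le h)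
      refine ⟨P, x, hP, fun C hC c hc p hp hpc => le_trans ?_ h⟩
      exact le_iSup_of_le ⟨C, hC⟩ (le_iSup_of_le ⟨c, hc, p, hp, hpc⟩ le_rfl)
    · rintro ⟨P, x, hP, h⟩
      push_cast
      rw [add_comm]
      gcongr
      refine iInf_le_of_le ⟨P, x, hP⟩ (iSup_le fun C => iSup_le fun c => ?_)
      obtain ⟨c, hc, p, hp, hpc⟩ := c
      exact h C.1 C.2 c hc p hp hpc

/-- If the main path `P` of `A` misses `B`, then `B` sits in one component of `A \ P`. Otherwise `B
∩ P` is again a path and serves as main path of `B`. -/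
theorem pathwidthOn_mono (hT : T.IsAcyclic) {A B : Set W} (hB : ConnectedSet T B) (hBA : B ⊆ A)
    {k : ℕ} (h : pathwidthOn T A ≤ k) : pathwidthOn T B ≤ k := by
  induction k generalizing A B with
  | zero => exact pathwidthOn_le_zero_iff.2 ((pathwidthOn_le_zero_iff.1 h).anti hBA)
  | succ k ih =>
    rcases pathwidthOn_le_succ_iff.1 h with h | ⟨P, x, y, hP, h⟩
    · exact pathwidthOn_le_succ_iff.2 (.inl (h.anti hBA))
    rcases B.eq_empty_or_nonempty with rfl | hne
    · exact pathwidthOn_le_succ_iff.2 (.inl Set.subsingleton_empty)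
    rcases (B ∩ P).eq_empty_or_nonempty with hd | hd
    · obtain ⟨C, hC, hBC⟩ := hB.exists_component hne (B := A \ P)
        fun z hz => ⟨hBA hz, fun hzP => (hd ▸ ⟨hz, hzP⟩ : z ∈ (∅ : Set W))⟩
      exact (ih hB hBC (h C hC)).trans (by exact_mod_cast Nat.le_succ k)
    · obtain ⟨x', y', hP', -⟩ := hP.inter_connectedSet hT hB hd
      refine pathwidthOn_le_succ_iff.2 (.inr ⟨_, x', y', hP', fun C hC => ?_⟩)
      rw [Set.sdiff_self_inter] at hC
      obtain ⟨C', hC', hCC'⟩ := hC.connectedSet.exists_component hC.nonempty (B := A \ P)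
        (hC.subset.trans (Set.sdiff_subset_sdiff_left hBA))
      exact ih hC.connectedSet hCC' (h C' hC')

/-- If the main path of a connected set ends at the root, the rooted pathwidth is at most one more
than that of the components, which is at most twice their pathwidth plus one. -/
theorem rootedPathwidthOn_le_of_path_end {k : ℕ}
    (ih : ∀ (A : Set W) (c : W), ConnectedSet T A → c ∈ A → pathwidthOn T A ≤ k →
      rootedPathwidthOn T A c ≤ (2 * k + 1 : ℕ)) {A P : Set W} {x y : W}
    (hP : IsPathSet T A P x y) (h : ∀ C, IsComponentSet T (A \ P) C → pathwidthOn T C ≤ k) :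
    rootedPathwidthOn T A x ≤ (2 * k + 1 + 1 : ℕ) :=
  rootedPathwidthOn_le_succ_iff.2 (.inr ⟨P, y, hP.symm, fun C hC c hc _ _ _ =>
    ih C c hC.connectedSet hc (h C hC)⟩)

/-- Delete the path `Q` from the root to an end `x` of the main path `P`. A remaining component that
meets `P` does so in a subpath starting at its own root, and deleting that subpath leaves only parts
of pathwidth at most `k`. So each level of pathwidth costs two levels of rooted pathwidth, and a
single vertex costs one. -/
theorem rootedPathwidthOn_le_of_pathwidthOn_le (hT : T.IsAcyclic) (k : ℕ) :
    ∀ (A : Set W) (c : W), ConnectedSet T A → c ∈ A → pathwidthOn T A ≤ k →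
      rootedPathwidthOn T A c ≤ (2 * k + 1 : ℕ) := by
  have hsub : ∀ (k : ℕ) (A : Set W) (c : W), c ∈ A → A.Subsingleton →
      rootedPathwidthOn T A c ≤ (k + 1 : ℕ) := by
    intro k A c hc hA
    refine rootedPathwidthOn_le_succ_iff.2 (.inr ⟨{c}, c, .nil hc, fun C hC => ?_⟩)
    obtain ⟨z, hz⟩ := hC.nonempty
    exact absurd (hA (hC.subset hz).1 hc) (hC.subset hz).2
  induction k with
  | zero => exact fun A c _ hc h => hsub _ A c hc (pathwidthOn_le_zero_iff.1 h)
  | succ k ih =>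
    intro A c hA hc h
    rcases pathwidthOn_le_succ_iff.1 h with h | ⟨P, x, y, hP, h⟩
    · exact hsub _ A c hc h
    obtain ⟨Q, hQ⟩ := (hA x (hP.subset hP.start_mem) c hc).exists_isPathSet
    refine rootedPathwidthOn_le_succ_iff.2 (.inr ⟨Q, x, hQ, fun C hC d hd q hq hqd => ?_⟩)
    rcases (C ∩ P).eq_empty_or_nonempty with hCP | hCP
    · obtain ⟨C', hC', hCC'⟩ := hC.connectedSet.exists_component hC.nonempty (B := A \ P)
        fun z hz => ⟨(hC.subset hz).1, fun hzP => (hCP ▸ ⟨hz, hzP⟩ : z ∈ (∅ : Set W))⟩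
      refine (ih C d hC.connectedSet hd
        (pathwidthOn_mono hT hC.connectedSet hCC' (h C' hC'))).trans ?_
      exact_mod_cast Nat.le_succ _
    · obtain ⟨x', y', hP', -, hx'⟩ := hP.inter_connectedSet hT hC.connectedSet hCP
      -- As `x` is on `Q`, the piece `C ∩ P` has a predecessor `w` on `P`. It lies on `Q`, since
      -- otherwise it would belong to the component `C`; so the piece starts at the root of `C`.
      have hxC : x ∉ C := fun hx => (hC.subset hx).2 hQ.start_mem
      obtain ⟨w, hwP, hwC, hwx⟩ := hx' hxC
      have hwQ : w ∈ Q := by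
        by_contra hwQ
        exact hwC (hC.mem_of_adj (hP'.subset hP'.start_mem) ⟨hP.subset hwP, hwQ⟩ hwx.symm)
      have hdx : x' = d := hC.connectedSet.adj_unique hT hQ.connectedSet
        (Set.disjoint_left.2 fun z hz => (hC.subset hz).2) (hP'.subset hP'.start_mem) hd hwQ hq
        hwx hqd
      subst hdx
      refine rootedPathwidthOn_le_of_path_end ih hP' fun D hD => ?_
      rw [Set.sdiff_self_inter] at hD
      obtain ⟨C', hC', hDC'⟩ := hD.connectedSet.exists_component hD.nonempty (B := A \ P)
        fun z hz => ⟨(hC.subset (hD.subset hz).1).1, (hD.subset hz).2⟩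
      exact pathwidthOn_mono hT hD.connectedSet hDC' (h C' hC')

/-- The free rooted pathwidth of a tree is at most twice its pathwidth, or one. -/
theorem freeRootedPathwidth_le [Nonempty W] (hT : T.IsAcyclic) (hc : ConnectedSet T Set.univ)
    {k : ℕ} (h : pathwidth T ≤ k) : freeRootedPathwidth T ≤ (max 1 (2 * k) : ℕ) := by
  have key : ∀ {m : ℕ} (r : W), rootedPathwidthOn T Set.univ r ≤ m → m ≤ max 1 (2 * k) →
      freeRootedPathwidth T ≤ (max 1 (2 * k) : ℕ) := fun r hr hm =>
    iInf_le_of_le r (hr.trans (by exact_mod_cast hm))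
  have hzero : pathwidth T ≤ (0 : ℕ) → freeRootedPathwidth T ≤ (max 1 (2 * k) : ℕ) := fun h0 =>
    key (Classical.arbitrary W)
      (rootedPathwidthOn_le_of_pathwidthOn_le hT 0 _ _ hc trivial h0) (by simp)
  cases k with
  | zero => exact hzero h
  | succ k =>
    rcases pathwidthOn_le_succ_iff.1 h with h | ⟨P, x, y, hP, h⟩
    · exact hzero (pathwidthOn_le_zero_iff.2 h)
    -- With the root at an end of the main path no connecting path `Q` is needed, which saves one of
    -- the `2 * (k + 1) + 1` levels.
    · exact key x (rootedPathwidthOn_le_of_path_end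
        (rootedPathwidthOn_le_of_pathwidthOn_le hT k) hP h) (by omega)

/-- A tree from which a path and then at most two further paths, attached to the first, are
deleted. -/
theorem pathwidthOn_le_of_two_fans (hT : T.IsAcyclic) {A P F₁ F₂ : Set W} {d : ℕ} {x y : W}
    (hP : IsPathSet T A P x y)
    (hF₁ : F₁ = ∅ ∨ ∃ a b, IsPathSet T (A \ P) F₁ a b ∧ ∃ s ∈ F₁, ∃ t ∈ P, T.Adj t s)
    (hF₂ : F₂ = ∅ ∨ ∃ a b, IsPathSet T (A \ P) F₂ a b ∧ ∃ s ∈ F₂, ∃ t ∈ P, T.Adj t s)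
    (hd : Disjoint F₁ F₂)
    (h : ∀ C, IsComponentSet T (A \ (P ∪ F₁ ∪ F₂)) C → pathwidthOn T C ≤ d) :
    pathwidthOn T A ≤ (d + 1 + 1 : ℕ) := by
  have h' : ∀ C, ConnectedSet T C → C ⊆ A \ (P ∪ F₁ ∪ F₂) → pathwidthOn T C ≤ d := by
    intro C hC hCA
    rcases C.eq_empty_or_nonempty with rfl | hne
    · exact (pathwidthOn_le_zero_iff.2 Set.subsingleton_empty).trans zero_le
    · obtain ⟨C', hC', hCC'⟩ := hC.exists_component hne hCA
      exact pathwidthOn_mono hT hC hCC' (h C' hC')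
  have key : ∀ F F' : Set W, (∃ a b, IsPathSet T (A \ P) F a b ∧ ∃ s ∈ F, ∃ t ∈ P, T.Adj t s) →
      (F' = ∅ ∨ ∃ a b, IsPathSet T (A \ P) F' a b ∧ ∃ s ∈ F', ∃ t ∈ P, T.Adj t s) →
      Disjoint F F' → (∀ C, ConnectedSet T C → C ⊆ A \ (P ∪ F ∪ F') → pathwidthOn T C ≤ d) →
      ∀ C, IsComponentSet T (A \ P) C → (C ∩ F).Nonempty → pathwidthOn T C ≤ (d + 1 : ℕ) := by
    rintro F F' ⟨a, b, hF, s, hs, t, ht, hts⟩ hF' hd h C hC ⟨z, hzC, hzF⟩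
    have hFC : F ⊆ C := hC.subset_of_connectedSet hF.connectedSet hF.subset hzF hzC
    refine pathwidthOn_le_succ_iff.2 (.inr ⟨F, a, b, hF.mono hFC, fun D hD => ?_⟩)
    refine h D hD.connectedSet fun v hv => ?_
    obtain ⟨hvC, hvF⟩ := hD.subset hv
    refine ⟨(hC.subset hvC).1, ?_⟩
    rintro ((hvP | hvF') | hvF')
    · exact (hC.subset hvC).2 hvP
    · exact hvF hvF'
    · rcases hF' with rfl | ⟨a', b', hF', s', hs', t', ht', hts'⟩
      · exact hvF'
      · have hF'C : F' ⊆ C := hC.subset_of_connectedSet hF'.connectedSet hF'.subset hvF' hvC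
        -- `C` is attached to `P` at a single vertex, which both fans would have to contain.
        have := hC.connectedSet.adj_unique hT hP.connectedSet
          (Set.disjoint_left.2 fun z hz => (hC.subset hz).2) (hFC hs) (hF'C hs') ht ht' hts hts'
        subst this
        exact hd.notMem_of_mem_left hs hs'
  refine pathwidthOn_le_succ_iff.2 (.inr ⟨P, x, y, hP, fun C hC => ?_⟩)
  by_cases h1 : (C ∩ F₁).Nonempty
  · refine key F₁ F₂ (hF₁.resolve_left ?_) hF₂ hd h' C hC h1
    rintro rfl
    simp at h1
  by_cases h2 : (C ∩ F₂).Nonempty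
  · refine key F₂ F₁ (hF₂.resolve_left ?_) hF₁ hd.symm ?_ C hC h2
    · rintro rfl
      simp at h2
    · intro D hD hDA
      refine h' D hD ?_
      rwa [Set.union_right_comm]
  · refine (h' C hC.connectedSet fun z hz => ⟨(hC.subset hz).1, ?_⟩).trans
      (by exact_mod_cast Nat.le_succ d)
    rintro ((hz' | hz') | hz')
    exacts [(hC.subset hz).2 hz', h1 ⟨z, hz, hz'⟩, h2 ⟨z, hz, hz'⟩]

/-- A root of a tree that is attained by an optimal path can be moved to a leaf. -/
theorem exists_leaf_rootedPathwidthOn_le (hT : T.IsAcyclic) {k : ℕ} {r : W}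
    (h : rootedPathwidthOn T Set.univ r ≤ k) :
    ∃ r', rootedPathwidthOn T Set.univ r' ≤ k ∧
      ∀ s t, T.Adj r' s → T.Adj r' t → s = t := by
  have hne : (Set.univ : Set W) ≠ ∅ := (Set.nonempty_of_mem (Set.mem_univ r)).ne_empty
  cases k with
  | zero => exact absurd (rootedPathwidthOn_le_zero_iff.1 h) hne
  | succ m =>
    obtain ⟨P, x, hP, hC⟩ := (rootedPathwidthOn_le_succ_iff.1 h).resolve_left hne
    obtain ⟨P, x, r, hP, hC, hr⟩ : ∃ P x r, IsPathSet T Set.univ P x r ∧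
        (∀ C, IsComponentSet T (Set.univ \ P) C → ∀ c ∈ C, ∀ p ∈ P, T.Adj p c →
          rootedPathwidthOn T C c ≤ m) ∧ ∀ s, T.Adj r s → s ∈ P := by
      clear h
      -- `N` bounds the number of vertices off `P`. While the end `r` has a neighbour `n` off `P`,
      -- the path is prolonged by an optimal path of the component of `n`.
      obtain ⟨N, hN⟩ : ∃ N, Nat.card W ≤ P.ncard + N := ⟨_, Nat.le_add_left _ _⟩
      induction N generalizing P x r with
      | zero =>
        have : P = Set.univ := Set.eq_of_subset_of_ncard_le (Set.subset_univ P)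
          (by simpa [Set.ncard_univ] using hN)
        exact ⟨P, x, r, hP, hC, by simp [this]⟩
      | succ N ih =>
        by_cases hr : ∀ s, T.Adj r s → s ∈ P
        · exact ⟨P, x, r, hP, hC, hr⟩
        push Not at hr
        obtain ⟨n, hrn, hnP⟩ := hr
        have hn : n ∈ Set.univ \ P := ⟨trivial, hnP⟩
        obtain ⟨C, hCc, hnC⟩ : ∃ C, IsComponentSet T (Set.univ \ P) C ∧ n ∈ C :=
          ⟨_, isComponentSet_of_mem hn, .refl hn⟩
        have hCn := hC C hCc n hnC r hP.end_mem hrn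
        have hCP : Disjoint C P := Set.disjoint_left.2 fun z hz => (hCc.subset hz).2
        cases m with
        | zero => exact absurd (rootedPathwidthOn_le_zero_iff.1 hCn) hCc.nonempty.ne_empty
        | succ m =>
          obtain ⟨P', x', hP', hD⟩ :=
            (rootedPathwidthOn_le_succ_iff.1 hCn).resolve_left hCc.nonempty.ne_empty
          have hdisj : Disjoint P P' := hCP.symm.mono_right hP'.subset
          refine ih (P ∪ P') x (hP.append (hP'.symm.mono (Set.subset_univ _)) hrn hdisj) ?_ ?_
          · intro D hDc d hd p hp hpd
            have hDP : ∀ z ∈ D, z ∉ P ∧ z ∉ P' := fun z hz => by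
              simpa [not_or] using (hDc.subset hz).2
            -- A component left by the longer path is either a part of `C` left by `P'`, or it
            -- avoids `C` and was a component before.
            by_cases hDC : (D ∩ C).Nonempty
            · obtain ⟨z, hzD, hzC⟩ := hDC
              have hsub : D ⊆ C := hCc.subset_of_connectedSet hDc.connectedSet
                (fun v hv => ⟨trivial, (hDP v hv).1⟩) hzD hzC
              have hpP : p ∉ P := by
                intro hp
                have := hCc.connectedSet.adj_unique hT hP.connectedSet hCP (hsub hd) hnC hp
                  hP.end_mem hpd hrn
                exact (hDP d hd).2 (this ▸ hP'.end_mem)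
              refine (hD D ?_ d hd p (hp.resolve_left hpP) hpd).trans
                (by exact_mod_cast Nat.le_succ m)
              refine .of_connectedSet hDc.connectedSet hDc.nonempty
                (fun v hv => ⟨hsub hv, (hDP v hv).2⟩) fun a ha b hb hab => ?_
              refine hDc.mem_of_adj ha ⟨trivial, ?_⟩ hab
              rintro (hb' | hb')
              exacts [(hCc.subset hb.1).2 hb', hb.2 hb']
            · have hdC : ∀ z ∈ D, z ∉ C := fun z hz hz' => hDC ⟨z, hz, hz'⟩
              have hnot : ∀ z ∈ D, ∀ w, T.Adj z w → w ∉ P' := fun z hz w hzw hw =>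
                hdC z hz (hCc.mem_of_adj (hP'.subset hw) ⟨trivial, (hDP z hz).1⟩ hzw.symm)
              refine hC D ?_ d hd p (hp.resolve_right (hnot d hd p hpd.symm)) hpd
              refine .of_connectedSet hDc.connectedSet hDc.nonempty
                (fun v hv => ⟨trivial, (hDP v hv).1⟩) fun a ha b hb hab => ?_
              refine hDc.mem_of_adj ha ⟨trivial, ?_⟩ hab
              rintro (hb' | hb')
              exacts [hb.2 hb', hnot a ha b hab hb']
          · rw [Set.ncard_union_eq hdisj (Set.toFinite _) (Set.toFinite _)]
            have : 0 < P'.ncard := (Set.ncard_pos (Set.toFinite _)).2 ⟨_, hP'.end_mem⟩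
            omega
    refine ⟨r, rootedPathwidthOn_le_succ_iff.2 (.inr ⟨P, x, hP, hC⟩), fun s t hs ht => ?_⟩
    -- All neighbours of `r` are on the path, and in a forest the rest of the path has only one
    -- vertex adjacent to its end.
    rcases hP.symm.eq_or_cons with ⟨-, rfl⟩ | ⟨y, P', -, hrP', rfl, hP'⟩
    · exact absurd (hr s hs) hs.ne'
    · exact hP'.connectedSet.adj_unique hT (Q := {r}) (by simp [ConnectedSet, JoinedWithin.refl])
        (by simpa using hrP') ((hr s hs).resolve_left hs.ne') ((hr t ht).resolve_left ht.ne')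
        rfl rfl hs ht

end TreeWidths

/-! ### Noncrossing orders and triangulations -/

section Noncrossing

variable {V : Type*} {G : SimpleGraph V} {f : V → ℤ}

/-- The order of the vertices given by `f` shows that `G` is outerplanar. -/
structure IsNoncrossing (G : SimpleGraph V) (f : V → ℤ) : Prop where
  inj : Function.Injective f
  not_cross : ∀ a b c d : V, f a < f b → f b < f c → f c < f d → G.Adj a c → G.Adj b d → False

theorem IsOuterplanar.exists_isNoncrossing (h : IsOuterplanar G) : ∃ f, IsNoncrossing G f := by
  obtain ⟨f, hf, h⟩ := h
  refine ⟨fun v => f v, fun a b hab => hf (by exact_mod_cast hab), ?_⟩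
  intro a b c d hab hbc hcd hac hbd
  exact h a b c d (by exact_mod_cast hab) (by exact_mod_cast hbc) (by exact_mod_cast hcd)
    ⟨hac, hbd⟩

theorem exists_lt_add [Finite V] (f : V → ℤ) : ∃ M, ∀ v w, f v < f w + M := by
  obtain ⟨a, ha⟩ := (Set.finite_range f).bddAbove
  obtain ⟨b, hb⟩ := (Set.finite_range f).bddBelow
  refine ⟨a - b + 1, fun v w => ?_⟩
  have := ha ⟨v, rfl⟩
  have := hb ⟨w, rfl⟩
  omega

theorem IsNoncrossing.isOuterplanar [Finite V] (h : IsNoncrossing G f) : IsOuterplanar G := by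
  obtain ⟨b, hb⟩ := (Set.finite_range f).bddBelow
  have hb' : ∀ v, b ≤ f v := fun v => hb ⟨v, rfl⟩
  have key : ∀ v w, (f v - b).toNat < (f w - b).toNat ↔ f v < f w := by
    intro v w
    have := hb' v
    have := hb' w
    omega
  refine ⟨fun v => (f v - b).toNat, fun v w hvw => h.inj ?_, ?_⟩
  · have := hb' v
    have := hb' w
    simp only at hvw
    omega
  · intro p q r s hpq hqr hrs hadj
    exact h.not_cross p q r s ((key _ _).1 hpq) ((key _ _).1 hqr) ((key _ _).1 hrs) hadj.1 hadj.2

theorem IsNoncrossing.mono {G' : SimpleGraph V} (h : IsNoncrossing G f) (hG : G' ≤ G) :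
    IsNoncrossing G' f :=
  ⟨h.inj, fun a b c d hab hbc hcd hac hbd => h.not_cross a b c d hab hbc hcd (hG hac) (hG hbd)⟩

theorem IsNoncrossing.neg (h : IsNoncrossing G f) : IsNoncrossing G (fun v => -f v) := by
  refine ⟨fun a b hab => h.inj (neg_injective hab), fun a b c d hab hbc hcd hac hbd => ?_⟩
  exact h.not_cross d c b a (by omega) (by omega) (by omega) hbd.symm hac.symm

/-- The order in which the vertices below `t` are moved behind all others. -/
def rotateOrder (f : V → ℤ) (t M : ℤ) (v : V) : ℤ := if f v < t then f v + M else f v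

/-- Whether chords of a circle cross does not depend on where the circle is cut open. `M` exceeds
the spread of `f`, so the moved vertices come last and stay in order. -/
theorem IsNoncrossing.rotate (h : IsNoncrossing G f) {M : ℤ} (hM : ∀ v w, f v < f w + M) (t : ℤ) :
    IsNoncrossing G (rotateOrder f t M) := by
  refine ⟨fun a b hab => h.inj ?_, fun a b c d hab hbc hcd hac hbd => ?_⟩
  · unfold rotateOrder at hab
    have := hM a b
    have := hM b a
    split_ifs at hab <;> omega
  · unfold rotateOrder at hab hbc hcd
    have h1 := hM a b
    have h2 := hM a c
    have h3 := hM a d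
    have h4 := hM b c
    have h5 := hM b d
    have h6 := hM c d
    have h7 := hM b a
    have h8 := hM c b
    have h9 := hM d c
    have h10 := hM d a
    by_cases ha : f a < t <;> by_cases hb : f b < t <;> by_cases hc : f c < t <;>
      by_cases hd : f d < t <;> simp only [ha, hb, hc, hd, if_true, if_false] at hab hbc hcd <;>
      first
      | (exfalso; omega)
      | exact h.not_cross a b c d (by omega) (by omega) (by omega) hac hbd
      | exact h.not_cross d a b c (by omega) (by omega) (by omega) hbd.symm hac
      | exact h.not_cross c d a b (by omega) (by omega) (by omega) hac.symm hbd.symm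
      | exact h.not_cross b c d a (by omega) (by omega) (by omega) hbd hac.symm

/-- A noncrossing graph on `n ≥ 2` vertices has at most `2n - 3` edges: each edge is the longest
one to the right of its left end or the longest one to the left of its right end. -/
theorem IsNoncrossing.ncard_edgeSet_le [Finite V] (h : IsNoncrossing G f) (hV : 2 ≤ Nat.card V) :
    G.edgeSet.ncard + 3 ≤ 2 * Nat.card V := by
  have : Nontrivial V := Finite.one_lt_card_iff_nontrivial.1 hV
  obtain ⟨top, htop⟩ := Finite.exists_max f
  obtain ⟨bot, hbot⟩ := Finite.exists_min f
  have hne : bot ≠ top := by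
    rintro rfl
    obtain ⟨v, hv⟩ := exists_ne bot
    exact hv (h.inj (le_antisymm (htop v) (hbot v)))
  let A : Set (V × V) := {p | G.Adj p.1 p.2 ∧ f p.1 < f p.2 ∧ ∀ c, G.Adj p.1 c → f c ≤ f p.2}
  let B : Set (V × V) := {p | G.Adj p.1 p.2 ∧ f p.1 < f p.2 ∧ ∃ c, G.Adj p.1 c ∧ f p.2 < f c}
  have hE : G.edgeSet ⊆ (fun p : V × V => s(p.1, p.2)) '' (A ∪ B) := by
    have key : ∀ a c, G.Adj a c → f a < f c →
        s(a, c) ∈ (fun p : V × V => s(p.1, p.2)) '' (A ∪ B) := by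
      intro a c hac hlt
      refine ⟨(a, c), ?_, rfl⟩
      by_cases hc : ∀ c', G.Adj a c' → f c' ≤ f c
      · exact .inl ⟨hac, hlt, hc⟩
      · push Not at hc
        exact .inr ⟨hac, hlt, hc⟩
    intro e
    induction e using Sym2.ind with
    | _ a c =>
      intro hac
      rw [SimpleGraph.mem_edgeSet] at hac
      rcases lt_or_gt_of_ne (h.inj.ne hac.ne) with hlt | hlt
      · exact key a c hac hlt
      · rw [Sym2.eq_swap]
        exact key c a hac.symm hlt
  have hA : A.ncard ≤ ({top}ᶜ : Set V).ncard := by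
    refine Set.ncard_le_ncard_of_injOn Prod.fst ?_ ?_ (Set.toFinite _)
    · rintro ⟨a, c⟩ ⟨-, hlt, -⟩ heq
      rw [Set.mem_singleton_iff] at heq
      subst heq
      exact absurd (htop c) (not_le.2 hlt)
    · rintro ⟨a, c⟩ ⟨hac, -, hc⟩ ⟨a', c'⟩ ⟨hac', -, hc'⟩ heq
      change a = a' at heq
      subst heq
      rw [h.inj (le_antisymm (hc' c hac) (hc c' hac'))]
  have hB : B.ncard ≤ ({bot, top}ᶜ : Set V).ncard := by
    refine Set.ncard_le_ncard_of_injOn Prod.snd ?_ ?_ (Set.toFinite _)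
    · rintro ⟨a, c⟩ ⟨-, hlt, c', -, hlt'⟩ heq
      rcases heq with heq | heq
      · change c = bot at heq
        subst heq
        exact absurd (hbot a) (not_le.2 hlt)
      · change c = top at heq
        subst heq
        exact absurd (htop c') (not_le.2 hlt')
    · rintro ⟨a, c⟩ ⟨hac, hlt, d, had, hd⟩ ⟨a', c'⟩ ⟨hac', hlt', d', had', hd'⟩ heq
      change c = c' at heq
      subst heq
      simp only at hac hlt had hd hac' hlt' had' hd'
      -- If two such edges had the same right end but different left ends, the outer one would cross
      -- the longer edge that starts at the inner left end.
      rcases lt_trichotomy (f a) (f a') with haa | haa | haa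
      · exact (h.not_cross a a' c d' haa hlt' hd' hac had').elim
      · rw [h.inj haa]
      · exact (h.not_cross a' a c d haa hlt hd hac' had).elim
  have h1 := Set.ncard_compl ({top} : Set V)
  have h2 := Set.ncard_compl ({bot, top} : Set V)
  rw [Set.ncard_singleton] at h1
  rw [Set.ncard_pair hne] at h2
  have h3 := (Set.ncard_le_ncard hE).trans (Set.ncard_image_le (Set.toFinite _))
  have h4 := Set.ncard_union_le A B
  omega

/-- An outerplanar supergraph also has at most `2n - 3` edges, so there is no room for a further
edge. -/
theorem isMaximalOuterplanar_of_ncard_edgeSet [Finite V] (hG : IsOuterplanar G)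
    (hV : 2 ≤ Nat.card V) (hE : 2 * Nat.card V ≤ G.edgeSet.ncard + 3) :
    IsMaximalOuterplanar G := by
  refine ⟨hG, fun K hK hGK => ?_⟩
  obtain ⟨f, hf⟩ := IsOuterplanar.exists_isNoncrossing hK
  have h1 := hf.ncard_edgeSet_le hV
  have h2 : G.edgeSet = K.edgeSet :=
    Set.eq_of_subset_of_ncard_le (SimpleGraph.edgeSet_mono hGK) (by omega)
  exact (SimpleGraph.edgeSet_inj.1 h2).ge

/-! ### Maximal outerplanar graphs as triangulated polygons -/

/-- The order given by `f` exhibits `G` as a triangulated polygon. -/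
structure IsTriangulation (G : SimpleGraph V) (f : V → ℤ) : Prop extends IsNoncrossing G f where
  adj_of_consecutive : ∀ a b, f a < f b → (∀ x, f a < f x → f b ≤ f x) → G.Adj a b
  adj_of_extreme : ∀ a b, f a < f b → (∀ x, f a ≤ f x ∧ f x ≤ f b) → G.Adj a b
  exists_mid : ∀ a b, G.Adj a b → (∃ x, f a < f x ∧ f x < f b) →
    ∃ w, f a < f w ∧ f w < f b ∧ G.Adj a w ∧ G.Adj w b
  exists_outer : ∀ a b, G.Adj a b → f a < f b → (∃ x, f x < f a ∨ f b < f x) →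
    ∃ w, (f w < f a ∨ f b < f w) ∧ G.Adj a w ∧ G.Adj w b

/-- By `h` no edge crosses the chord `ab`, so it can be added without losing outerplanarity;
maximality says that it is already there. -/
theorem IsMaximalOuterplanar.adj_of_not_cross [Finite V] (hG : IsMaximalOuterplanar G)
    (hf : IsNoncrossing G f) {a b : V} (hab : f a < f b)
    (h : ∀ c d, G.Adj c d → f a < f c → f c < f b → f a ≤ f d ∧ f d ≤ f b) : G.Adj a b := by
  have hK : IsNoncrossing (G ⊔ SimpleGraph.edge a b) f := by
    refine ⟨hf.inj, fun p q r s hpq hqr hrs hpr hqs => ?_⟩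
    have hedge : ∀ x y, (SimpleGraph.edge a b).Adj x y → f x < f y → x = a ∧ y = b := by
      intro x y hxy hlt
      rw [SimpleGraph.edge_adj] at hxy
      rcases hxy.1 with h | h
      · exact h
      · rw [h.1, h.2] at hlt
        omega
    rcases hpr with hpr | hpr <;> rcases hqs with hqs | hqs
    · exact hf.not_cross p q r s hpq hqr hrs hpr hqs
    · obtain ⟨rfl, rfl⟩ := hedge _ _ hqs (hqr.trans hrs)
      have := (h r p hpr.symm hqr hrs).1
      omega
    · obtain ⟨rfl, rfl⟩ := hedge _ _ hpr (hpq.trans hqr)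
      have := (h q s hqs hpq hqr).2
      omega
    · obtain ⟨rfl, rfl⟩ := hedge _ _ hqs (hqr.trans hrs)
      obtain ⟨rfl, rfl⟩ := hedge _ _ hpr (hpq.trans hqr)
      omega
  have hle := hG.2 hK.isOuterplanar le_sup_left
  refine hle (.inr ?_)
  rw [SimpleGraph.edge_adj]
  exact ⟨.inl ⟨rfl, rfl⟩, fun h => by rw [h] at hab; omega⟩

/-- The apex is the last neighbour `w` of `a` before `b`. An edge crossing `wb` would cross `ab` or
`aw`, or would end at `a` and contradict the choice of `w`. -/
theorem IsMaximalOuterplanar.exists_mid [Finite V] (hG : IsMaximalOuterplanar G)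
    (hf : IsNoncrossing G f) {a b : V} (hab : G.Adj a b) (hx : ∃ x, f a < f x ∧ f x < f b) :
    ∃ w, f a < f w ∧ f w < f b ∧ G.Adj a w ∧ G.Adj w b := by
  obtain ⟨s, ⟨has, hsb⟩, hs⟩ := Set.exists_min_image {x | f a < f x ∧ f x < f b} f
    (Set.toFinite _) hx
  have hadj : G.Adj a s := by
    refine hG.adj_of_not_cross hf has fun c d _ hac hcs => ?_
    have := hs c ⟨hac, by omega⟩
    omega
  obtain ⟨w, ⟨⟨haw, hwb⟩, hadj⟩, hw⟩ := Set.exists_max_image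
    {x | (f a < f x ∧ f x < f b) ∧ G.Adj a x} f (Set.toFinite _) ⟨s, ⟨has, hsb⟩, hadj⟩
  refine ⟨w, haw, hwb, hadj, hG.adj_of_not_cross hf hwb fun c d hcd hwc hcb => ?_⟩
  by_contra hd
  have had : f a ≤ f d ∧ f d ≤ f b := by
    by_contra h
    rcases lt_or_ge (f d) (f a) with h1 | h1
    · exact hf.not_cross d a c b h1 (by omega) hcb hcd.symm hab
    · exact hf.not_cross a c b d (by omega) hcb (by omega) hab hcd
  rcases had.1.eq_or_lt with heq | hlt
  · obtain rfl := hf.inj heq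
    have := hw c ⟨⟨by omega, hcb⟩, hcd.symm⟩
    omega
  · exact hf.not_cross a d w c hlt (by omega) hwc hadj hcd.symm

theorem IsMaximalOuterplanar.isTriangulation [Finite V] (hG : IsMaximalOuterplanar G)
    (hf : IsNoncrossing G f) : IsTriangulation G f where
  toIsNoncrossing := hf
  adj_of_consecutive a b hab h := hG.adj_of_not_cross hf hab fun c d _ hac hcb => by
    have := h c hac
    omega
  adj_of_extreme a b hab h := hG.adj_of_not_cross hf hab fun c d _ _ _ => h d
  exists_mid a b hab hx := hG.exists_mid hf hab hx
  exists_outer a b hab hlt hx := by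
    -- Cutting the circle open at `b` turns the far side of `ab` into the inside of `ba`.
    obtain ⟨M, hM⟩ := exists_lt_add f
    obtain ⟨w, h1, h2, h3, h4⟩ := hG.exists_mid (hf.rotate hM (f b)) hab.symm (by
      obtain ⟨x, hx⟩ := hx
      refine ⟨x, ?_⟩
      have := hM b x
      have := hM x a
      simp only [rotateOrder, hlt, if_true, lt_irrefl, if_false]
      split_ifs <;> omega)
    refine ⟨w, ?_, h4.symm, h3.symm⟩
    have := hM b w
    have := hM w a
    simp only [rotateOrder, hlt, if_true, lt_irrefl, if_false] at h1 h2
    split_ifs at h1 h2 <;> omega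

namespace IsTriangulation

variable (h : IsTriangulation G f) {a b c d w w' : V}
include h

theorem lt_or_gt_of_ne (hab : a ≠ b) : f a < f b ∨ f b < f a :=
  _root_.lt_or_gt_of_ne (h.inj.ne hab)

/-- An edge with one end strictly inside the interval of another edge stays in this interval. -/
theorem mem_Icc_of_adj (hab : G.Adj a b) (hcd : G.Adj c d) (hac : f a < f c) (hcb : f c < f b) :
    f a ≤ f d ∧ f d ≤ f b := by
  by_contra hd
  rcases lt_or_ge (f d) (f a) with h1 | h1
  · exact h.not_cross d a c b h1 hac hcb hcd.symm hab
  · exact h.not_cross a c b d hac hcb (by omega) hab hcd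

/-- With two apexes under `ab`, the edge from `a` to the farther one crosses the edge from the
nearer one to `b`. -/
theorem mid_unique (hwb : f w < f b) (haw : f a < f w) (hw1 : G.Adj a w)
    (hw2 : G.Adj w b) (haw' : f a < f w') (hwb' : f w' < f b) (hw1' : G.Adj a w')
    (hw2' : G.Adj w' b) : w = w' := by
  rcases lt_trichotomy (f w) (f w') with hlt | heq | hlt
  · exact (h.not_cross a w w' b haw hlt hwb' hw1' hw2).elim
  · exact h.inj heq
  · exact (h.not_cross a w' w b haw' hlt hwb hw1 hw2').elim

theorem outer_unique (hab : f a < f b) (hw : f w < f a ∨ f b < f w) (hw1 : G.Adj a w)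
    (hw2 : G.Adj w b) (hw' : f w' < f a ∨ f b < f w') (hw1' : G.Adj a w')
    (hw2' : G.Adj w' b) : w = w' := by
  by_contra hne
  rcases h.lt_or_gt_of_ne hne with hlt | hlt <;> rcases hw with hw | hw <;>
    rcases hw' with hw' | hw'
  · exact h.not_cross w w' a b hlt hw' hab hw1.symm hw2'
  · exact h.not_cross w a b w' hw hab hw' hw2 hw1'
  · omega
  · exact h.not_cross a b w w' hab hw hlt hw1 hw2'.symm
  · exact h.not_cross w' w a b hlt hw hab hw1'.symm hw2
  · omega
  · exact h.not_cross w' a b w hw' hab hw hw2' hw1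
  · exact h.not_cross a b w' w hab hw' hlt hw1' hw2.symm

end IsTriangulation

end Noncrossing

/-! ### The dual tree of a triangulated polygon -/

section Faces

variable {V : Type*} {K : SimpleGraph V}

theorem Face.adj (t : Face K) {x y : V} (hx : x ∈ t.1) (hy : y ∈ t.1) (hne : x ≠ y) :
    K.Adj x y :=
  t.2.isClique hx hy hne

theorem Face.exists_third (t : Face K) {x y : V} (hx : x ∈ t.1) (hy : y ∈ t.1) (hne : x ≠ y) :
    ∃ w, w ≠ x ∧ w ≠ y ∧ ∀ z, z ∈ t.1 ↔ z = x ∨ z = y ∨ z = w := by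
  classical
  obtain ⟨a, b, c, hab, hac, hbc, ht⟩ := SimpleGraph.is3Clique_iff.1 t.2
  have := hab.ne
  have := hac.ne
  have := hbc.ne
  simp only [ht, Finset.mem_insert, Finset.mem_singleton] at hx hy ⊢
  rcases hx with rfl | rfl | rfl <;> rcases hy with rfl | rfl | rfl <;> first
    | exact absurd rfl hne
    | exact ⟨a, by tauto, by tauto, by tauto⟩
    | exact ⟨b, by tauto, by tauto, by tauto⟩
    | exact ⟨c, by tauto, by tauto, by tauto⟩

theorem Face.exists_of_adj {x y z : V} (hxy : K.Adj x y) (hyz : K.Adj y z) (hxz : K.Adj x z) :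
    ∃ t : Face K, ∀ v, v ∈ t.1 ↔ v = x ∨ v = y ∨ v = z := by
  classical
  exact ⟨⟨{x, y, z}, SimpleGraph.is3Clique_triple_iff.2 ⟨hxy, hxz, hyz⟩⟩, by simp⟩

theorem Face.ext_iff_mem {s t : Face K} : s = t ↔ ∀ v, v ∈ s.1 ↔ v ∈ t.1 :=
  ⟨by rintro rfl v; rfl, fun h => Subtype.ext (Finset.ext h)⟩

theorem dualTree_adj_iff {s t : Face K} : (dualTree K).Adj s t ↔
    s ≠ t ∧ ∃ x y, x ≠ y ∧ (x ∈ s.1 ∧ y ∈ s.1) ∧ x ∈ t.1 ∧ y ∈ t.1 := by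
  constructor
  · rintro ⟨hne, e, ⟨he, hs⟩, -, ht⟩
    induction e using Sym2.ind with
    | _ x y =>
      exact ⟨hne, x, y, SimpleGraph.Adj.ne he, ⟨hs _ (by simp), hs _ (by simp)⟩, ht _ (by simp),
        ht _ (by simp)⟩
  · rintro ⟨hne, x, y, hxy, ⟨hxs, hys⟩, hxt, hyt⟩
    refine ⟨hne, s(x, y), ⟨s.adj hxs hys hxy, ?_⟩, s.adj hxs hys hxy, ?_⟩ <;>
      simp [*]

end Faces

section DualTree

variable {V : Type*} {G : SimpleGraph V} {f : V → ℤ}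

/-- The faces all of whose vertices lie between `a` and `b`. -/
def facesWithin (G : SimpleGraph V) (f : V → ℤ) (a b : V) : Set (Face G) :=
  {t | ∀ x ∈ t.1, f a ≤ f x ∧ f x ≤ f b}

/-- The vertices of the face `t` are `a`, `w` and `b`, in this order. -/
structure IsFaceTriple (f : V → ℤ) (t : Face G) (a w b : V) : Prop where
  left_lt : f a < f w
  lt_right : f w < f b
  mem_iff : ∀ x, x ∈ t.1 ↔ x = a ∨ x = w ∨ x = b

namespace IsFaceTriple

variable {t t' : Face G} {a w b : V} (h : IsFaceTriple f t a w b)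
include h

theorem left_mem : a ∈ t.1 := by simp [h.mem_iff]
theorem mid_mem : w ∈ t.1 := by simp [h.mem_iff]
theorem right_mem : b ∈ t.1 := by simp [h.mem_iff]

theorem lt : f a < f b := h.left_lt.trans h.lt_right

theorem adj_left : G.Adj a w :=
  t.adj h.left_mem h.mid_mem fun e => (e ▸ h.left_lt).false

theorem adj_right : G.Adj w b :=
  t.adj h.mid_mem h.right_mem fun e => (e ▸ h.lt_right).false

theorem adj : G.Adj a b :=
  t.adj h.left_mem h.right_mem fun e => (e ▸ h.lt).false

theorem mem_facesWithin : t ∈ facesWithin G f a b := by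
  intro x hx
  have := h.left_lt
  have := h.lt_right
  rcases (h.mem_iff x).1 hx with rfl | rfl | rfl <;> omega

theorem eq_of_triple (h' : IsFaceTriple f t' a w b) : t = t' :=
  Face.ext_iff_mem.2 fun v => (h.mem_iff v).trans (h'.mem_iff v).symm

end IsFaceTriple

theorem IsNoncrossing.exists_isFaceTriple (h : IsNoncrossing G f) (t : Face G) :
    ∃ a w b, IsFaceTriple f t a w b := by
  classical
  obtain ⟨a, b, c, hab, hac, hbc, ht⟩ := SimpleGraph.is3Clique_iff.1 t.2
  have h1 := h.inj.ne hab.ne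
  have h2 := h.inj.ne hac.ne
  have h3 := h.inj.ne hbc.ne
  have hm : ∀ x, x ∈ t.1 ↔ x = a ∨ x = b ∨ x = c := by simp [ht]
  rcases lt_or_gt_of_ne h1 with h1 | h1 <;> rcases lt_or_gt_of_ne h2 with h2 | h2 <;>
    rcases lt_or_gt_of_ne h3 with h3 | h3
  · exact ⟨a, b, c, h1, h3, hm⟩
  · exact ⟨a, c, b, h2, h3, fun x => by rw [hm]; tauto⟩
  · omega
  · exact ⟨c, a, b, h2, h1, fun x => by rw [hm]; tauto⟩
  · exact ⟨b, a, c, h1, h2, fun x => by rw [hm]; tauto⟩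
  · omega
  · exact ⟨b, c, a, h3, h2, fun x => by rw [hm]; tauto⟩
  · exact ⟨c, b, a, h3, h1, fun x => by rw [hm]; tauto⟩

theorem exists_isFaceTriple_of_adj {a w b : V} (haw : f a < f w) (hwb : f w < f b)
    (h1 : G.Adj a w) (h2 : G.Adj w b) (h3 : G.Adj a b) : ∃ t, IsFaceTriple (G := G) f t a w b :=
  (Face.exists_of_adj h1 h2 h3).imp fun _ ht => ⟨haw, hwb, ht⟩

namespace IsTriangulation

variable (h : IsTriangulation G f) {a b x z w : V} {s t : Face G}
include h

theorem exists_faceTriple_of_between (hab : G.Adj a b) (hx : f a < f x) (hxb : f x < f b) :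
    ∃ t w, IsFaceTriple (G := G) f t a w b := by
  obtain ⟨w, h1, h2, h3, h4⟩ := h.exists_mid a b hab ⟨x, hx, hxb⟩
  obtain ⟨t, ht⟩ := exists_isFaceTriple_of_adj h1 h2 h3 h4 hab
  exact ⟨t, w, ht⟩

/-- A face not within `[x, z]` has no vertices strictly between `x` and `z`. -/
theorem not_between_of_notMem_facesWithin (hxz : G.Adj x z) (ht : t ∉ facesWithin G f x z) {v : V}
    (hv : v ∈ t.1) : ¬(f x < f v ∧ f v < f z) := by
  rintro ⟨h1, h2⟩
  refine ht fun u hu => ?_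
  by_cases huv : v = u
  · subst huv
    exact ⟨h1.le, h2.le⟩
  · exact h.mem_Icc_of_adj hxz (t.adj hv hu huv) h1 h2

/-- The two ends of a crossing from the faces within `[x, z]` to the others contain `x` and
`z`. -/
theorem mem_of_adj_of_notMem_facesWithin (hxz : G.Adj x z) (hlt : f x < f z)
    (hs : s ∈ facesWithin G f x z) (ht : t ∉ facesWithin G f x z) (hst : (dualTree G).Adj s t) :
    (x ∈ s.1 ∧ z ∈ s.1) ∧ x ∈ t.1 ∧ z ∈ t.1 := by
  obtain ⟨-, p, q, hpq, ⟨hps, hqs⟩, hpt, hqt⟩ := dualTree_adj_iff.1 hst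
  have hp := h.not_between_of_notMem_facesWithin hxz ht hpt
  have hq := h.not_between_of_notMem_facesWithin hxz ht hqt
  have hp' := hs p hps
  have hq' := hs q hqs
  have hne := h.inj.ne hpq
  rcases hp'.1.eq_or_lt with h1 | h1
  · obtain rfl := h.inj h1
    obtain rfl : q = z := h.inj (by omega)
    exact ⟨⟨hps, hqs⟩, hpt, hqt⟩
  · obtain rfl : p = z := h.inj (by omega)
    obtain rfl : q = x := h.inj (by omega)
    exact ⟨⟨hqs, hps⟩, hqt, hpt⟩

theorem isFaceTriple_of_mem_facesWithin (hlt : f x < f z) (hx : x ∈ s.1) (hz : z ∈ s.1)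
    (hs : s ∈ facesWithin G f x z) : ∃ w, IsFaceTriple f s x w z := by
  obtain ⟨w, hwx, hwz, hw⟩ := s.exists_third hx hz (fun e => (e ▸ hlt).false)
  have := hs w ((hw w).2 (by simp))
  have h1 := h.inj.ne hwx
  have h2 := h.inj.ne hwz
  exact ⟨w, by omega, by omega, fun v => by rw [hw]; tauto⟩

omit h in
theorem exists_outer_of_notMem_facesWithin (hlt : f x < f z) (hx : x ∈ s.1) (hz : z ∈ s.1)
    (hs : s ∉ facesWithin G f x z) : ∃ w, (f w < f x ∨ f z < f w) ∧ G.Adj x w ∧ G.Adj w z ∧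
      ∀ v, v ∈ s.1 ↔ v = x ∨ v = z ∨ v = w := by
  obtain ⟨w, hwx, hwz, hw⟩ := s.exists_third hx hz (fun e => (e ▸ hlt).false)
  refine ⟨w, ?_, s.adj hx ((hw w).2 (by simp)) hwx.symm, s.adj ((hw w).2 (by simp)) hz hwz, hw⟩
  by_contra hcon
  refine hs fun v hv => ?_
  rcases (hw v).1 hv with rfl | rfl | rfl <;> omega

theorem eq_of_mem_facesWithin (hlt : f x < f z) (hxs : x ∈ s.1) (hzs : z ∈ s.1)
    (hs : s ∈ facesWithin G f x z) (hxt : x ∈ t.1) (hzt : z ∈ t.1)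
    (ht : t ∈ facesWithin G f x z) : s = t := by
  obtain ⟨w, hw⟩ := h.isFaceTriple_of_mem_facesWithin hlt hxs hzs hs
  obtain ⟨w', hw'⟩ := h.isFaceTriple_of_mem_facesWithin hlt hxt hzt ht
  obtain rfl := h.mid_unique hw.lt_right hw.left_lt hw.adj_left hw.adj_right hw'.left_lt
    hw'.lt_right hw'.adj_left hw'.adj_right
  exact hw.eq_of_triple hw'

theorem eq_of_notMem_facesWithin (hlt : f x < f z) (hxs : x ∈ s.1) (hzs : z ∈ s.1)
    (hs : s ∉ facesWithin G f x z) (hxt : x ∈ t.1) (hzt : z ∈ t.1)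
    (ht : t ∉ facesWithin G f x z) : s = t := by
  obtain ⟨w, hw1, hw2, hw3, hw4⟩ := exists_outer_of_notMem_facesWithin hlt hxs hzs hs
  obtain ⟨w', hw1', hw2', hw3', hw4'⟩ := exists_outer_of_notMem_facesWithin hlt hxt hzt ht
  obtain rfl := h.outer_unique hlt hw1 hw2 hw3 hw1' hw2' hw3'
  exact Face.ext_iff_mem.2 fun v => (hw4 v).trans (hw4' v).symm

/-- Every dual edge is a bridge: `s` and `t` share an edge `xz`, which has only one face on either
side, so no other dual edge leads from the faces under `xz` to the rest. -/
theorem dualTree_isAcyclic : (dualTree G).IsAcyclic := by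
  rw [SimpleGraph.isAcyclic_iff_forall_adj_isBridge]
  have key : ∀ s t, (dualTree G).Adj s t → ∀ x z, G.Adj x z → f x < f z → x ∈ s.1 → z ∈ s.1 →
      x ∈ t.1 → z ∈ t.1 → s ∈ facesWithin G f x z → (dualTree G).IsBridge s(s, t) := by
    intro s t hst x z hxz hlt hxs hzs hxt hzt hs
    have ht : t ∉ facesWithin G f x z := fun ht =>
      hst.ne (h.eq_of_mem_facesWithin hlt hxs hzs hs hxt hzt ht)
    rw [SimpleGraph.isBridge_iff]
    rintro ⟨p⟩
    refine ht (JoinedWithin.mem_of_closed (B := Set.univ) ⟨p, by simp⟩ hs ?_)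
    rintro a b ha - hab
    rw [SimpleGraph.deleteEdges_adj] at hab
    by_contra hb
    obtain ⟨⟨h1, h2⟩, h3, h4⟩ := h.mem_of_adj_of_notMem_facesWithin hxz hlt ha hb hab.1
    obtain rfl := h.eq_of_mem_facesWithin hlt hxs hzs hs h1 h2 ha
    obtain rfl := h.eq_of_notMem_facesWithin hlt hxt hzt ht h3 h4 hb
    exact hab.2 rfl
  intro s t hst
  obtain ⟨-, x, z, hne, ⟨hxs, hzs⟩, hxt, hzt⟩ := dualTree_adj_iff.1 hst
  have : ∃ x z, G.Adj x z ∧ f x < f z ∧ (x ∈ s.1 ∧ z ∈ s.1) ∧ x ∈ t.1 ∧ z ∈ t.1 := by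
    rcases h.lt_or_gt_of_ne hne with hlt | hlt
    · exact ⟨x, z, s.adj hxs hzs hne, hlt, ⟨hxs, hzs⟩, hxt, hzt⟩
    · exact ⟨z, x, s.adj hzs hxs hne.symm, hlt, ⟨hzs, hxs⟩, hzt, hxt⟩
  obtain ⟨x, z, hxz, hlt, ⟨hxs, hzs⟩, hxt, hzt⟩ := this
  by_cases hs : s ∈ facesWithin G f x z
  · exact key s t hst x z hxz hlt hxs hzs hxt hzt hs
  · have ht : t ∈ facesWithin G f x z := by
      by_contra ht
      exact hst.ne (h.eq_of_notMem_facesWithin hlt hxs hzs hs hxt hzt ht)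
    rw [Sym2.eq_swap]
    exact key t s hst.symm x z hxz hlt hxt hzt hxs hzs ht

/-- A face under neither `aw` nor `wb` has no vertex strictly under these edges, which leaves only
`a`, `w` and `b`. -/
theorem mem_facesWithin_cases {t₀ : Face G} (h₀ : IsFaceTriple f t₀ a w b)
    (ht : t ∈ facesWithin G f a b) :
    t = t₀ ∨ t ∈ facesWithin G f a w ∨ t ∈ facesWithin G f w b := by
  by_contra! hcon
  obtain ⟨h0, h1, h2⟩ := hcon
  have hsub : ∀ x ∈ t.1, x = a ∨ x = w ∨ x = b := by
    intro x hx
    have h3 := h.not_between_of_notMem_facesWithin h₀.adj_left h1 hx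
    have h4 := h.not_between_of_notMem_facesWithin h₀.adj_right h2 hx
    have h5 := ht x hx
    by_contra! hne
    have := h.inj.ne hne.1
    have := h.inj.ne hne.2.1
    have := h.inj.ne hne.2.2
    omega
  refine h0 (Subtype.ext (Finset.eq_of_subset_of_card_le (fun x hx => ?_) ?_))
  · exact (h₀.mem_iff x).2 (hsub x hx)
  · rw [t.2.card_eq, t₀.2.card_eq]

end IsTriangulation

namespace IsFaceTriple

variable {a w b : V} {t s : Face G} (ht : IsFaceTriple f t a w b)
include ht

theorem notMem_facesWithin_left : t ∉ facesWithin G f a w := fun hcon =>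
  absurd (hcon b ht.right_mem).2 (not_le.2 ht.lt_right)

theorem notMem_facesWithin_right : t ∉ facesWithin G f w b := fun hcon =>
  absurd (hcon a ht.left_mem).1 (not_le.2 ht.left_lt)

theorem facesWithin_left_subset : facesWithin G f a w ⊆ facesWithin G f a b := fun _ hs x hx =>
  ⟨(hs x hx).1, (hs x hx).2.trans ht.lt_right.le⟩

theorem facesWithin_right_subset : facesWithin G f w b ⊆ facesWithin G f a b := fun _ hs x hx =>
  ⟨ht.left_lt.le.trans (hs x hx).1, (hs x hx).2⟩

theorem adj_of_left {w' : V} (hs : IsFaceTriple f s a w' w) : (dualTree G).Adj t s :=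
  dualTree_adj_iff.2 ⟨fun e => ht.notMem_facesWithin_left (e ▸ hs.mem_facesWithin), a, w,
    ht.adj_left.ne, ⟨ht.left_mem, ht.mid_mem⟩, hs.left_mem, hs.right_mem⟩

theorem adj_of_right {w' : V} (hs : IsFaceTriple f s w w' b) : (dualTree G).Adj t s :=
  dualTree_adj_iff.2 ⟨fun e => ht.notMem_facesWithin_right (e ▸ hs.mem_facesWithin), w, b,
    ht.adj_right.ne, ⟨ht.mid_mem, ht.right_mem⟩, hs.left_mem, hs.right_mem⟩

end IsFaceTriple

/-! ### Connectedness of the faces under an edge -/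

namespace IsTriangulation

variable (h : IsTriangulation G f) {a b w : V} {s t : Face G}
include h

theorem facesWithin_nonempty_iff (hab : G.Adj a b) :
    (facesWithin G f a b).Nonempty ↔ ∃ x, f a < f x ∧ f x < f b := by
  constructor
  · rintro ⟨s, hs⟩
    obtain ⟨p, q, r, hpqr⟩ := h.exists_isFaceTriple s
    have := hs p hpqr.left_mem
    have := hs r hpqr.right_mem
    exact ⟨q, by have := hpqr.left_lt; omega, by have := hpqr.lt_right; omega⟩
  · rintro ⟨x, hax, hxb⟩
    obtain ⟨t, w, ht⟩ := h.exists_faceTriple_of_between hab hax hxb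
    exact ⟨t, ht.mem_facesWithin⟩

/-- Induction on the length of the interval: the face at `ab` is adjacent to the faces at `aw` and
at `wb`, from which the faces under these edges are reached. -/
theorem joinedWithin_facesWithin (ht : IsFaceTriple f t a w b) (hs : s ∈ facesWithin G f a b) :
    JoinedWithin (dualTree G) (facesWithin G f a b) t s := by
  obtain ⟨n, hn⟩ : ∃ n : ℕ, f b - f a ≤ n := ⟨(f b - f a).toNat, by omega⟩
  induction n generalizing a w b t with
  | zero =>
    have := ht.lt
    omega
  | succ n ih =>
    have h1 := ht.left_lt
    have h2 := ht.lt_right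
    rcases h.mem_facesWithin_cases ht hs with rfl | hs' | hs'
    · exact .refl hs
    · obtain ⟨x, hx⟩ := (h.facesWithin_nonempty_iff ht.adj_left).1 ⟨s, hs'⟩
      obtain ⟨t', w', ht'⟩ := h.exists_faceTriple_of_between ht.adj_left hx.1 hx.2
      exact (JoinedWithin.of_adj ht.mem_facesWithin
        (ht.facesWithin_left_subset ht'.mem_facesWithin) (ht.adj_of_left ht')).trans
        ((ih ht' hs' (by push_cast at hn ⊢; omega)).mono ht.facesWithin_left_subset)
    · obtain ⟨x, hx⟩ := (h.facesWithin_nonempty_iff ht.adj_right).1 ⟨s, hs'⟩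
      obtain ⟨t', w', ht'⟩ := h.exists_faceTriple_of_between ht.adj_right hx.1 hx.2
      exact (JoinedWithin.of_adj ht.mem_facesWithin
        (ht.facesWithin_right_subset ht'.mem_facesWithin) (ht.adj_of_right ht')).trans
        ((ih ht' hs' (by push_cast at hn ⊢; omega)).mono ht.facesWithin_right_subset)

theorem connectedSet_facesWithin (hab : G.Adj a b) :
    ConnectedSet (dualTree G) (facesWithin G f a b) := by
  intro s hs s' hs'
  obtain ⟨x, hx⟩ := (h.facesWithin_nonempty_iff hab).1 ⟨s, hs⟩
  obtain ⟨t, w, ht⟩ := h.exists_faceTriple_of_between hab hx.1 hx.2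
  exact (h.joinedWithin_facesWithin ht hs).symm.trans (h.joinedWithin_facesWithin ht hs')

end IsTriangulation

end DualTree

/-! ### Cutting edges of the subgraphs induced by intervals -/

section Cutting

variable {V : Type*} {G : SimpleGraph V}

theorem reachable_deleteVerts_iff {H : G.Subgraph} {D : Set V} (x y : (H.deleteVerts D).verts) :
    (H.deleteVerts D).coe.Reachable x y ↔ JoinedWithin H.spanningCoe (H.verts \ D) x y := by
  constructor
  · rintro ⟨p⟩
    induction p with
    | nil => exact .refl (Subtype.coe_prop _)
    | cons hadj q ih =>
      refine (JoinedWithin.of_adj (Subtype.coe_prop _) (Subtype.coe_prop _) ?_).trans ih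
      exact (SimpleGraph.Subgraph.deleteVerts_adj.1 hadj).2.2.2.2
  · intro hxy
    have key : ∀ y ∈ {y | ∃ hy : y ∈ (H.deleteVerts D).verts,
        (H.deleteVerts D).coe.Reachable x ⟨y, hy⟩}, y ∈ (H.deleteVerts D).verts :=
      fun _ hy => hy.1
    obtain ⟨_, hy⟩ := hxy.mem_of_closed (C := {y | ∃ hy : y ∈ (H.deleteVerts D).verts,
        (H.deleteVerts D).coe.Reachable x ⟨y, hy⟩}) ⟨x.2, .rfl⟩ (by
      rintro a b ⟨ha, hxa⟩ hb hab
      refine ⟨hb, hxa.trans (SimpleGraph.Adj.reachable ?_)⟩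
      exact SimpleGraph.Subgraph.deleteVerts_adj.2 ⟨ha.1, ha.2, hb.1, hb.2, hab⟩)
    exact hy

theorem isCuttingEdge_iff {H : G.Subgraph} {e : Sym2 V} : IsCuttingEdge H e ↔
    e ∈ H.edgeSet ∧ ¬ConnectedSet H.spanningCoe (H.verts \ {x | x ∈ e}) := by
  unfold IsCuttingEdge
  refine and_congr_right fun _ => not_congr ⟨fun h x hx y hy => ?_, fun h x y => ?_⟩
  · exact (reachable_deleteVerts_iff ⟨x, hx⟩ ⟨y, hy⟩).1 (h _ _)
  · exact (reachable_deleteVerts_iff x y).2 (h _ x.2 _ y.2)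

theorem isCutComponent_iff {H S : G.Subgraph} {e : Sym2 V} : IsCutComponent H e S ↔
    ∃ x ∈ H.verts \ {x | x ∈ e}, S = H.induce ({x | x ∈ e} ∪
      {y | JoinedWithin H.spanningCoe (H.verts \ {x | x ∈ e}) x y}) := by
  have key : ∀ x : (H.deleteVerts {x | x ∈ e}).verts, Subtype.val ''
      ((H.deleteVerts {x | x ∈ e}).coe.connectedComponentMk x).supp =
      {y | JoinedWithin H.spanningCoe (H.verts \ {x | x ∈ e}) x y} := by
    intro x
    ext y
    constructor
    · rintro ⟨y, hy, rfl⟩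
      rw [SimpleGraph.ConnectedComponent.mem_supp_iff, SimpleGraph.ConnectedComponent.eq] at hy
      exact (reachable_deleteVerts_iff x y).1 hy.symm
    · intro hy
      refine ⟨⟨y, hy.right_mem⟩, ?_, rfl⟩
      rw [SimpleGraph.ConnectedComponent.mem_supp_iff, SimpleGraph.ConnectedComponent.eq]
      exact ((reachable_deleteVerts_iff x ⟨y, hy.right_mem⟩).2 hy).symm
  constructor
  · rintro ⟨C, rfl⟩
    induction C using SimpleGraph.ConnectedComponent.ind with
    | h x => exact ⟨x, x.2, by rw [key]⟩
  · rintro ⟨x, hx, rfl⟩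
    exact ⟨_, by rw [key ⟨x, hx⟩]⟩

/-- The subgraph induced by the vertices from `a` to `b`. -/
def intervalSubgraph (G : SimpleGraph V) (f : V → ℤ) (a b : V) : G.Subgraph :=
  (⊤ : G.Subgraph).induce {x | f a ≤ f x ∧ f x ≤ f b}

variable {f : V → ℤ} {a b x y z u v : V}

@[simp]
theorem mem_verts_intervalSubgraph :
    x ∈ (intervalSubgraph G f a b).verts ↔ f a ≤ f x ∧ f x ≤ f b := Iff.rfl

theorem intervalSubgraph_adj : (intervalSubgraph G f a b).Adj x y ↔
    (f a ≤ f x ∧ f x ≤ f b) ∧ (f a ≤ f y ∧ f y ≤ f b) ∧ G.Adj x y := by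
  simp [intervalSubgraph]

theorem intervalSubgraph_eq_top (h : ∀ x, f a ≤ f x ∧ f x ≤ f b) :
    intervalSubgraph G f a b = ⊤ := by
  ext
  · simp [h]
  · simp [h, intervalSubgraph_adj]

namespace IsTriangulation

variable [Finite V] (h : IsTriangulation G f)
include h

/-- The walk follows the polygon, from each vertex to its successor in the order. -/
theorem joinedWithin_of_between {B : Set V}
    (hB : B ⊆ (intervalSubgraph G f a b).verts) (hxy : f x ≤ f y)
    (hb : ∀ v, f x ≤ f v → f v ≤ f y → v ∈ B) :
    JoinedWithin (intervalSubgraph G f a b).spanningCoe B x y := by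
  obtain ⟨n, hn⟩ : ∃ n : ℕ, f y - f x ≤ n := ⟨(f y - f x).toNat, by omega⟩
  induction n generalizing x with
  | zero =>
    obtain rfl : x = y := h.inj (by omega)
    exact .refl (hb x le_rfl le_rfl)
  | succ n ih =>
    rcases hxy.eq_or_lt with heq | hlt
    · obtain rfl : x = y := h.inj heq
      exact .refl (hb x le_rfl le_rfl)
    obtain ⟨s, hxs, hs⟩ := Set.exists_min_image {v | f x < f v} f (Set.toFinite _) ⟨y, hlt⟩
    have hsy := hs y hlt
    change f x < f s at hxs
    have hxB := hb x le_rfl hxy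
    have hsB := hb s hxs.le hsy
    refine (JoinedWithin.of_adj hxB hsB ?_).trans (ih hsy (fun v hv => hb v (by omega))
      (by push_cast at hn; omega))
    exact intervalSubgraph_adj.2 ⟨hB hxB, hB hsB, h.adj_of_consecutive x s hxs fun v hv => hs v hv⟩

theorem joinedWithin_inside (hax : f a ≤ f x) (hzb : f z ≤ f b) (hu : f x < f u ∧ f u < f z)
    (hv : f x < f v ∧ f v < f z) : JoinedWithin (intervalSubgraph G f a b).spanningCoe
      ((intervalSubgraph G f a b).verts \ {y | y ∈ s(x, z)}) u v := by
  wlog huv : f u ≤ f v generalizing u v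
  · exact (this hv hu (by omega)).symm
  refine h.joinedWithin_of_between Set.sdiff_subset huv fun w h1 h2 => ⟨⟨by omega, by omega⟩, ?_⟩
  simp only [Set.mem_ofPred_eq, Sym2.mem_iff]
  rintro (rfl | rfl) <;> omega

/-- Vertices before `x` are joined to `a`, vertices after `z` to `b`, and the edge `ab` links the
two sides. It is used only when both sides occur, and then neither `a` nor `b` has been deleted. -/
theorem joinedWithin_outside (hab : G.Adj a b) (hxz : f x < f z)
    (hu : f a ≤ f u ∧ f u ≤ f b) (hv : f a ≤ f v ∧ f v ≤ f b)
    (hu' : f u < f x ∨ f z < f u) (hv' : f v < f x ∨ f z < f v) :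
    JoinedWithin (intervalSubgraph G f a b).spanningCoe
      ((intervalSubgraph G f a b).verts \ {y | y ∈ s(x, z)}) u v := by
  have hleft : ∀ u, f a ≤ f u → f u ≤ f b → f u < f x →
      JoinedWithin (intervalSubgraph G f a b).spanningCoe
      ((intervalSubgraph G f a b).verts \ {y | y ∈ s(x, z)}) a u := by
    intro u h1 h3 h2
    refine h.joinedWithin_of_between Set.sdiff_subset h1 fun w h3 h4 => ⟨⟨h3, by omega⟩, ?_⟩
    simp only [Set.mem_ofPred_eq, Sym2.mem_iff]
    rintro (rfl | rfl) <;> omega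
  have hright : ∀ u, f a ≤ f u → f u ≤ f b → f z < f u →
      JoinedWithin (intervalSubgraph G f a b).spanningCoe
      ((intervalSubgraph G f a b).verts \ {y | y ∈ s(x, z)}) u b := by
    intro u h3 h1 h2
    refine h.joinedWithin_of_between Set.sdiff_subset h1 fun w h3 h4 => ⟨⟨by omega, h4⟩, ?_⟩
    simp only [Set.mem_ofPred_eq, Sym2.mem_iff]
    rintro (rfl | rfl) <;> omega
  have hcross : ∀ u v, f a ≤ f u ∧ f u ≤ f b → f a ≤ f v ∧ f v ≤ f b → f u < f x → f z < f v →
      JoinedWithin (intervalSubgraph G f a b).spanningCoe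
      ((intervalSubgraph G f a b).verts \ {y | y ∈ s(x, z)}) u v := by
    intro u v hu hv hux hzv
    have h1 := hleft u hu.1 hu.2 hux
    have h2 := hright v hv.1 hv.2 hzv
    refine (h1.symm.trans (.of_adj h1.left_mem h2.right_mem ?_)).trans h2.symm
    exact intervalSubgraph_adj.2 ⟨h1.left_mem.1, h2.right_mem.1, hab⟩
  rcases hu' with hu' | hu' <;> rcases hv' with hv' | hv'
  · exact (hleft u hu.1 hu.2 hu').symm.trans (hleft v hv.1 hv.2 hv')
  · exact hcross u v hu hv hu' hv'
  · exact (hcross v u hv hu hv' hu').symm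
  · exact (hright u hu.1 hu.2 hu').trans (hright v hv.1 hv.2 hv').symm

omit [Finite V] in
/-- A subgraph containing vertices on both sides of one of its edges is cut by it. -/
theorem isCuttingEdge_of_sides {U : G.Subgraph} (hxz : U.Adj x z)
    (hu : u ∈ U.verts) (hu' : f x < f u ∧ f u < f z) (hv : v ∈ U.verts)
    (hv' : f v < f x ∨ f z < f v) : IsCuttingEdge U s(x, z) := by
  have hmem : ∀ w ∈ U.verts, w ≠ x → w ≠ z → w ∈ U.verts \ {y | y ∈ s(x, z)} := by
    intro w hw h1 h2
    simp [hw, h1, h2]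
  refine isCuttingEdge_iff.2 ⟨hxz, fun hconn => ?_⟩
  have hj := hconn u (hmem u hu (by rintro rfl; omega) (by rintro rfl; omega))
    v (hmem v hv (by rintro rfl; omega) (by rintro rfl; omega))
  have : f x < f v ∧ f v < f z := by
    refine hj.mem_of_closed (C := {w | f x < f w ∧ f w < f z}) hu' ?_
    rintro p q ⟨hp1, hp2⟩ ⟨-, hq⟩ hpq
    have := h.mem_Icc_of_adj hxz.adj_sub (U.adj_sub hpq) hp1 hp2
    simp only [Set.mem_ofPred_eq, Sym2.mem_iff, not_or] at hq
    have := h.inj.ne hq.1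
    have := h.inj.ne hq.2
    exact ⟨by omega, by omega⟩
  omega

/-- Deleting `x` and `z` splits the polygon into the vertices under `xz` and those outside. Each
part is connected and no edge joins them, so `xz` cuts exactly when both are non-empty; the outside
is empty only for `ab` itself. -/
theorem isCuttingEdge_intervalSubgraph_iff (hab : G.Adj a b) (hxz : G.Adj x z) (hax : f a ≤ f x)
    (hlt : f x < f z) (hzb : f z ≤ f b) : IsCuttingEdge (intervalSubgraph G f a b) s(x, z) ↔
      (∃ y, f x < f y ∧ f y < f z) ∧ (x ≠ a ∨ z ≠ b) := by
  have hadj : (intervalSubgraph G f a b).Adj x z :=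
    intervalSubgraph_adj.2 ⟨⟨hax, by omega⟩, ⟨by omega, hzb⟩, hxz⟩
  constructor
  · intro hcut
    rw [isCuttingEdge_iff] at hcut
    by_contra hcon
    refine hcut.2 fun u hu v hv => ?_
    simp only [Set.mem_sdiff, mem_verts_intervalSubgraph, Set.mem_ofPred_eq, Sym2.mem_iff,
      not_or] at hu hv
    have h1 := h.inj.ne hu.2.1
    have h2 := h.inj.ne hu.2.2
    have h3 := h.inj.ne hv.2.1
    have h4 := h.inj.ne hv.2.2
    by_cases hy : ∃ y, f x < f y ∧ f y < f z
    · have hxa : x = a ∧ z = b := by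
        by_contra hne
        exact hcon ⟨hy, by tauto⟩
      obtain ⟨rfl, rfl⟩ := hxa
      exact h.joinedWithin_inside le_rfl le_rfl (by omega) (by omega)
    · push Not at hy
      have := hy u
      have := hy v
      exact h.joinedWithin_outside hab hlt hu.1 hv.1 (by omega) (by omega)
  · rintro ⟨⟨y, hy⟩, hne⟩
    rcases hne with hne | hne
    · have := h.inj.ne hne
      exact h.isCuttingEdge_of_sides hadj (u := y) (v := a) ⟨by omega, by omega⟩ hy
        ⟨by omega, by omega⟩ (by omega)
    · have := h.inj.ne hne
      exact h.isCuttingEdge_of_sides hadj (u := y) (v := b) ⟨by omega, by omega⟩ hy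
        ⟨by omega, by omega⟩ (by omega)

theorem isNonCuttingEdge_root (hab : G.Adj a b) (hlt : f a < f b) :
    IsNonCuttingEdge (intervalSubgraph G f a b) s(a, b) := by
  refine ⟨intervalSubgraph_adj.2 ⟨⟨le_rfl, hlt.le⟩, ⟨hlt.le, le_rfl⟩, hab⟩, fun hcut => ?_⟩
  simpa using ((h.isCuttingEdge_intervalSubgraph_iff hab hab le_rfl hlt le_rfl).1 hcut).2

omit [Finite V] in
theorem induce_intervalSubgraph {C : Set V} (hax : f a ≤ f x) (hlt : f x < f z) (hzb : f z ≤ f b)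
    (hC : ∀ v, v ∈ C ↔ f x < f v ∧ f v < f z) :
    (intervalSubgraph G f a b).induce ({y | y ∈ s(x, z)} ∪ C) = intervalSubgraph G f x z := by
  have key : ∀ v, v ∈ {y | y ∈ s(x, z)} ∪ C ↔ f x ≤ f v ∧ f v ≤ f z := by
    intro v
    simp only [Set.mem_union, Set.mem_ofPred_eq, Sym2.mem_iff, hC]
    constructor
    · rintro ((rfl | rfl) | h) <;> omega
    · intro hv
      by_contra! hcon
      have := h.inj.ne hcon.1.1
      have := h.inj.ne hcon.1.2
      omega
  ext u v
  · exact key u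
  · simp only [SimpleGraph.Subgraph.induce_adj, key, intervalSubgraph_adj]
    constructor
    · rintro ⟨h1, h2, -, -, h3⟩
      exact ⟨h1, h2, h3⟩
    · rintro ⟨h1, h2, h3⟩
      exact ⟨h1, h2, ⟨by omega, by omega⟩, ⟨by omega, by omega⟩, h3⟩

theorem joinedWithin_iff_inside (hxz : G.Adj x z) (hax : f a ≤ f x) (hzb : f z ≤ f b)
    (hu : f x < f u ∧ f u < f z) : JoinedWithin (intervalSubgraph G f a b).spanningCoe
      ((intervalSubgraph G f a b).verts \ {y | y ∈ s(x, z)}) u v ↔ f x < f v ∧ f v < f z := by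
  refine ⟨fun hj => ?_, h.joinedWithin_inside hax hzb hu⟩
  refine hj.mem_of_closed (C := {w | f x < f w ∧ f w < f z}) hu ?_
  rintro p q ⟨hp1, hp2⟩ ⟨-, hq⟩ hpq
  have := h.mem_Icc_of_adj hxz (intervalSubgraph_adj.1 hpq).2.2 hp1 hp2
  simp only [Set.mem_ofPred_eq, Sym2.mem_iff, not_or] at hq
  have := h.inj.ne hq.1
  have := h.inj.ne hq.2
  exact ⟨by omega, by omega⟩

/-- A component that starts outside `[x, z]` comprises everything outside, so together with `x` and
`z` it contains the edge `ab`, which `hc` excludes. -/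
theorem eq_intervalSubgraph_of_isCutComponent (hab : G.Adj a b) (hxz : G.Adj x z)
    (hax : f a ≤ f x) (hlt : f x < f z) (hzb : f z ≤ f b) {S : G.Subgraph}
    (hS : IsCutComponent (intervalSubgraph G f a b) s(x, z) S) (hc : s(a, b) ∉ S.edgeSet) :
    S = intervalSubgraph G f x z := by
  obtain ⟨u, ⟨hu, hu'⟩, rfl⟩ := isCutComponent_iff.1 hS
  simp only [Set.mem_ofPred_eq, Sym2.mem_iff, not_or] at hu'
  have h1 := h.inj.ne hu'.1
  have h2 := h.inj.ne hu'.2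
  rw [mem_verts_intervalSubgraph] at hu
  by_cases hin : f x < f u ∧ f u < f z
  · exact h.induce_intervalSubgraph hax hlt hzb fun v =>
      h.joinedWithin_iff_inside hxz hax hzb hin
  · exfalso
    have hmem : ∀ v, f a ≤ f v ∧ f v ≤ f b → ¬(f x < f v ∧ f v < f z) →
        v ∈ {y | y ∈ s(x, z)} ∪ {y | JoinedWithin (intervalSubgraph G f a b).spanningCoe
          ((intervalSubgraph G f a b).verts \ {y | y ∈ s(x, z)}) u y} := by
      intro v hv hnot
      by_cases hvx : v = x
      · exact .inl (by simp [hvx])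
      by_cases hvz : v = z
      · exact .inl (by simp [hvz])
      have := h.inj.ne hvx
      have := h.inj.ne hvz
      exact .inr (h.joinedWithin_outside hab hlt hu hv (by omega) (by omega))
    refine hc ?_
    rw [SimpleGraph.Subgraph.mem_edgeSet, SimpleGraph.Subgraph.induce_adj]
    exact ⟨hmem a (by omega) (by omega), hmem b (by omega) (by omega),
      intervalSubgraph_adj.2 ⟨by omega, by omega, hab⟩⟩

theorem isCutComponent_intervalSubgraph (hxz : G.Adj x z) (hax : f a ≤ f x)
    (hlt : f x < f z) (hzb : f z ≤ f b) (hu : ∃ u, f x < f u ∧ f u < f z) :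
    IsCutComponent (intervalSubgraph G f a b) s(x, z) (intervalSubgraph G f x z) := by
  obtain ⟨u, hu⟩ := hu
  refine isCutComponent_iff.2 ⟨u, ⟨⟨by omega, by omega⟩, ?_⟩, ?_⟩
  · simp only [Set.mem_ofPred_eq, Sym2.mem_iff]
    rintro (rfl | rfl) <;> omega
  · exact (h.induce_intervalSubgraph hax hlt hzb fun v =>
      h.joinedWithin_iff_inside hxz hax hzb hu).symm

omit [Finite V] in
theorem root_notMem_edgeSet (hax : f a ≤ f x) (hzb : f z ≤ f b) (hne : x ≠ a ∨ z ≠ b) :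
    s(a, b) ∉ (intervalSubgraph G f x z).edgeSet := by
  rw [SimpleGraph.Subgraph.mem_edgeSet, intervalSubgraph_adj]
  rintro ⟨h1, h2, -⟩
  rcases hne with hne | hne
  · have := h.inj.ne hne
    omega
  · have := h.inj.ne hne
    omega

end IsTriangulation

/-- An edge without vertices between its ends can be made the outermost edge. -/
theorem IsMaximalOuterplanar.exists_rotation [Finite V] (hG : IsMaximalOuterplanar G)
    (hf : IsNoncrossing G f) (hlt : f x < f z) (hxz : ∀ y, ¬(f x < f y ∧ f y < f z)) :
    ∃ g, IsTriangulation G g ∧ g z < g x ∧ ∀ v, g z ≤ g v ∧ g v ≤ g x := by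
  obtain ⟨M, hM⟩ := exists_lt_add f
  refine ⟨_, hG.isTriangulation (hf.rotate hM (f z)), ?_⟩
  have := hM z x
  simp only [rotateOrder, hlt, if_true, lt_irrefl, if_false]
  refine ⟨this, fun v => ?_⟩
  have := hM v x
  have := hM z v
  have := hxz v
  split_ifs <;> omega

/-- Every non-cutting edge can be made the outermost edge. -/
theorem IsMaximalOuterplanar.exists_extreme [Finite V] (hG : IsMaximalOuterplanar G)
    {c : Sym2 V} (hc : IsNonCuttingEdge (⊤ : G.Subgraph) c) :
    ∃ g a b, IsTriangulation G g ∧ c = s(a, b) ∧ g a < g b ∧ ∀ v, g a ≤ g v ∧ g v ≤ g b := by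
  obtain ⟨f, hf⟩ := IsOuterplanar.exists_isNoncrossing hG.1
  have h := hG.isTriangulation hf
  obtain ⟨x, z, rfl, hlt⟩ : ∃ x z, c = s(x, z) ∧ f x < f z := by
    induction c using Sym2.ind with
    | _ x z =>
      have hxz : G.Adj x z := hc.1
      rcases h.lt_or_gt_of_ne hxz.ne with hlt | hlt
      exacts [⟨x, z, rfl, hlt⟩, ⟨z, x, Sym2.eq_swap, hlt⟩]
  have hxz : G.Adj x z := hc.1
  have : Nonempty V := ⟨x⟩
  obtain ⟨b, hb⟩ := Finite.exists_max f
  obtain ⟨a, ha⟩ := Finite.exists_min f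
  have hall : ∀ v, f a ≤ f v ∧ f v ≤ f b := fun v => ⟨ha v, hb v⟩
  have hab : f a < f b := by
    have := ha x
    have := hb z
    omega
  have hnc := hc.2
  rw [← intervalSubgraph_eq_top hall, h.isCuttingEdge_intervalSubgraph_iff
    (h.adj_of_extreme a b hab hall) hxz (ha x) hlt (hb z)] at hnc
  -- A non-cutting edge with a vertex under it is the outermost edge already; one with nothing under
  -- it becomes outermost by a rotation.
  by_cases hy : ∃ y, f x < f y ∧ f y < f z
  · have hxa : x = a ∧ z = b := by
      by_contra hne
      exact hnc ⟨hy, by tauto⟩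
    obtain ⟨rfl, rfl⟩ := hxa
    exact ⟨f, x, z, h, rfl, hlt, hall⟩
  · push Not at hy
    obtain ⟨g, hg, hlt, hall⟩ := hG.exists_rotation hf hlt fun y hy' => by
      have := hy y
      omega
    exact ⟨g, z, x, hg, Sym2.eq_swap, hlt, hall⟩

end Cutting

/-! ### Strahler numbers -/

section Strahler

variable {V : Type*} {G : SimpleGraph V} {f : V → ℤ}

/-- The part of the triangulation under the edge `ab`, seen as a binary tree, has Strahler number
at most `k`. -/
inductive StrahlerLE (G : SimpleGraph V) (f : V → ℤ) : V → V → ℕ → Prop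
  | consecutive {a b : V} {k : ℕ} (h : ∀ x, ¬(f a < f x ∧ f x < f b)) : StrahlerLE G f a b k
  | left {a w b : V} {k : ℕ} {t : Face G} (ht : IsFaceTriple f t a w b)
      (h₁ : StrahlerLE G f a w (k + 1)) (h₂ : StrahlerLE G f w b k) : StrahlerLE G f a b (k + 1)
  | right {a w b : V} {k : ℕ} {t : Face G} (ht : IsFaceTriple f t a w b)
      (h₁ : StrahlerLE G f a w k) (h₂ : StrahlerLE G f w b (k + 1)) : StrahlerLE G f a b (k + 1)

theorem StrahlerLE.succ {a b : V} {k : ℕ} (hs : StrahlerLE G f a b k) :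
    StrahlerLE G f a b (k + 1) := by
  induction hs with
  | consecutive h => exact .consecutive h
  | left ht _ _ h₁ h₂ => exact .left ht h₁ h₂
  | right ht _ _ h₁ h₂ => exact .right ht h₁ h₂

theorem IsFaceTriple.neg {a w b : V} {t : Face G} (ht : IsFaceTriple f t a w b) :
    IsFaceTriple (fun v => -f v) t b w a :=
  ⟨neg_lt_neg ht.lt_right, neg_lt_neg ht.left_lt, fun x => by rw [ht.mem_iff]; tauto⟩

theorem StrahlerLE.neg {a b : V} {k : ℕ} (hs : StrahlerLE G f a b k) :
    StrahlerLE G (fun v => -f v) b a k := by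
  induction hs with
  | consecutive h => exact .consecutive fun x hx => h x ⟨by omega, by omega⟩
  | left ht _ _ h₁ h₂ => exact .right ht.neg h₂ h₁
  | right ht _ _ h₁ h₂ => exact .left ht.neg h₂ h₁

namespace IsTriangulation

variable (h : IsTriangulation G f) {a b w : V} {k : ℕ} {t : Face G}
include h

theorem isFaceTriple_mid_unique {w' : V} {t' : Face G} (ht : IsFaceTriple f t a w b)
    (ht' : IsFaceTriple f t' a w' b) : w = w' :=
  h.mid_unique ht.lt_right ht.left_lt ht.adj_left ht.adj_right ht'.left_lt ht'.lt_right
    ht'.adj_left ht'.adj_right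

theorem strahlerLE_sides (hs : StrahlerLE G f a b k) (ht : IsFaceTriple f t a w b) :
    StrahlerLE G f a w k ∧ StrahlerLE G f w b k := by
  cases hs with
  | consecutive hc => exact absurd ⟨ht.left_lt, ht.lt_right⟩ (hc w)
  | left ht' h₁ h₂ =>
    obtain rfl := h.isFaceTriple_mid_unique ht ht'
    exact ⟨h₁, h₂.succ⟩
  | right ht' h₁ h₂ =>
    obtain rfl := h.isFaceTriple_mid_unique ht ht'
    exact ⟨h₁.succ, h₂⟩

/-- The Strahler number is at most the rooted pathwidth of the dual tree. -/
theorem strahlerLE_of_rootedPathwidthOn_le [Finite V] (ht : IsFaceTriple f t a w b)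
    (hr : rootedPathwidthOn (dualTree G) (facesWithin G f a b) t ≤ (k : ℕ)) : StrahlerLE G f a b k := by
  obtain ⟨n, hn⟩ : ∃ n : ℕ, f b - f a ≤ n := ⟨(f b - f a).toNat, by omega⟩
  induction n generalizing a b w t k with
  | zero =>
    have := ht.lt
    omega
  | succ n ih =>
    have hlt1 := ht.left_lt
    have hlt2 := ht.lt_right
    push_cast at hn
    cases k with
    | zero =>
      exact absurd (rootedPathwidthOn_le_zero_iff.1 hr) (Set.nonempty_of_mem ht.mem_facesWithin).ne_empty
    | succ m =>
      obtain ⟨P, x, hP, hC⟩ := (rootedPathwidthOn_le_succ_iff.1 hr).resolve_left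
        (Set.nonempty_of_mem ht.mem_facesWithin).ne_empty
      -- The faces under a lower edge `pq` of `t` are linked to all others only through `t`.
      have hexit : ∀ p q : V, G.Adj p q → f p < f q → p ∈ t.1 → q ∈ t.1 →
          t ∉ facesWithin G f p q → ∀ s ∈ facesWithin G f p q, ∀ s', s' ≠ t →
          (dualTree G).Adj s s' → s' ∈ facesWithin G f p q := by
        intro p q hpq hlt hp hq htn s hs s' hne hadj
        by_contra hs'
        obtain ⟨-, h1, h2⟩ := h.mem_of_adj_of_notMem_facesWithin hpq hlt hs hs' hadj
        exact hne (h.eq_of_notMem_facesWithin hlt h1 h2 hs' hp hq htn)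
      -- A side that `P` avoids is a whole component of what remains, so its Strahler number is at
      -- most `m`.
      have hside : ∀ p q : V, G.Adj p q → f p < f q → p ∈ t.1 → q ∈ t.1 →
          t ∉ facesWithin G f p q → facesWithin G f p q ⊆ facesWithin G f a b →
          f q - f p ≤ n → (∀ s ∈ facesWithin G f p q, s ∉ P) → StrahlerLE G f p q m := by
        intro p q hpq hlt hp hq htn hsub hle hd
        by_cases hc : ∃ y, f p < f y ∧ f y < f q
        · obtain ⟨y, hy⟩ := hc
          obtain ⟨t', w', ht'⟩ := h.exists_faceTriple_of_between hpq hy.1 hy.2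
          refine ih ht' (hC _ ?_ t' ht'.mem_facesWithin t hP.end_mem ?_) hle
          · refine .of_connectedSet (h.connectedSet_facesWithin hpq) ⟨t', ht'.mem_facesWithin⟩
              (fun s hs => ⟨hsub hs, hd s hs⟩) fun s hs s' hs' hadj => ?_
            exact hexit p q hpq hlt hp hq htn s hs s'
              (fun e => hs'.2 (e ▸ hP.end_mem)) hadj
          · exact dualTree_adj_iff.2 ⟨fun e => htn (e ▸ ht'.mem_facesWithin), p, q, hpq.ne,
              ⟨hp, hq⟩, ht'.left_mem, ht'.right_mem⟩
        · exact .consecutive fun y hy => hc ⟨y, hy⟩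
      have hleft := hside a w ht.adj_left hlt1 ht.left_mem ht.mid_mem ht.notMem_facesWithin_left
        ht.facesWithin_left_subset (by omega)
      have hright := hside w b ht.adj_right hlt2 ht.mid_mem ht.right_mem
        ht.notMem_facesWithin_right ht.facesWithin_right_subset (by omega)
      have hdisj : ∀ s ∈ facesWithin G f a w, s ∉ facesWithin G f w b := by
        intro s hs hs'
        obtain ⟨p, q, r, hpqr⟩ := h.exists_isFaceTriple s
        have := hpqr.lt
        have := (hs r hpqr.right_mem).2
        have := (hs' p hpqr.left_mem).1
        omega
      rcases hP.symm.eq_or_cons with ⟨-, rfl⟩ | ⟨y, P', hty, htP', rfl, hP'⟩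
      -- The path is `t` alone: both sides are bounded by `m`, and one of the bounds is weakened.
      · refine .left ht (StrahlerLE.succ (hleft fun s hs e => ?_)) (hright fun s hs e => ?_)
        · obtain rfl : s = t := e
          exact ht.notMem_facesWithin_left hs
        · obtain rfl : s = t := e
          exact ht.notMem_facesWithin_right hs
      -- Otherwise the path stays in the side that it enters. There its tail is a path ending at the
      -- root, and the components left in this side are components of the original remainder, so the
      -- side is bounded by `m + 1`.
      have hmain : ∀ p q : V, G.Adj p q → f p < f q → p ∈ t.1 → q ∈ t.1 →
          t ∉ facesWithin G f p q → facesWithin G f p q ⊆ facesWithin G f a b →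
          f q - f p ≤ n → y ∈ facesWithin G f p q →
          P' ⊆ facesWithin G f p q ∧ StrahlerLE G f p q (m + 1) := by
        intro p q hpq hlt hp hq htn hsub hle hy
        have hP'sub : P' ⊆ facesWithin G f p q := fun s hs =>
          (hP'.connectedSet y hP'.start_mem s hs).mem_of_closed hy fun s s' hs hs' hadj =>
            hexit p q hpq hlt hp hq htn s hs s' (fun e => htP' (e ▸ hs')) hadj
        refine ⟨hP'sub, ?_⟩
        obtain ⟨⟨h1, h2⟩, -⟩ := h.mem_of_adj_of_notMem_facesWithin hpq hlt hy htn hty.symm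
        obtain ⟨w', hw'⟩ := h.isFaceTriple_of_mem_facesWithin hlt h1 h2 hy
        refine ih hw' (rootedPathwidthOn_le_succ_iff.2 (.inr
          ⟨P', x, (hP'.mono hP'sub).symm, fun C hCc c hc p' hp' hadj => ?_⟩)) hle
        refine hC C (hCc.of_closed ?_ ?_) c hc p' (.inr hp') hadj
        · rintro s ⟨hs, hs'⟩
          refine ⟨hsub hs, ?_⟩
          rintro (rfl | hs'')
          exacts [htn hs, hs' hs'']
        · rintro s ⟨hs, -⟩ s' ⟨-, hs'⟩ hadj
          rw [Set.mem_insert_iff, not_or] at hs'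
          exact ⟨hexit p q hpq hlt hp hq htn s hs s' hs'.1 hadj, hs'.2⟩
      rcases h.mem_facesWithin_cases ht (hP'.subset hP'.start_mem) with rfl | hy | hy
      · exact absurd rfl hty.ne
      · obtain ⟨hsub, hst⟩ := hmain a w ht.adj_left hlt1 ht.left_mem ht.mid_mem
          ht.notMem_facesWithin_left ht.facesWithin_left_subset (by omega) hy
        refine .left ht hst (hright fun s hs e => ?_)
        rcases e with rfl | hs'
        exacts [ht.notMem_facesWithin_right hs, hdisj s (hsub hs') hs]
      · obtain ⟨hsub, hst⟩ := hmain w b ht.adj_right hlt2 ht.mid_mem ht.right_mem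
          ht.notMem_facesWithin_right ht.facesWithin_right_subset (by omega) hy
        refine .right ht (hleft fun s hs e => ?_) hst
        rcases e with rfl | hs'
        exacts [ht.notMem_facesWithin_left hs, hdisj s hs (hsub hs')]

/-- The Strahler number is at most logarithmic. -/
theorem strahlerLE_of_ncard_lt [Finite V] (hab : G.Adj a b)
    (hk : {v | f a < f v ∧ f v ≤ f b}.ncard < 2 ^ (k + 1)) : StrahlerLE G f a b k := by
  obtain ⟨n, hn⟩ : ∃ n : ℕ, f b - f a ≤ n := ⟨(f b - f a).toNat, by omega⟩
  induction n generalizing a b k with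
  | zero => exact .consecutive fun x hx => by omega
  | succ n ih =>
    by_cases hc : ∃ y, f a < f y ∧ f y < f b
    · obtain ⟨y, hy⟩ := hc
      obtain ⟨t, w, ht⟩ := h.exists_faceTriple_of_between hab hy.1 hy.2
      have h1 := ht.left_lt
      have h2 := ht.lt_right
      push_cast at hn
      -- The polygon edges under `ab`, that is, the leaves of the binary tree, are counted by their
      -- right ends; the count is additive over the two sides.
      have hunion : {v | f a < f v ∧ f v ≤ f b} =
          {v | f a < f v ∧ f v ≤ f w} ∪ {v | f w < f v ∧ f v ≤ f b} := by
        ext v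
        simp only [Set.mem_ofPred_eq, Set.mem_union]
        omega
      have hcard := Set.ncard_union_eq (s := {v | f a < f v ∧ f v ≤ f w})
        (t := {v | f w < f v ∧ f v ≤ f b}) (Set.disjoint_left.2 fun v hv hv' => by
          simp only [Set.mem_ofPred_eq] at hv hv'
          omega) (Set.toFinite _) (Set.toFinite _)
      rw [← hunion] at hcard
      have hpos1 : 0 < {v | f a < f v ∧ f v ≤ f w}.ncard :=
        (Set.ncard_pos (Set.toFinite _)).2 ⟨w, h1, le_rfl⟩
      have hpos2 : 0 < {v | f w < f v ∧ f v ≤ f b}.ncard :=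
        (Set.ncard_pos (Set.toFinite _)).2 ⟨b, h2, le_rfl⟩
      cases k with
      | zero => omega
      | succ k =>
        rw [pow_succ] at hk
        -- The two sides cannot both have `2 ^ (k + 1)` leaves, so one of them has number at most
        -- `k`.
        by_cases hle : {v | f w < f v ∧ f v ≤ f b}.ncard < 2 ^ (k + 1)
        · exact .left ht (ih ht.adj_left (by rw [pow_succ]; omega) (by omega))
            (ih ht.adj_right hle (by omega))
        · exact .right ht (ih ht.adj_left (by omega) (by omega))
            (ih ht.adj_right (by rw [pow_succ]; omega) (by omega))
    · exact .consecutive fun y hy => hc ⟨y, hy⟩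

end IsTriangulation

end Strahler

/-! ### Chains of faces -/

section Chains

variable {V : Type*} {G : SimpleGraph V} {f : V → ℤ} {K : ℕ} {l m r : ℕ → V}

/-- A sequence of faces with vertices `l i`, `m i`, `r i` (in this order), each but the first of
which lies under one of the two lower edges of its predecessor. -/
structure IsFaceChain (G : SimpleGraph V) (f : V → ℤ) (K : ℕ) (l m r : ℕ → V) : Prop where
  triple : ∀ i ≤ K, ∃ t : Face G, IsFaceTriple f t (l i) (m i) (r i)
  step : ∀ i < K, (l (i + 1) = l i ∧ r (i + 1) = m i) ∨ (l (i + 1) = m i ∧ r (i + 1) = r i)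

/-- The vertices of the `i`-th face of a chain. -/
def chainFace (l m r : ℕ → V) (i : ℕ) : Set V := {l i, m i, r i}

theorem mem_chainFace {i : ℕ} {v : V} : v ∈ chainFace l m r i ↔ v = l i ∨ v = m i ∨ v = r i :=
  Iff.rfl

namespace IsFaceChain

variable (hc : IsFaceChain G f K l m r) {i j : ℕ} {v : V}
include hc

theorem left_lt (hi : i ≤ K) : f (l i) < f (m i) := (hc.triple i hi).elim fun _ ht => ht.left_lt
theorem lt_right (hi : i ≤ K) : f (m i) < f (r i) := (hc.triple i hi).elim fun _ ht => ht.lt_right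
theorem adj_left (hi : i ≤ K) : G.Adj (l i) (m i) := (hc.triple i hi).elim fun _ ht => ht.adj_left
theorem adj_right (hi : i ≤ K) : G.Adj (m i) (r i) := (hc.triple i hi).elim fun _ ht => ht.adj_right
theorem adj (hi : i ≤ K) : G.Adj (l i) (r i) := (hc.triple i hi).elim fun _ ht => ht.adj

theorem adj_of_mem {x y : V} (hi : i ≤ K) (hx : x ∈ chainFace l m r i)
    (hy : y ∈ chainFace l m r i) (hne : x ≠ y) : G.Adj x y := by
  obtain ⟨t, ht⟩ := hc.triple i hi
  exact t.adj ((ht.mem_iff x).2 hx) ((ht.mem_iff y).2 hy) hne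

theorem mono {K' : ℕ} (hK : K' ≤ K) : IsFaceChain G f K' l m r :=
  ⟨fun i hi => hc.triple i (hi.trans hK), fun i hi => hc.step i (hi.trans_le hK)⟩

theorem nested (hij : i ≤ j) (hj : j ≤ K) : f (l i) ≤ f (l j) ∧ f (r j) ≤ f (r i) := by
  induction j, hij using Nat.le_induction with
  | base => exact ⟨le_rfl, le_rfl⟩
  | succ j hij ih =>
    have := ih (by omega)
    have h1 := hc.left_lt (i := j) (by omega)
    have h2 := hc.lt_right (i := j) (by omega)
    rcases hc.step j (by omega) with ⟨h3, h4⟩ | ⟨h3, h4⟩ <;> rw [h3, h4] <;> constructor <;> omega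

theorem mem_Icc (hi : i ≤ K) (hv : v ∈ chainFace l m r i) : f (l i) ≤ f v ∧ f v ≤ f (r i) := by
  have h1 := hc.left_lt hi
  have h2 := hc.lt_right hi
  rcases hv with rfl | rfl | rfl <;> constructor <;> omega

/-- The vertices of a face are not strictly inside the intervals of later faces. -/
theorem outside (hij : i < j) (hj : j ≤ K) (hv : v ∈ chainFace l m r i) :
    f v ≤ f (l j) ∨ f (r j) ≤ f v := by
  have h0 := hc.nested hij hj
  have h1 := hc.left_lt (i := i) (by omega)
  have h2 := hc.lt_right (i := i) (by omega)
  rcases hc.step i (by omega) with ⟨h3, h4⟩ | ⟨h3, h4⟩ <;> rw [h3, h4] at h0 <;>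
    rcases hv with rfl | rfl | rfl <;> omega

theorem next_subset (hi : i < K) {v : V} (hv : v = l (i + 1) ∨ v = r (i + 1)) :
    v ∈ chainFace l m r i := by
  rw [mem_chainFace]
  rcases hc.step i hi with ⟨h1, h2⟩ | ⟨h1, h2⟩ <;> rw [h1, h2] at hv <;> tauto

theorem neg : IsFaceChain G (fun v => -f v) K r m l :=
  ⟨fun i hi => (hc.triple i hi).imp fun _ ht => ht.neg, fun i hi => by
    have := hc.step i hi
    tauto⟩

end IsFaceChain

/-- The union of the faces of a chain. -/
def chainGraph (hc : IsFaceChain G f K l m r) : G.Subgraph where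
  verts := {v | ∃ i ≤ K, v ∈ chainFace l m r i}
  Adj x y := ∃ i ≤ K, x ≠ y ∧ x ∈ chainFace l m r i ∧ y ∈ chainFace l m r i
  adj_sub := fun ⟨_, hi, hne, hx, hy⟩ => hc.adj_of_mem hi hx hy hne
  edge_vert := fun ⟨i, hi, _, hx, _⟩ => ⟨i, hi, hx⟩
  symm := ⟨fun _ _ ⟨i, hi, hne, hx, hy⟩ => ⟨i, hi, hne.symm, hy, hx⟩⟩

namespace IsFaceChain

/-- After the first triangle, each face adds only its apex `m i`, since its top edge belongs to the
preceding face. -/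
theorem ncard_verts_le [Finite V] (hc : IsFaceChain G f K l m r) :
    (chainGraph hc).verts.ncard ≤ K + 3 := by
  induction K with
  | zero =>
    have : (chainGraph hc).verts ⊆ {l 0, m 0, r 0} := by
      rintro v ⟨i, hi, hv⟩
      obtain rfl : i = 0 := by omega
      exact hv
    refine (Set.ncard_le_ncard this (Set.toFinite _)).trans ?_
    refine (Set.ncard_insert_le _ _).trans (Nat.succ_le_succ ?_)
    refine (Set.ncard_insert_le _ _).trans (Nat.succ_le_succ ?_)
    simp
  | succ K ih =>
    have hc' := hc.mono (Nat.le_succ K)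
    have : (chainGraph hc).verts ⊆ insert (m (K + 1)) (chainGraph hc').verts := by
      rintro v ⟨i, hi, hv⟩
      rcases hi.lt_or_eq with hi | rfl
      · exact .inr ⟨i, by omega, hv⟩
      · rcases hv with rfl | rfl | rfl
        · exact .inr ⟨K, le_rfl, hc.next_subset (Nat.lt_succ_self K) (.inl rfl)⟩
        · exact .inl rfl
        · exact .inr ⟨K, le_rfl, hc.next_subset (Nat.lt_succ_self K) (.inr rfl)⟩
    refine (Set.ncard_le_ncard this (Set.toFinite _)).trans ?_
    exact (Set.ncard_insert_le _ _).trans (Nat.succ_le_succ (ih hc'))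

/-- The apex of each further face is a new vertex, so both edges at it are new. -/
theorem le_ncard_edgeSet [Finite V] (hc : IsFaceChain G f K l m r) :
    2 * K + 3 ≤ (chainGraph hc).edgeSet.ncard := by
  induction K with
  | zero =>
    have h1 := hc.adj_left le_rfl
    have h2 := hc.adj_right le_rfl
    have h3 := hc.adj le_rfl
    have h1' := h1.ne
    have h2' := h2.ne
    have h3' := h3.ne
    have hsub : {s(l 0, m 0), s(m 0, r 0), s(l 0, r 0)} ⊆ (chainGraph hc).edgeSet := by
      rintro e (rfl | rfl | rfl)
      · exact ⟨0, le_rfl, h1', by simp [chainFace], by simp [chainFace]⟩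
      · exact ⟨0, le_rfl, h2', by simp [chainFace], by simp [chainFace]⟩
      · exact ⟨0, le_rfl, h3', by simp [chainFace], by simp [chainFace]⟩
    refine le_trans ?_ (Set.ncard_le_ncard hsub (Set.toFinite _))
    rw [Set.ncard_insert_of_notMem, Set.ncard_pair]
    · simp only [ne_eq, Sym2.eq_iff]
      tauto
    · simp only [Set.mem_insert_iff, Set.mem_singleton_iff, Sym2.eq_iff]
      tauto
  | succ K ih =>
    have hc' := hc.mono (Nat.le_succ K)
    have hm : m (K + 1) ∉ (chainGraph hc').verts := by
      rintro ⟨i, hi, hv⟩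
      have h1 := hc.outside (j := K + 1) (Nat.lt_succ_of_le hi) le_rfl hv
      have h2 := hc.left_lt (i := K + 1) le_rfl
      have h3 := hc.lt_right (i := K + 1) le_rfl
      omega
    have hsub : insert s(l (K + 1), m (K + 1))
        (insert s(m (K + 1), r (K + 1)) (chainGraph hc').edgeSet) ⊆ (chainGraph hc).edgeSet := by
      rintro e (rfl | rfl | he)
      · exact ⟨K + 1, le_rfl, (hc.adj_left le_rfl).ne, by simp [chainFace], by simp [chainFace]⟩
      · exact ⟨K + 1, le_rfl, (hc.adj_right le_rfl).ne, by simp [chainFace], by simp [chainFace]⟩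
      · induction e using Sym2.ind with
        | _ x y =>
          obtain ⟨i, hi, h⟩ := he
          exact ⟨i, by omega, h⟩
    refine le_trans ?_ (Set.ncard_le_ncard hsub (Set.toFinite _))
    rw [Set.ncard_insert_of_notMem, Set.ncard_insert_of_notMem]
    · have := ih hc'
      omega
    · exact fun he => hm ((chainGraph hc').edge_vert he)
    · rintro (he | he)
      · rw [Sym2.eq_iff] at he
        have := (hc.adj_right (i := K + 1) le_rfl).ne
        have := (hc.adj (i := K + 1) le_rfl).ne
        tauto
      · exact hm ((chainGraph hc').edge_vert he.symm)

end IsFaceChain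

theorem isOuterplanar_coe (hf : IsOuterplanar G) (P : G.Subgraph) : IsOuterplanar P.coe := by
  obtain ⟨g, hg, hcr⟩ := hf
  refine ⟨fun v => g v, fun a b hab => Subtype.ext (hg hab), ?_⟩
  intro a b c d hab hbc hcd hadj
  exact hcr a b c d hab hbc hcd ⟨P.adj_sub hadj.1, P.adj_sub hadj.2⟩

theorem ncard_edgeSet_coe (P : G.Subgraph) : P.coe.edgeSet.ncard = P.edgeSet.ncard := by
  rw [← P.image_coe_edgeSet_coe]
  exact (Set.ncard_image_of_injective _ (Sym2.map.injective Subtype.val_injective)).symm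

namespace IsTriangulation

variable [Finite V] (h : IsTriangulation G f)
include h

/-- At least `2K + 3` edges on at most `K + 3` vertices reach the extremal number `2n - 3`, so
maximality follows by counting. -/
theorem isMaximalOuterplanar_chainGraph (hc : IsFaceChain G f K l m r) :
    IsMaximalOuterplanar (chainGraph hc).coe := by
  have h1 := hc.ncard_verts_le
  have h2 := hc.le_ncard_edgeSet
  have h3 : 2 ≤ (chainGraph hc).verts.ncard := by
    rw [← Set.ncard_pair (hc.adj_left (i := 0) (Nat.zero_le _)).ne]
    refine Set.ncard_le_ncard ?_ (Set.toFinite _)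
    rintro v (rfl | rfl)
    · exact ⟨0, Nat.zero_le _, by simp [chainFace]⟩
    · exact ⟨0, Nat.zero_le _, by simp [chainFace]⟩
  refine isMaximalOuterplanar_of_ncard_edgeSet (isOuterplanar_coe h.isOuterplanar _) ?_ ?_
  · rwa [Nat.card_coe_set_eq]
  · rw [Nat.card_coe_set_eq, ncard_edgeSet_coe]
    omega

-- The union of the faces has no unexpected triangles. The long edge `xz` of a triangle belongs to
-- some face `i`. If it is the top edge there, uniqueness of the apex decides. If it is a lower
-- edge, the third vertex comes from a later face, so the chain continues under `xz` and the
-- triangle is face `i + 1`.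
omit [Finite V] in
theorem exists_chainFace_of_face (hc : IsFaceChain G f K l m r)
    (t : Face (chainGraph hc).spanningCoe) :
    ∃ i ≤ K, ∀ v, v ∈ t.1 ↔ v ∈ chainFace l m r i := by
  obtain ⟨x, y, z, ht⟩ :=
    (h.toIsNoncrossing.mono (chainGraph hc).spanningCoe_le).exists_isFaceTriple t
  have hxy := (chainGraph hc).adj_sub ht.adj_left
  have hyz := (chainGraph hc).adj_sub ht.adj_right
  obtain ⟨i, hi, -, hx, hz⟩ := ht.adj
  obtain ⟨j, hj, -, -, hy⟩ := ht.adj_left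
  have hlt1 := ht.left_lt
  have hlt2 := ht.lt_right
  have hi1 := hc.left_lt hi
  have hi2 := hc.lt_right hi
  have hmid : ∀ k ≤ K, x = l k → z = r k → y = m k := fun k hk h1 h2 => by
    subst h1 h2
    exact h.mid_unique hlt2 hlt1 hxy hyz (hc.left_lt hk) (hc.lt_right hk)
      (hc.adj_left hk) (hc.adj_right hk)
  by_cases hlr : x = l i ∧ z = r i
  · refine ⟨i, hi, fun v => ?_⟩
    rw [ht.mem_iff, mem_chainFace, hmid i hi hlr.1 hlr.2, hlr.1, hlr.2]
  have hij : i < j := by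
    by_contra hji
    rcases (not_lt.1 hji).lt_or_eq with hji | rfl
    · have := hc.outside hji hi hy
      have := (hc.mem_Icc hi hx).1
      have := (hc.mem_Icc hi hz).2
      omega
    · rcases hx with rfl | rfl | rfl <;> rcases hz with rfl | rfl | rfl <;>
        rcases hy with rfl | rfl | rfl <;> first | omega | exact hlr ⟨rfl, rfl⟩
  have hyj := hc.mem_Icc hj hy
  have hn := hc.nested (Nat.succ_le_of_lt hij) hj
  have hnext : x = l (i + 1) ∧ z = r (i + 1) := by
    rcases hc.step i (by omega) with ⟨h1, h2⟩ | ⟨h1, h2⟩ <;> rw [h1, h2] at hn ⊢ <;>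
      rcases hx with rfl | rfl | rfl <;> rcases hz with rfl | rfl | rfl <;>
      first | omega | exact ⟨rfl, rfl⟩ | exact absurd ⟨rfl, rfl⟩ hlr
  refine ⟨i + 1, by omega, fun v => ?_⟩
  rw [ht.mem_iff, mem_chainFace, hmid (i + 1) (by omega) hnext.1 hnext.2, hnext.1, hnext.2]

omit [Finite V] in
/-- The dual tree of the union of a chain of faces is a path. -/
theorem exists_iso_dualTree_chainGraph (hc : IsFaceChain G f K l m r) :
    ∃ e : SimpleGraph.pathGraph (K + 1) ≃g dualTree (chainGraph hc).spanningCoe,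
      ∀ i v, v ∈ (e i).1 ↔ v ∈ chainFace l m r i := by
  have hface : ∀ i : Fin (K + 1), ∃ t : Face (chainGraph hc).spanningCoe,
      ∀ v, v ∈ t.1 ↔ v ∈ chainFace l m r i := by
    intro i
    have hi : (i : ℕ) ≤ K := by omega
    refine Face.exists_of_adj (x := l i) (y := m i) (z := r i) ?_ ?_ ?_
    · exact ⟨i, hi, (hc.adj_left hi).ne, by simp [chainFace], by simp [chainFace]⟩
    · exact ⟨i, hi, (hc.adj_right hi).ne, by simp [chainFace], by simp [chainFace]⟩
    · exact ⟨i, hi, (hc.adj hi).ne, by simp [chainFace], by simp [chainFace]⟩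
  choose φ hφ using hface
  have hinj : ∀ i j : Fin (K + 1), i < j → φ i ≠ φ j := by
    intro i j hij he
    have hj : (j : ℕ) ≤ K := by omega
    have := hc.outside hij hj (v := m j) (by rw [← hφ, he, hφ]; simp [chainFace])
    have := hc.left_lt hj
    have := hc.lt_right hj
    omega
  have hadj : ∀ i j : Fin (K + 1), i < j →
      ((dualTree (chainGraph hc).spanningCoe).Adj (φ i) (φ j) ↔ i.val + 1 = j.val) := by
    intro i j hij
    have hj : (j : ℕ) ≤ K := by omega
    rw [dualTree_adj_iff]
    constructor
    · rintro ⟨-, x, y, hne, ⟨hxi, hyi⟩, hxj, hyj⟩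
      rw [hφ] at hxi hyi hxj hyj
      by_contra hne'
      -- A vertex of face `i` is not strictly inside the interval of face `i + 1`, and a vertex of
      -- face `j` lies in that of face `i + 2`, one end of which is `m (i + 1)`. Only one vertex
      -- satisfies both, so no edge is shared.
      have hij' : i.val + 1 < j.val := by
        have : i.val < j.val := hij
        omega
      have h1 := hc.outside (j := i + 1) (Nat.lt_succ_self _) (by omega) hxi
      have h2 := hc.outside (j := i + 1) (Nat.lt_succ_self _) (by omega) hyi
      have h3 := hc.mem_Icc hj hxj
      have h4 := hc.mem_Icc hj hyj
      have h5 := hc.nested (Nat.succ_le_of_lt hij') hj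
      have h6 := h.inj.ne hne
      have h7 := hc.left_lt (i := i + 1) (by omega)
      have h8 := hc.lt_right (i := i + 1) (by omega)
      rcases hc.step (i + 1) (by omega) with ⟨h9, h10⟩ | ⟨h9, h10⟩ <;> rw [h9, h10] at h5 <;>
        omega
    · intro he
      have hi : (i : ℕ) < K := by omega
      refine ⟨hinj i j hij, l j, r j, (hc.adj hj).ne, ?_, ?_⟩
      · rw [hφ, hφ, ← he]
        exact ⟨hc.next_subset hi (.inl rfl), hc.next_subset hi (.inr rfl)⟩
      · rw [hφ, hφ]
        simp [chainFace]
  refine ⟨⟨Equiv.ofBijective φ ⟨fun i j he => ?_, fun t => ?_⟩, ?_⟩, hφ⟩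
  · rcases lt_trichotomy i j with hij | hij | hij
    exacts [absurd he (hinj i j hij), hij, absurd he.symm (hinj j i hij)]
  · obtain ⟨i, hi, ht⟩ := h.exists_chainFace_of_face hc t
    exact ⟨⟨i, by omega⟩, Face.ext_iff_mem.2 fun v => (hφ _ v).trans (ht v).symm⟩
  · intro i j
    change (dualTree (chainGraph hc).spanningCoe).Adj (φ i) (φ j) ↔ _
    rw [SimpleGraph.pathGraph_adj]
    rcases lt_trichotomy i j with hij | rfl | hij
    · have : i.val < j.val := hij
      rw [hadj i j hij]
      omega
    · simp
    · have : j.val < i.val := hij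
      rw [SimpleGraph.adj_comm, hadj j i hij]
      omega

theorem isOuterplanarPath_chainGraph (hc : IsFaceChain G f K l m r) :
    IsOuterplanarPath (chainGraph hc) :=
  ⟨h.isMaximalOuterplanar_chainGraph hc, K,
    (h.exists_iso_dualTree_chainGraph hc).elim fun e _ => ⟨e⟩⟩

theorem connectsEdges_chainGraph (hc : IsFaceChain G f K l m r) {x y : V} (hxy : x ≠ y)
    (hx : x ∈ chainFace l m r K) (hy : y ∈ chainFace l m r K) :
    ConnectsEdges (chainGraph hc) s(l 0, r 0) s(x, y) := by
  obtain ⟨e, he⟩ := h.exists_iso_dualTree_chainGraph hc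
  refine ⟨h.isMaximalOuterplanar_chainGraph hc, K, e, ⟨?_, ?_⟩, ?_, ?_⟩
  · exact ⟨0, Nat.zero_le _, (hc.adj (Nat.zero_le _)).ne, by simp [chainFace],
      by simp [chainFace]⟩
  · intro v hv
    rw [he]
    rcases Sym2.mem_iff.1 hv with rfl | rfl <;> simp [chainFace]
  · exact ⟨K, le_rfl, hxy, hx, hy⟩
  · intro v hv
    rw [he]
    rcases Sym2.mem_iff.1 hv with rfl | rfl <;> simpa

end IsTriangulation

end Chains

/-! ### Umbrella systems from Strahler numbers -/

section UmbrellaConstruction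

variable {V : Type*} {G : SimpleGraph V} {f : V → ℤ} {K k : ℕ} {l m r : ℕ → V}

/-- The lower edges of the faces of a chain either carry a part of Strahler number at most `k` or
belong to the next face. -/
structure HasSmallSides (G : SimpleGraph V) (f : V → ℤ) (k K : ℕ) (l m r : ℕ → V) : Prop where
  left : ∀ i ≤ K, StrahlerLE G f (l i) (m i) k ∨
    (i < K ∧ l (i + 1) = l i ∧ r (i + 1) = m i)
  right : ∀ i ≤ K, StrahlerLE G f (m i) (r i) k ∨
    (i < K ∧ l (i + 1) = m i ∧ r (i + 1) = r i)

theorem HasSmallSides.neg (hs : HasSmallSides G f k K l m r) :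
    HasSmallSides G (fun v => -f v) k K r m l :=
  ⟨fun i hi => (hs.right i hi).imp (·.neg) (by tauto),
    fun i hi => (hs.left i hi).imp (·.neg) (by tauto)⟩

/-- The edges of a chain with small sides are small, unless a vertex of the chain lies under
them. -/
theorem HasSmallSides.edge_cases (hs : HasSmallSides G f k K l m r)
    (hc : IsFaceChain G f K l m r) {x z : V} (hxz : (chainGraph hc).Adj x z) (hlt : f x < f z) :
    StrahlerLE G f x z k ∨ ∃ y ∈ (chainGraph hc).verts, f x < f y ∧ f y < f z := by
  obtain ⟨i, hi, -, hx, hz⟩ := hxz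
  have h1 := hc.left_lt hi
  have h2 := hc.lt_right hi
  have hnext : i < K → f (l (i + 1)) < f (m (i + 1)) ∧ f (m (i + 1)) < f (r (i + 1)) ∧
      m (i + 1) ∈ (chainGraph hc).verts := fun hi =>
    ⟨hc.left_lt hi, hc.lt_right hi, i + 1, hi, by simp [chainFace]⟩
  have hcases : (x = l i ∧ z = m i) ∨ (x = m i ∧ z = r i) ∨ (x = l i ∧ z = r i) := by
    rcases hx with rfl | rfl | rfl <;> rcases hz with rfl | rfl | rfl <;> first | omega | simp
  rcases hcases with ⟨rfl, rfl⟩ | ⟨rfl, rfl⟩ | ⟨rfl, rfl⟩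
  · refine (hs.left i hi).imp_right fun ⟨hi', h3, h4⟩ => ?_
    obtain ⟨h5, h6, h7⟩ := hnext hi'
    rw [h3] at h5
    rw [h4] at h6
    exact ⟨_, h7, h5, h6⟩
  · refine (hs.right i hi).imp_right fun ⟨hi', h3, h4⟩ => ?_
    obtain ⟨h5, h6, h7⟩ := hnext hi'
    rw [h3] at h5
    rw [h4] at h6
    exact ⟨_, h7, h5, h6⟩
  · exact .inr ⟨m i, ⟨i, hi, by simp [chainFace]⟩, h1, h2⟩

/-- Putting a new first entry in front of a sequence. -/
def consSeq (a : V) (l : ℕ → V) : ℕ → V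
  | 0 => a
  | n + 1 => l n

theorem isFaceChain_zero {a w b : V} {t : Face G} (ht : IsFaceTriple f t a w b) :
    IsFaceChain G f 0 (fun _ => a) (fun _ => w) (fun _ => b) :=
  ⟨fun _ _ => ⟨t, ht⟩, fun _ hi => absurd hi (Nat.not_lt_zero _)⟩

theorem IsFaceChain.cons {a w b : V} {t : Face G} (ht : IsFaceTriple f t a w b)
    (hc : IsFaceChain G f K l m r) (h0 : (l 0 = a ∧ r 0 = w) ∨ (l 0 = w ∧ r 0 = b)) :
    IsFaceChain G f (K + 1) (consSeq a l) (consSeq w m) (consSeq b r) := by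
  refine ⟨fun i hi => ?_, fun i hi => ?_⟩
  · cases i with
    | zero => exact ⟨t, ht⟩
    | succ i => exact hc.triple i (by omega)
  · cases i with
    | zero => exact h0
    | succ i => exact hc.step i (by omega)

theorem HasSmallSides.cons {a w b : V} (hs : HasSmallSides G f k K l m r)
    (hl : StrahlerLE G f a w k ∨ (l 0 = a ∧ r 0 = w))
    (hr : StrahlerLE G f w b k ∨ (l 0 = w ∧ r 0 = b)) :
    HasSmallSides G f k (K + 1) (consSeq a l) (consSeq w m) (consSeq b r) := by
  refine ⟨fun i hi => ?_, fun i hi => ?_⟩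
  · cases i with
    | zero => exact hl.imp_right fun h => ⟨Nat.succ_pos _, h⟩
    | succ i => exact (hs.left i (by omega)).imp_right fun h => ⟨by omega, h.2⟩
  · cases i with
    | zero => exact hr.imp_right fun h => ⟨Nat.succ_pos _, h⟩
    | succ i => exact (hs.right i (by omega)).imp_right fun h => ⟨by omega, h.2⟩

theorem hasSmallSides_zero {a w b : V} (hl : StrahlerLE G f a w k) (hr : StrahlerLE G f w b k) :
    HasSmallSides G f k 0 (fun _ => a) (fun _ => w) (fun _ => b) :=
  ⟨fun _ _ => .inl hl, fun _ _ => .inl hr⟩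

/-- A part of Strahler number at most `k + 1` has a chain of faces with small sides from its root
edge to another outer edge. -/
theorem StrahlerLE.exists_chain {a b : V} {n : ℕ}
    (hs : StrahlerLE G f a b n) (hn : n = k + 1) (hab : G.Adj a b)
    (hy : ∃ y, f a < f y ∧ f y < f b) :
    ∃ K l m r, IsFaceChain G f K l m r ∧ HasSmallSides G f k K l m r ∧ l 0 = a ∧ r 0 = b ∧
      ((∀ x, ¬(f (l K) < f x ∧ f x < f (m K))) ∨ ∀ x, ¬(f (m K) < f x ∧ f x < f (r K))) := by
  induction hs with
  | consecutive hc => exact absurd hy.choose_spec (hc _)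
  | @left a w b k' t ht h₁ h₂ ih _ =>
    obtain rfl : k' = k := by omega
    -- The chain follows the side whose number may be `k + 1`. If nothing lies under that side, its
    -- edge is the outer edge at which the chain stops.
    by_cases hy' : ∃ y, f a < f y ∧ f y < f w
    · obtain ⟨K, l, m, r, hc, hsm, h0, h0', hlast⟩ := ih rfl ht.adj_left hy'
      exact ⟨K + 1, consSeq a l, consSeq w m, consSeq b r, hc.cons ht (.inl ⟨h0, h0'⟩),
        hsm.cons (.inr ⟨h0, h0'⟩) (.inl h₂), rfl, rfl, hlast⟩
    · push Not at hy'
      have hcons : ∀ x, ¬(f a < f x ∧ f x < f w) := fun x hx => by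
        have := hy' x
        omega
      exact ⟨0, _, _, _, isFaceChain_zero ht, hasSmallSides_zero (.consecutive hcons) h₂, rfl, rfl,
        .inl hcons⟩
  | @right a w b k' t ht h₁ h₂ _ ih =>
    obtain rfl : k' = k := by omega
    by_cases hy' : ∃ y, f w < f y ∧ f y < f b
    · obtain ⟨K, l, m, r, hc, hsm, h0, h0', hlast⟩ := ih rfl ht.adj_right hy'
      exact ⟨K + 1, consSeq a l, consSeq w m, consSeq b r, hc.cons ht (.inr ⟨h0, h0'⟩),
        hsm.cons (.inl h₁) (.inr ⟨h0, h0'⟩), rfl, rfl, hlast⟩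
    · push Not at hy'
      have hcons : ∀ x, ¬(f w < f x ∧ f x < f b) := fun x hx => by
        have := hy' x
        omega
      exact ⟨0, _, _, _, isFaceChain_zero ht, hasSmallSides_zero h₁ (.consecutive hcons), rfl, rfl,
        .inr hcons⟩

namespace IsTriangulation

variable [Finite V] (h : IsTriangulation G f) {a b : V}
include h

omit [Finite V] in
/-- The chain of all faces at `a` under the edge `ab`. -/
theorem exists_fan (hab : G.Adj a b) (hs : StrahlerLE G f a b k)
    (hy : ∃ y, f a < f y ∧ f y < f b) :
    ∃ K l m r, IsFaceChain G f K l m r ∧ HasSmallSides G f k K l m r ∧ r 0 = b ∧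
      (∀ i, i ≤ K → l i = a) ∧
      ∀ v, G.Adj a v → f a < f v → f v ≤ f b → ∃ i ≤ K, v ∈ chainFace l m r i := by
  obtain ⟨n, hn⟩ : ∃ n : ℕ, f b - f a ≤ n := ⟨(f b - f a).toNat, by omega⟩
  induction n generalizing b with
  | zero =>
    obtain ⟨y, hy⟩ := hy
    omega
  | succ n ih =>
    obtain ⟨y, hy⟩ := hy
    obtain ⟨t, w, ht⟩ := h.exists_faceTriple_of_between hab hy.1 hy.2
    obtain ⟨hl, hr⟩ := h.strahlerLE_sides hs ht
    have h1 := ht.left_lt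
    have h2 := ht.lt_right
    -- An edge from `a` to a vertex strictly between `w` and `b` would cross `wb`. So the fan
    -- descends on the left side only.
    have hv : ∀ v, G.Adj a v → f a < f v → f v ≤ f b → v = b ∨ f v ≤ f w := by
      intro v hav hlt hle
      by_contra! hcon
      have := h.inj.ne hcon.1
      exact h.not_cross a w v b h1 hcon.2 (by omega) hav ht.adj_right
    by_cases hy' : ∃ y, f a < f y ∧ f y < f w
    · push_cast at hn
      obtain ⟨K, l, m, r, hc, hsm, h0, hl', hcov⟩ := ih ht.adj_left hl hy' (by omega)
      refine ⟨K + 1, consSeq a l, consSeq w m, consSeq b r,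
        hc.cons ht (.inl ⟨hl' 0 (Nat.zero_le _), h0⟩), hsm.cons (.inl hl) (.inl hr), rfl, ?_, ?_⟩
      · rintro (_ | i) hi
        exacts [rfl, hl' i (by omega)]
      · intro v hav hlt hle
        rcases hv v hav hlt hle with rfl | hle'
        · exact ⟨0, Nat.zero_le _, by simp [chainFace, consSeq]⟩
        · obtain ⟨i, hi, hmem⟩ := hcov v hav hlt hle'
          exact ⟨i + 1, by omega, hmem⟩
    · push Not at hy'
      refine ⟨0, _, _, _, isFaceChain_zero ht, hasSmallSides_zero hl hr, rfl, fun _ _ => rfl, ?_⟩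
      intro v hav hlt hle
      refine ⟨0, le_rfl, ?_⟩
      rcases hv v hav hlt hle with rfl | hle'
      · simp [chainFace]
      · obtain rfl : v = w := h.inj (by
          have := hy' v hlt
          omega)
        simp [chainFace]

/-- The fan at the left end of the root edge of a chain. -/
theorem exists_left_fan (hc : IsFaceChain G f K l m r) (hs : HasSmallSides G f k K l m r)
    (ha : l 0 = a) (hb : r 0 = b) :
    ∃ (F : G.Subgraph) (i : ℕ), i ≤ K ∧ l i = a ∧ (i = K ∨ l (i + 1) = m i) ∧
      IsFan (intervalSubgraph G f a b) (chainGraph hc) a F ∧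
      (∀ v ∈ F.verts, f a ≤ f v ∧ f v ≤ f (m i)) ∧
      (∀ x z, F.Adj x z → f x < f z →
        StrahlerLE G f x z k ∨ ∃ y ∈ F.verts, f x < f y ∧ f y < f z) ∧
      ∀ v, G.Adj a v → f a < f v → f v ≤ f b → v ∈ (chainGraph hc).verts ∪ F.verts := by
  -- Face `i` is the last one with left end `a`: after it the chain stops or continues with left end
  -- `m i`.
  obtain ⟨i, hiK, hia, hmax⟩ : ∃ i ≤ K, l i = a ∧ (i = K ∨ l (i + 1) ≠ a) := by
    by_contra! hcon
    have : ∀ i ≤ K, l i = a := by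
      intro i
      induction i with
      | zero => exact fun _ => ha
      | succ i ih =>
        intro hi
        exact (hcon i (by omega) (ih (by omega))).2
    exact (hcon K le_rfl (this K le_rfl)).1 rfl
  have hbefore : ∀ j ≤ i, l j = a := by
    intro j hj
    have h1 := (hc.nested (Nat.zero_le j) (hj.trans hiK)).1
    have h2 := (hc.nested hj hiK).1
    rw [ha] at h1
    rw [hia] at h2
    exact h.inj (by omega)
  have hturn : i = K ∨ l (i + 1) = m i := by
    rcases hiK.eq_or_lt with hi | hi
    · exact .inl hi
    · rcases hc.step i hi with h1 | h1
      · rcases hmax with h2 | h2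
        exacts [.inl h2, absurd (h1.1.trans hia) h2]
      · exact .inr h1.1
  have h1 := hc.left_lt hiK
  have h2 := hc.lt_right hiK
  have hadj := hc.adj_left hiK
  rw [hia] at h1 hadj
  -- The chain does not continue under the edge from `a` to `m i`, so this is one of its small
  -- sides.
  have hside : StrahlerLE G f a (m i) k := by
    rcases hs.left i hiK with h3 | ⟨h3, h4, -⟩
    · rwa [hia] at h3
    · rcases hturn with h5 | h5
      · omega
      · rw [h4, hia] at h5
        exact absurd h5 hadj.ne
  -- Apart from `a`, the chain has no vertex before `m i`. Hence a fan under the edge from `a` to `m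
  -- i` shares just this edge with the chain.
  have hlow : ∀ v ∈ (chainGraph hc).verts, v = a ∨ f (m i) ≤ f v := by
    rintro v ⟨j, hj, hv⟩
    have hva := (hc.mem_Icc hj hv).1
    have hva' := (hc.nested (Nat.zero_le j) hj).1
    rw [ha] at hva'
    rcases lt_trichotomy i j with hij | rfl | hij
    · have h3 := (hc.nested (Nat.succ_le_of_lt hij) hj).1
      have h4 : l (i + 1) = m i := hturn.resolve_left (by omega)
      rw [Nat.succ_eq_add_one, h4] at h3
      exact .inr (by omega)
    · rcases hv with rfl | rfl | rfl
      exacts [.inl hia, .inr le_rfl, .inr (by omega)]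
    · rcases hc.outside hij hiK hv with h3 | h3
      · rw [hia] at h3
        exact .inl (h.inj (by omega))
      · exact .inr (by omega)
  -- An edge at `a` cannot end strictly between `m j` and `r j`, as it would cross the right lower
  -- edge of face `j`. Step by step up to face `i`, neighbours of `a` off the chain are confined to
  -- the interval from `a` to `m i`.
  have hnbr : ∀ v, G.Adj a v → f a < f v → f v ≤ f b →
      v ∈ (chainGraph hc).verts ∨ f v ≤ f (m i) := by
    intro v hav hlt hle
    have key : ∀ j ≤ i, v ∈ (chainGraph hc).verts ∨ f v ≤ f (m j) := by
      intro j
      have hstep : ∀ j ≤ i, f v ≤ f (r j) → v ∈ (chainGraph hc).verts ∨ f v ≤ f (m j) := by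
        intro j hj hvr
        by_contra! hcon
        have hjK := hj.trans hiK
        have hne : v ≠ r j := by
          rintro rfl
          exact hcon.1 ⟨j, hjK, by simp [chainFace]⟩
        have h3 := h.inj.ne hne
        have h4 := hc.left_lt hjK
        rw [hbefore j hj] at h4
        exact h.not_cross a (m j) v (r j) h4 hcon.2 (by omega) hav (hc.adj_right hjK)
      induction j with
      | zero => exact fun h0 => hstep 0 h0 (hb ▸ hle)
      | succ j ih =>
        intro hj
        rcases ih (by omega) with h3 | h3
        · exact .inl h3
        · refine hstep (j + 1) hj ?_
          have h4 := hc.left_lt (i := j) (by omega)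
          rcases hc.step j (by omega) with h5 | h5
          · rw [h5.2]
            exact h3
          · rw [hbefore (j + 1) hj] at h5
            rw [hbefore j (by omega), ← h5.1] at h4
            omega
    exact key i le_rfl
  have hb' : f (m i) ≤ f b := by
    have h3 := (hc.nested (Nat.zero_le i) hiK).2
    rw [hb] at h3
    omega
  by_cases hy : ∃ y, f a < f y ∧ f y < f (m i)
  · obtain ⟨K', l', m', r', hc', hs', h0', hl', hcov⟩ := h.exists_fan hadj hside hy
    have hrange : ∀ v ∈ (chainGraph hc').verts, f a ≤ f v ∧ f v ≤ f (m i) := by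
      rintro v ⟨j, hj, hv⟩
      have h3 := hc'.mem_Icc hj hv
      have h4 := hc'.nested (Nat.zero_le j) hj
      rw [hl' 0 (Nat.zero_le _), h0'] at h4
      omega
    refine ⟨chainGraph hc', i, hiK, hia, hturn, .inr ⟨h.isOuterplanarPath_chainGraph hc', ?_, ?_,
      s(a, m i), by simp, ?_⟩, hrange, fun x z hxz hlt => hs'.edge_cases hc' hxz hlt, ?_⟩
    · refine ⟨fun v hv => ?_, fun x y hxy => ?_⟩
      · have := hrange v hv
        exact ⟨this.1, by omega⟩
      · have h3 := hrange x ((chainGraph hc').edge_vert hxy)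
        have h4 := hrange y ((chainGraph hc').edge_vert hxy.symm)
        exact intervalSubgraph_adj.2 ⟨⟨h3.1, by omega⟩, ⟨h4.1, by omega⟩,
          (chainGraph hc').adj_sub hxy⟩
    · rintro v ⟨j, hj, hv⟩
      by_cases hva : v = a
      · exact .inl hva
      · have h3 := hrange v ⟨j, hj, hv⟩
        refine .inr (intervalSubgraph_adj.2 ⟨⟨le_rfl, by omega⟩, ⟨h3.1, by omega⟩, ?_⟩)
        exact hc'.adj_of_mem hj (mem_chainFace.2 (.inl (hl' j hj).symm)) hv (Ne.symm hva)
    · ext e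
      induction e using Sym2.ind with
      | _ x y =>
        rw [Set.mem_inter_iff, SimpleGraph.Subgraph.mem_edgeSet, SimpleGraph.Subgraph.mem_edgeSet,
          Set.mem_singleton_iff]
        constructor
        · rintro ⟨hxy', hxy⟩
          have key : ∀ v ∈ (chainGraph hc').verts, v ∈ (chainGraph hc).verts →
              v = a ∨ v = m i := fun v hv hv' =>
            (hlow v hv').imp_right fun h3 => h.inj (le_antisymm (hrange v hv).2 h3)
          rcases key x ((chainGraph hc').edge_vert hxy') ((chainGraph hc).edge_vert hxy) with
            rfl | rfl <;>
            rcases key y ((chainGraph hc').edge_vert hxy'.symm)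
              ((chainGraph hc).edge_vert hxy.symm) with rfl | rfl
          · exact absurd rfl hxy.ne
          · rfl
          · exact Sym2.eq_swap
          · exact absurd rfl hxy.ne
        · intro he
          have h3 : (chainGraph hc').Adj a (m i) := ⟨0, Nat.zero_le _, hadj.ne, by
            simp [chainFace, hl'], by simp [chainFace, h0']⟩
          have h4 : (chainGraph hc).Adj a (m i) := ⟨i, hiK, hadj.ne, by
            simp [chainFace, hia], by simp [chainFace]⟩
          rcases Sym2.eq_iff.1 he with ⟨rfl, rfl⟩ | ⟨rfl, rfl⟩
          exacts [⟨h3, h4⟩, ⟨h3.symm, h4.symm⟩]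
    · intro v hav hlt hle
      exact (hnbr v hav hlt hle).imp_right fun h3 => hcov v hav hlt h3
  · refine ⟨⊥, i, hiK, hia, hturn, .inl rfl, by simp, by simp, fun v hav hlt hle => .inl ?_⟩
    rcases hnbr v hav hlt hle with h3 | h3
    · exact h3
    · obtain rfl : v = m i := h.inj (by
        by_contra hne
        exact hy ⟨v, hlt, by omega⟩)
      exact ⟨i, hiK, by simp [chainFace]⟩

end IsTriangulation

/-- Different positions at which a chain leaves the two ends of its root edge. -/
theorem IsFaceChain.turn_le (hc : IsFaceChain G f K l m r) {i j : ℕ} (hi : i ≤ K) (hj : j ≤ K)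
    (hl : i = K ∨ l (i + 1) = m i) (hr : j = K ∨ r (j + 1) = m j) : f (m i) ≤ f (m j) := by
  rcases lt_trichotomy i j with hij | rfl | hij
  · have h1 := (hc.nested (Nat.succ_le_of_lt hij) hj).1
    have h2 : l (i + 1) = m i := hl.resolve_left (by omega)
    rw [Nat.succ_eq_add_one, h2] at h1
    have := hc.left_lt hj
    omega
  · exact le_rfl
  · have h1 := (hc.nested (Nat.succ_le_of_lt hij) hi).2
    have h2 : r (j + 1) = m j := hr.resolve_left (by omega)
    rw [Nat.succ_eq_add_one, h2] at h1
    have := hc.lt_right hi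
    omega

theorem chainGraph_neg (hc : IsFaceChain G f K l m r) : chainGraph hc.neg = chainGraph hc := by
  have : ∀ i v, v ∈ chainFace r m l i ↔ v ∈ chainFace l m r i := by
    intro i v
    rw [mem_chainFace, mem_chainFace]
    tauto
  ext <;> simp [chainGraph, this]

theorem intervalSubgraph_neg {a b : V} :
    intervalSubgraph G (fun v => -f v) b a = intervalSubgraph G f a b := by
  ext
  · simp [and_comm]
  · simp only [intervalSubgraph_adj, neg_le_neg_iff]
    tauto

/-- A part of Strahler number at most `k + 1` has an umbrella that leaves only parts of Strahler
number at most `k`. -/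
theorem StrahlerLE.exists_umbrella [Finite V] (hG : IsMaximalOuterplanar G)
    (h : IsTriangulation G f) {a b : V}
    (hs : StrahlerLE G f a b (k + 1)) (hab : G.Adj a b) (hy : ∃ y, f a < f y ∧ f y < f b) :
    ∃ U, IsUmbrella (intervalSubgraph G f a b) s(a, b) U ∧ a ∈ U.verts ∧ b ∈ U.verts ∧
      ∀ x z, U.Adj x z → f x < f z →
        StrahlerLE G f x z k ∨ ∃ y ∈ U.verts, f x < f y ∧ f y < f z := by
  obtain ⟨y₀, hy₀⟩ := hy
  have hlt : f a < f b := hy₀.1.trans hy₀.2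
  obtain ⟨K, l, m, r, hc, hsm, ha, hb, hlast⟩ := hs.exists_chain rfl hab ⟨y₀, hy₀⟩
  obtain ⟨F₁, i, hiK, hia, hti, hF₁, hrange₁, hedge₁, hcov₁⟩ := h.exists_left_fan hc hsm ha hb
  -- The fan at `b` is the left fan for the reversed order.
  obtain ⟨F₂, j, hjK, hjb, htj, hF₂, hrange₂, hedge₂, hcov₂⟩ :=
    (hG.isTriangulation h.toIsNoncrossing.neg).exists_left_fan hc.neg hsm.neg hb ha
  rw [chainGraph_neg hc] at hF₂ hcov₂
  rw [intervalSubgraph_neg] at hF₂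
  have hij := hc.turn_le hiK hjK hti htj
  have hsub : ∀ v ∈ (chainGraph hc).verts, f a ≤ f v ∧ f v ≤ f b := by
    rintro v ⟨i, hi, hv⟩
    have h1 := hc.mem_Icc hi hv
    have h2 := hc.nested (Nat.zero_le i) hi
    rw [ha, hb] at h2
    omega
  have haP : a ∈ (chainGraph hc).verts := ⟨0, Nat.zero_le _, by simp [chainFace, ha]⟩
  have hbP : b ∈ (chainGraph hc).verts := ⟨0, Nat.zero_le _, by simp [chainFace, hb]⟩
  refine ⟨chainGraph hc ⊔ F₁ ⊔ F₂, ⟨h.isNonCuttingEdge_root hab hlt, a, b, chainGraph hc, rfl,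
    ⟨fun v hv => hsub v hv, fun x y hxy => intervalSubgraph_adj.2
      ⟨hsub x ((chainGraph hc).edge_vert hxy), hsub y ((chainGraph hc).edge_vert hxy.symm),
        (chainGraph hc).adj_sub hxy⟩⟩, ?_, F₁, F₂, rfl, hF₁, hF₂, ?_, ?_⟩,
    .inl (.inl haP), .inl (.inl hbP), ?_⟩
  · have h1 := hc.left_lt le_rfl
    have h2 := hc.lt_right le_rfl
    have h3 := hc.nested (Nat.zero_le K) le_rfl
    rw [ha, hb] at h3
    have key : ∀ x z, G.Adj x z → f a ≤ f x → f x < f z → f z ≤ f b →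
        (∀ y, ¬(f x < f y ∧ f y < f z)) →
        IsNonCuttingEdge (intervalSubgraph G f a b) s(x, z) := by
      intro x z hxz h4 h5 h6 h7
      refine ⟨intervalSubgraph_adj.2 ⟨⟨h4, h5.le.trans h6⟩, ⟨h4.trans h5.le, h6⟩, hxz⟩,
        fun hcut => ?_⟩
      obtain ⟨y, hy⟩ := ((h.isCuttingEdge_intervalSubgraph_iff hab hxz h4 h5 h6).1 hcut).1
      exact h7 y hy
    have hcd := fun x y => h.connectsEdges_chainGraph hc (x := x) (y := y)
    rw [ha, hb] at hcd
    rcases hlast with hlast | hlast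
    · refine ⟨s(l K, m K), ?_, key _ _ (hc.adj_left le_rfl) (by omega) h1 (by omega) hlast,
        hcd _ _ (hc.adj_left le_rfl).ne (by simp [chainFace]) (by simp [chainFace])⟩
      rw [ne_eq, Sym2.eq_iff]
      rintro (⟨h4, h5⟩ | ⟨h4, h5⟩)
      · rw [h5] at h2
        omega
      · rw [h4] at h1
        omega
    · refine ⟨s(m K, r K), ?_, key _ _ (hc.adj_right le_rfl) (by omega) h2 (by omega) hlast,
        hcd _ _ (hc.adj_right le_rfl).ne (by simp [chainFace]) (by simp [chainFace])⟩
      rw [ne_eq, Sym2.eq_iff]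
      rintro (⟨h4, h5⟩ | ⟨h4, h5⟩)
      · rw [h4] at h1
        omega
      · rw [h5] at h2
        omega
  -- The fans lie in `[a, m i]` and `[m j, b]`, and `m i` does not come after `m j`, so they have at
  -- most one vertex in common.
  · refine Set.disjoint_left.2 fun e => ?_
    induction e using Sym2.ind with
    | _ x y =>
      intro he₁ he₂
      have h1 := hrange₁ x (F₁.edge_vert he₁)
      have h2 := hrange₁ y (F₁.edge_vert (SimpleGraph.Subgraph.Adj.symm he₁))
      have h3 := hrange₂ x (F₂.edge_vert he₂)
      have h4 := hrange₂ y (F₂.edge_vert (SimpleGraph.Subgraph.Adj.symm he₂))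
      have hxy : G.Adj x y := F₁.adj_sub he₁
      exact hxy.ne (h.inj (by omega))
  · rintro v (hv | hv)
    · obtain ⟨-, hv, hav⟩ := intervalSubgraph_adj.1 hv
      have := h.inj.ne hav.ne
      rcases hcov₁ v hav (by omega) hv.2 with h1 | h1
      exacts [.inl (.inl h1), .inl (.inr h1)]
    · obtain ⟨-, hv, hbv⟩ := intervalSubgraph_adj.1 hv
      have := h.inj.ne hbv.ne
      rcases hcov₂ v hbv (by omega) (by omega) with h1 | h1
      exacts [.inl (.inl h1), .inr h1]
  · rintro x z ((hxz | hxz) | hxz) hlt'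
    · refine (hsm.edge_cases hc hxz hlt').imp_right ?_
      rintro ⟨y, hy, hy'⟩
      exact ⟨y, .inl (.inl hy), hy'⟩
    · refine (hedge₁ x z hxz hlt').imp_right ?_
      rintro ⟨y, hy, hy'⟩
      exact ⟨y, .inl (.inr hy), hy'⟩
    · refine (hedge₂ z x (SimpleGraph.Subgraph.Adj.symm hxz) (by omega)).imp (fun h1 => ?_) ?_
      · simpa using h1.neg
      · rintro ⟨y, hy, hy'⟩
        exact ⟨y, .inr hy, by omega⟩

/-! ### Depth of systems of umbrellas -/

theorem CapSystem.depth_mk {IsPiece : G.Subgraph → Sym2 V → G.Subgraph → Prop}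
    {H : G.Subgraph} {c : Sym2 V} {U : G.Subgraph} (hU : IsPiece H c U)
    (sub : ∀ (e : Sym2 V) (S : G.Subgraph), IsHangingSubgraph H c U e S → CapSystem IsPiece S e) :
    (CapSystem.mk H c U hU sub).depth = 1 + ⨆ e, ⨆ S, ⨆ h, (sub e S h).depth := rfl

theorem CapSystem.depth_mk_le_iff {IsPiece : G.Subgraph → Sym2 V → G.Subgraph → Prop}
    {H : G.Subgraph} {c : Sym2 V} {U : G.Subgraph} (hU : IsPiece H c U)
    (sub : ∀ (e : Sym2 V) (S : G.Subgraph), IsHangingSubgraph H c U e S → CapSystem IsPiece S e)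
    {d : ℕ} : (CapSystem.mk H c U hU sub).depth ≤ (d + 1 : ℕ) ↔
      ∀ e S h, (sub e S h).depth ≤ d := by
  rw [CapSystem.depth_mk]
  push_cast
  rw [add_comm, ENat.add_le_add_iff_right ENat.one_ne_top]
  simp only [iSup_le_iff]

/-- An edge with a vertex of the umbrella under it cuts the umbrella, because `a` or `b` lies on the
other side. So an anchor-edge carries a part of Strahler number at most `k`, to which the induction
hypothesis applies. Number zero is impossible when a vertex lies under `ab`. -/
theorem StrahlerLE.umbrellaDepth_le [Finite V] (hG : IsMaximalOuterplanar G)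
    (h : IsTriangulation G f) {a b : V} {k : ℕ} (hs : StrahlerLE G f a b k) (hab : G.Adj a b)
    (hy : ∃ y, f a < f y ∧ f y < f b) :
    ∃ 𝒰 : UmbrellaSystem (intervalSubgraph G f a b) s(a, b), 𝒰.depth ≤ k := by
  induction k generalizing a b with
  | zero =>
    cases hs with
    | consecutive hc => exact absurd hy.choose_spec (hc _)
  | succ k ih =>
    obtain ⟨U, hU, ha, hb, hedge⟩ := hs.exists_umbrella hG h hab hy
    have hlt : f a < f b := hy.elim fun y hy => hy.1.trans hy.2
    have key : ∀ (e : Sym2 V) (S : G.Subgraph),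
        IsHangingSubgraph (intervalSubgraph G f a b) s(a, b) U e S →
        ∃ 𝒰 : UmbrellaSystem S e, 𝒰.depth ≤ k := by
      intro e S hS
      obtain ⟨x, z, rfl, hxz⟩ : ∃ x z, e = s(x, z) ∧ f x < f z := by
        have he := hS.1.1
        clear hS
        induction e using Sym2.ind with
        | _ x z =>
          rcases h.lt_or_gt_of_ne (U.adj_sub he).ne with h1 | h1
          exacts [⟨x, z, rfl, h1⟩, ⟨z, x, Sym2.eq_swap, h1⟩]
      obtain ⟨⟨hUe, hcut, hncut⟩, hcomp, hc⟩ := hS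
      obtain ⟨hx, hz, hadj⟩ : (f a ≤ f x ∧ f x ≤ f b) ∧ (f a ≤ f z ∧ f z ≤ f b) ∧ G.Adj x z :=
        intervalSubgraph_adj.1 hcut.1
      obtain ⟨hbet, hne⟩ :=
        (h.isCuttingEdge_intervalSubgraph_iff hab hadj hx.1 hxz hz.2).1 hcut
      obtain rfl := h.eq_intervalSubgraph_of_isCutComponent hab hadj hx.1 hxz hz.2 hcomp hc
      rcases hedge x z hUe hxz with h1 | ⟨y, hyU, hy'⟩
      · exact ih h1 hadj hbet
      · refine absurd ?_ hncut
        rcases hne with hne | hne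
        · have := h.inj.ne hne
          exact h.isCuttingEdge_of_sides hUe hyU hy' ha (by omega)
        · have := h.inj.ne hne
          exact h.isCuttingEdge_of_sides hUe hyU hy' hb (by omega)
    choose sub hsub using key
    exact ⟨.mk _ _ U hU sub, (CapSystem.depth_mk_le_iff hU sub).2 hsub⟩

end UmbrellaConstruction

/-! ### Pathwidth is at most twice the bonnet depth -/

section FaceSets

variable {V : Type*} {G : SimpleGraph V}

/-- The faces of `G` that are faces of the subgraph `P`. -/
def faceSet (P : G.Subgraph) : Set (Face G) := {t | P.spanningCoe.IsNClique 3 t.1}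

theorem adj_of_mem_faceSet {P : G.Subgraph} {t : Face G} (ht : t ∈ faceSet P) {x y : V}
    (hx : x ∈ t.1) (hy : y ∈ t.1) (hne : x ≠ y) : P.Adj x y :=
  SimpleGraph.IsNClique.isClique ht hx hy hne

theorem exists_mem_faceSet {P : G.Subgraph} {x y z : V} (hxy : P.Adj x y) (hyz : P.Adj y z)
    (hxz : P.Adj x z) : ∃ t ∈ faceSet P, ∀ v, v ∈ t.1 ↔ v = x ∨ v = y ∨ v = z := by
  obtain ⟨t, ht⟩ := Face.exists_of_adj (K := P.spanningCoe) hxy hyz hxz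
  exact ⟨⟨t.1, t.2.mono P.spanningCoe_le⟩, t.2, ht⟩

theorem exists_two_of_face {K : SimpleGraph V} (t : Face K) (x y : V) : ∃ z ∈ t.1, z ≠ x ∧ z ≠ y := by
  classical
  by_contra! hcon
  have hsub : t.1 ⊆ {x, y} := by
    intro z hz
    by_cases hzx : z = x
    · simp [hzx]
    · simp [hcon z hz hzx]
  have := Finset.card_le_card hsub
  rw [t.2.card_eq] at this
  have := Finset.card_le_two (a := x) (b := y)
  omega

theorem faceSet_bot : faceSet (⊥ : G.Subgraph) = ∅ := by
  rw [Set.eq_empty_iff_forall_notMem]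
  intro t ht
  obtain ⟨x, hx, y, hy, hxy⟩ := Finset.one_lt_card.1 (show 1 < t.1.card by
    rw [t.2.card_eq]; norm_num)
  exact adj_of_mem_faceSet ht hx hy hxy

/-- A maximal outerplanar subgraph of an outerplanar graph is induced. -/
theorem adj_of_isMaximalOuterplanar_coe (hG : IsOuterplanar G) {P : G.Subgraph}
    (hP : IsMaximalOuterplanar P.coe) {x y : V} (hx : x ∈ P.verts) (hy : y ∈ P.verts)
    (hxy : G.Adj x y) : P.Adj x y := by
  have hK : IsOuterplanar (G.induce P.verts) := by
    obtain ⟨g, hg, hcr⟩ := hG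
    exact ⟨fun v => g v, fun a b hab => Subtype.ext (hg hab), fun a b c d hab hbc hcd hadj =>
      hcr a b c d hab hbc hcd hadj⟩
  have hle : G.induce P.verts ≤ P.coe := hP.2 hK fun a b hab => P.adj_sub hab
  exact hle (show (G.induce P.verts).Adj ⟨x, hx⟩ ⟨y, hy⟩ from hxy)

/-- The face `t` guarantees a third vertex, so the edge has a side on which there is an apex. -/
theorem exists_face_of_adj [Finite V] {P : G.Subgraph} (hP : IsMaximalOuterplanar P.coe)
    (t : Face P.spanningCoe) {x y : V} (hxy : P.Adj x y) :
    ∃ s ∈ faceSet P, x ∈ s.1 ∧ y ∈ s.1 := by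
  obtain ⟨g, hg⟩ := IsOuterplanar.exists_isNoncrossing hP.1
  have h := hP.isTriangulation hg
  have key : ∀ x y : P.verts, P.coe.Adj x y → g x < g y → ∃ w, P.coe.Adj x w ∧ P.coe.Adj w y := by
    intro x y hxy hlt
    obtain ⟨z, hz, hzx, hzy⟩ := exists_two_of_face t x y
    obtain ⟨z', hz', hzz'⟩ := Finset.exists_mem_ne (s := t.1) (by rw [t.2.card_eq]; norm_num) z
    have hzP : z ∈ P.verts := P.edge_vert (t.adj hz hz' hzz'.symm)
    have h1 : g ⟨z, hzP⟩ ≠ g x := hg.inj.ne fun e => hzx (congrArg Subtype.val e)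
    have h2 : g ⟨z, hzP⟩ ≠ g y := hg.inj.ne fun e => hzy (congrArg Subtype.val e)
    by_cases hbet : g x < g ⟨z, hzP⟩ ∧ g ⟨z, hzP⟩ < g y
    · obtain ⟨w, -, -, hw⟩ := h.exists_mid x y hxy ⟨_, hbet⟩
      exact ⟨w, hw⟩
    · obtain ⟨w, -, hw⟩ := h.exists_outer x y hxy hlt ⟨⟨z, hzP⟩, by omega⟩
      exact ⟨w, hw⟩
  have key' : ∃ w, P.Adj x w ∧ P.Adj w y := by
    have hx := P.edge_vert hxy
    have hy := P.edge_vert hxy.symm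
    have hxy' : P.coe.Adj ⟨x, hx⟩ ⟨y, hy⟩ := hxy
    rcases h.lt_or_gt_of_ne hxy'.ne with hlt | hlt
    · obtain ⟨w, h1, h2⟩ := key _ _ hxy' hlt
      exact ⟨w, h1, h2⟩
    · obtain ⟨w, h1, h2⟩ := key _ _ hxy'.symm hlt
      exact ⟨w, h2.symm, h1.symm⟩
  obtain ⟨w, h1, h2⟩ := key'
  obtain ⟨s, hs, hmem⟩ := exists_mem_faceSet h1 h2 hxy
  exact ⟨s, hs, by simp [hmem], by simp [hmem]⟩

/-- The face `t` provides a second vertex, so `x` has a predecessor or a successor in the order; the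
edge to it lies on a face. -/
theorem exists_face_of_mem_verts [Finite V] {P : G.Subgraph} (hP : IsMaximalOuterplanar P.coe)
    (t : Face P.spanningCoe) {x : V} (hx : x ∈ P.verts) : ∃ s ∈ faceSet P, x ∈ s.1 := by
  obtain ⟨g, hg⟩ := IsOuterplanar.exists_isNoncrossing hP.1
  have h := hP.isTriangulation hg
  obtain ⟨z, hz, hzx, -⟩ := exists_two_of_face t x x
  obtain ⟨z', hz', hzz'⟩ := Finset.exists_mem_ne (s := t.1) (by rw [t.2.card_eq]; norm_num) z
  have hzP : z ∈ P.verts := P.edge_vert (t.adj hz hz' hzz'.symm)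
  have key : ∃ y, P.coe.Adj ⟨x, hx⟩ y := by
    rcases h.lt_or_gt_of_ne (a := ⟨z, hzP⟩) (b := ⟨x, hx⟩)
      (fun e => hzx (congrArg Subtype.val e)) with hlt | hlt
    · obtain ⟨s, hs, hmax⟩ := Set.exists_max_image {v | g v < g ⟨x, hx⟩} g (Set.toFinite _)
        ⟨_, hlt⟩
      refine ⟨s, (h.adj_of_consecutive s ⟨x, hx⟩ hs fun v hv => ?_).symm⟩
      by_contra hv'
      have := hmax v (not_le.1 hv')
      omega
    · obtain ⟨s, hs, hmin⟩ := Set.exists_min_image {v | g ⟨x, hx⟩ < g v} g (Set.toFinite _)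
        ⟨_, hlt⟩
      exact ⟨s, h.adj_of_consecutive ⟨x, hx⟩ s hs fun v hv => hmin v hv⟩
  obtain ⟨y, hy⟩ := key
  obtain ⟨s, hs, hxs, -⟩ := exists_face_of_adj hP t (show P.Adj x y from hy)
  exact ⟨s, hs, hxs⟩

theorem isPathSet_of_seq {W : Type*} {T : SimpleGraph W} (ψ : ℕ → W) {k : ℕ}
    (hadj : ∀ i < k, T.Adj (ψ i) (ψ (i + 1)))
    (hinj : ∀ i ≤ k, ∀ j ≤ k, ψ i = ψ j → i = j) :
    IsPathSet T Set.univ {w | ∃ i ≤ k, w = ψ i} (ψ k) (ψ 0) := by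
  induction k with
  | zero =>
    have : {w | ∃ i ≤ 0, w = ψ i} = {ψ 0} := by
      ext w
      simp
    rw [this]
    exact .nil trivial
  | succ k ih =>
    have h1 := ih (fun i hi => hadj i (by omega)) fun i hi j hj => hinj i (by omega) j (by omega)
    have : {w | ∃ i ≤ k + 1, w = ψ i} = insert (ψ (k + 1)) {w | ∃ i ≤ k, w = ψ i} := by
      ext w
      constructor
      · rintro ⟨i, hi, rfl⟩
        rcases hi.lt_or_eq with hi | rfl
        exacts [.inr ⟨i, by omega, rfl⟩, .inl rfl]
      · rintro (rfl | ⟨i, hi, rfl⟩)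
        exacts [⟨k + 1, le_rfl, rfl⟩, ⟨i, by omega, rfl⟩]
    rw [this]
    refine h1.cons (hadj k (Nat.lt_succ_self k)).symm trivial ?_
    rintro ⟨i, hi, he⟩
    have := hinj (k + 1) le_rfl i (by omega) he
    omega

/-- The faces of an outerplanar path form a path in the dual graph. -/
theorem exists_isPathSet_faceSet {P : G.Subgraph} {k : ℕ}
    (e : SimpleGraph.pathGraph (k + 1) ≃g dualTree P.spanningCoe) :
    ∃ s t, IsPathSet (dualTree G) Set.univ (faceSet P) s t := by
  let φ : Fin (k + 1) → Face G := fun i => ⟨(e i).1, (e i).2.mono P.spanningCoe_le⟩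
  have hφ : ∀ i j, φ i = φ j → i = j := fun i j hij =>
    e.injective (Subtype.ext (congrArg (fun s : Face G => s.1) hij))
  have hadj : ∀ i j, (SimpleGraph.pathGraph (k + 1)).Adj i j → (dualTree G).Adj (φ i) (φ j) := by
    intro i j hij
    obtain ⟨-, x, y, hxy, h1, h2⟩ := dualTree_adj_iff.1 (e.map_adj_iff.2 hij)
    exact dualTree_adj_iff.2 ⟨fun h => hij.ne (hφ i j h), x, y, hxy, h1, h2⟩
  have hval : ∀ i, i ≤ k → (Fin.ofNat (k + 1) i).val = i := fun i hi => by
    rw [Fin.val_ofNat]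
    exact Nat.mod_eq_of_lt (by omega)
  have hpath := isPathSet_of_seq (T := dualTree G) (fun i => φ (Fin.ofNat (k + 1) i)) (k := k)
    (fun i hi => hadj _ _ (SimpleGraph.pathGraph_adj.2 (.inl (by
      rw [hval i (by omega), hval (i + 1) (by omega)]))))
    (fun i hi j hj hij => by rw [← hval i hi, ← hval j hj, hφ _ _ hij])
  have heq : {w | ∃ i ≤ k, w = φ (Fin.ofNat (k + 1) i)} = faceSet P := by
    ext w
    constructor
    · rintro ⟨i, -, rfl⟩
      exact (e (Fin.ofNat (k + 1) i)).2
    · intro hw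
      obtain ⟨i, hi⟩ := e.surjective ⟨w.1, hw⟩
      refine ⟨i, by omega, Subtype.ext ?_⟩
      have : Fin.ofNat (k + 1) i = i := Fin.ext (hval i (by omega))
      simp only [this, φ, hi]
  rw [heq] at hpath
  exact ⟨_, _, hpath⟩

theorem ConnectedSet.union_of_adj {W : Type*} {T : SimpleGraph W} {A B : Set W}
    (hA : ConnectedSet T A) (hB : ConnectedSet T B) {a b : W} (ha : a ∈ A) (hb : b ∈ B)
    (hab : T.Adj a b) : ConnectedSet T (A ∪ B) := by
  have key : ∀ x ∈ A ∪ B, JoinedWithin T (A ∪ B) x a := by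
    rintro x (hx | hx)
    · exact (hA x hx a ha).mono Set.subset_union_left
    · exact ((hB x hx b hb).mono Set.subset_union_right).trans
        (.of_adj (.inr hb) (.inl ha) hab.symm)
  exact fun x hx y hy => (key x hx).trans (key y hy).symm

/-- A common face would have an edge that avoids `c` and belongs to both subgraphs. -/
theorem disjoint_faceSet {P F : G.Subgraph} {c : V}
    (h : ∀ x y, F.Adj x y → P.Adj x y → x = c ∨ y = c) : Disjoint (faceSet F) (faceSet P) := by
  refine Set.disjoint_left.2 fun t ht ht' => ?_
  obtain ⟨x, hx, hxc, -⟩ := exists_two_of_face t c c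
  obtain ⟨y, hy, hyc, hyx⟩ := exists_two_of_face t c x
  rcases h x y (adj_of_mem_faceSet ht hx hy hyx.symm) (adj_of_mem_faceSet ht' hx hy hyx.symm) with
    h1 | h1
  exacts [hxc h1, hyc h1]

end FaceSets

/-! ### Deleting the faces of a bonnet from the dual tree -/

section BonnetBound

variable {V : Type*} {G : SimpleGraph V} {f : V → ℤ}

theorem faceSet_subset_facesWithin {P : G.Subgraph} {a b : V}
    (hP : P ≤ intervalSubgraph G f a b) : faceSet P ⊆ facesWithin G f a b := by
  intro t ht x hx
  obtain ⟨y, hy, hyx, -⟩ := exists_two_of_face t x x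
  exact hP.1 (P.edge_vert (adj_of_mem_faceSet ht hx hy hyx.symm))

/-- The properties of a fan used below: it is empty, or its faces form a path in the dual graph
that is attached to the faces of `P`. -/
theorem IsFan.spec [Finite V] {H P F : G.Subgraph} {u : V} (hF : IsFan H P u F)
    (hP : IsMaximalOuterplanar P.coe) (t₀ : Face P.spanningCoe) :
    (∀ v ∈ F.verts, ∃ s ∈ faceSet F, v ∈ s.1) ∧
      (faceSet F = ∅ ∨ F ≤ H ∧ Disjoint (faceSet F) (faceSet P) ∧
        ∃ a b, IsPathSet (dualTree G) Set.univ (faceSet F) a b ∧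
        ∃ s ∈ faceSet F, ∃ t ∈ faceSet P, (dualTree G).Adj t s) := by
  rcases hF with rfl | ⟨⟨hF, k, ⟨φ⟩⟩, hFH, -, e, hue, he⟩
  · exact ⟨by simp, .inl faceSet_bot⟩
  refine ⟨fun v hv => exists_face_of_mem_verts hF (φ 0) hv, .inr ?_⟩
  induction e using Sym2.ind with
  | _ x y =>
    have hxy : s(x, y) ∈ F.edgeSet ∩ P.edgeSet := he ▸ rfl
    have hd : Disjoint (faceSet F) (faceSet P) := by
      refine disjoint_faceSet (c := u) fun p q hp hq => ?_
      have hpq : s(p, q) ∈ F.edgeSet ∩ P.edgeSet := ⟨hp, hq⟩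
      rw [he, Set.mem_singleton_iff] at hpq
      rw [← hpq, Sym2.mem_iff] at hue
      tauto
    obtain ⟨a, b, hpath⟩ := exists_isPathSet_faceSet φ
    obtain ⟨s, hs, hxs, hys⟩ := exists_face_of_adj hF (φ 0) hxy.1
    obtain ⟨t, ht, hxt, hyt⟩ := exists_face_of_adj hP t₀ hxy.2
    refine ⟨hFH, hd, a, b, hpath, s, hs, t, ht, dualTree_adj_iff.2 ⟨?_, x, y,
      SimpleGraph.Adj.ne (F.adj_sub hxy.1), ⟨hxt, hyt⟩, hxs, hys⟩⟩
    rintro rfl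
    exact hd.notMem_of_mem_left hs ht

namespace IsTriangulation

variable [Finite V] (h : IsTriangulation G f)
include h

/-- If a connected set of faces contains the face at the root edge, every component of the
remaining faces lies under an edge of one of these faces. -/
theorem exists_edge_of_component {a b w : V} {t₀ : Face G} (ht₀ : IsFaceTriple f t₀ a w b)
    {𝒰 C : Set (Face G)} (ht₀U : t₀ ∈ 𝒰)
    (hC : IsComponentSet (dualTree G) (facesWithin G f a b \ 𝒰) C) :
    ∃ x z, f a ≤ f x ∧ f x < f z ∧ f z ≤ f b ∧ (x ≠ a ∨ z ≠ b) ∧ C ⊆ facesWithin G f x z ∧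
      (∃ s, s ∉ 𝒰 ∧ ∃ y, IsFaceTriple f s x y z) ∧
      ∃ t ∈ 𝒰, t ∉ facesWithin G f x z ∧ x ∈ t.1 ∧ z ∈ t.1 := by
  choose X Y Z hXYZ using h.exists_isFaceTriple
  -- The face of `C` with the widest interval is the topmost one. The face across its long edge is
  -- wider still, so it cannot be in `C` and must belong to `𝒰`.
  obtain ⟨s, hsC, hmax⟩ := Set.exists_max_image C (fun s => f (Z s) - f (X s)) (Set.toFinite _)
    hC.nonempty
  have hs := hXYZ s
  obtain ⟨hsD, hsU⟩ := hC.subset hsC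
  have hax := (hsD _ hs.left_mem).1
  have hzb := (hsD _ hs.right_mem).2
  have hne : X s ≠ a ∨ Z s ≠ b := by
    by_contra! hcon
    refine hsU ?_
    have : s = t₀ := h.eq_of_mem_facesWithin ht₀.lt (hcon.1 ▸ hs.left_mem)
      (hcon.2 ▸ hs.right_mem) hsD ht₀.left_mem ht₀.right_mem ht₀.mem_facesWithin
    exact this ▸ ht₀U
  have hlt := hs.lt
  obtain ⟨w', hw', hxw, hwz⟩ := h.exists_outer (X s) (Z s) hs.adj hlt (by
    rcases hne with hne | hne
    · have := h.inj.ne hne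
      exact ⟨a, .inl (by omega)⟩
    · have := h.inj.ne hne
      exact ⟨b, .inr (by omega)⟩)
  have hw'ab : f a ≤ f w' ∧ f w' ≤ f b := by
    rcases hne with hne | hne
    · have := h.inj.ne hne
      exact h.mem_Icc_of_adj ht₀.adj hxw (by omega) (by omega)
    · have := h.inj.ne hne
      exact h.mem_Icc_of_adj ht₀.adj hwz.symm (by omega) (by omega)
  obtain ⟨t, ht⟩ := Face.exists_of_adj hxw hwz hs.adj
  have htD : t ∈ facesWithin G f a b := by
    intro v hv
    rcases (ht v).1 hv with rfl | rfl | rfl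
    exacts [⟨hax, by omega⟩, hw'ab, ⟨by omega, hzb⟩]
  have hxt : X s ∈ t.1 := by simp [ht]
  have hwt : w' ∈ t.1 := by simp [ht]
  have hzt : Z s ∈ t.1 := by simp [ht]
  have htn : t ∉ facesWithin G f (X s) (Z s) := fun hcon => by
    have := hcon w' hwt
    omega
  have hst : (dualTree G).Adj s t := dualTree_adj_iff.2 ⟨fun e => htn (e ▸ hs.mem_facesWithin),
    X s, Z s, hs.adj.ne, ⟨hs.left_mem, hs.right_mem⟩, hxt, hzt⟩
  have htU : t ∈ 𝒰 := by
    by_contra htU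
    have h1 := hmax t (hC.mem_of_adj hsC ⟨htD, htU⟩ hst)
    have h2 := (hXYZ t).mem_facesWithin _ hxt
    have h3 := (hXYZ t).mem_facesWithin _ hwt
    have h4 := (hXYZ t).mem_facesWithin _ hzt
    omega
  refine ⟨X s, Z s, hax, hlt, hzb, hne, ?_, ⟨s, hsU, Y s, hs⟩, t, htU, htn, hxt, hzt⟩
  intro c hc
  refine (hC.connectedSet s hsC c hc).mem_of_closed hs.mem_facesWithin fun p q hp hq hpq => ?_
  by_contra hqn
  obtain ⟨-, h1, h2⟩ := h.mem_of_adj_of_notMem_facesWithin hs.adj hlt hp hqn hpq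
  have := h.eq_of_notMem_facesWithin hlt h1 h2 hqn hxt hzt htn
  exact (hC.subset hq).2 (this ▸ htU)

omit [Finite V] in
/-- An edge of a union of faces that are connected in the dual tree and all lie on the same side
of it is no cutting edge of this union. -/
theorem not_isCuttingEdge_of_connectedSet {U : G.Subgraph} {𝒰 : Set (Face G)}
    (hconn : ConnectedSet (dualTree G) 𝒰)
    (hadj : ∀ t ∈ 𝒰, ∀ x ∈ t.1, ∀ y ∈ t.1, x ≠ y → U.Adj x y)
    (hcov : ∀ v ∈ U.verts, ∃ t ∈ 𝒰, v ∈ t.1) {x y z : V} {s t : Face G}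
    (hs : IsFaceTriple f s x y z) (hsU : s ∉ 𝒰) (htU : t ∈ 𝒰)
    (htn : t ∉ facesWithin G f x z) (hxt : x ∈ t.1) (hzt : z ∈ t.1) :
    ¬IsCuttingEdge U s(x, z) := by
  have hlt := hs.lt
  -- Passing below `xz` inside `𝒰` would lead through `s`, the only face directly under `xz`, which
  -- is not in `𝒰`.
  have hside : ∀ q ∈ 𝒰, q ∉ facesWithin G f x z := by
    intro q hq
    refine (hconn t htU q hq).mem_of_closed (C := {q | q ∉ facesWithin G f x z}) htn ?_
    intro p q hp hq hpq hqD
    obtain ⟨⟨h1, h2⟩, -⟩ := h.mem_of_adj_of_notMem_facesWithin hs.adj hlt hqD hp hpq.symm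
    have := h.eq_of_mem_facesWithin hlt h1 h2 hqD hs.left_mem hs.right_mem hs.mem_facesWithin
    exact hsU (this ▸ hq)
  obtain ⟨w, hwx, hwz, hw⟩ := t.exists_third hxt hzt hs.adj.ne
  have hwt : w ∈ t.1 := by simp [hw]
  have hmem : ∀ q ∈ 𝒰, ∀ v ∈ q.1, v ≠ x → v ≠ z → v ∈ U.verts \ {v | v ∈ s(x, z)} := by
    intro q hq v hv h1 h2
    obtain ⟨v', hv', hne, -⟩ := exists_two_of_face q v v
    refine ⟨U.edge_vert (hadj q hq v hv v' hv' hne.symm), ?_⟩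
    simp [h1, h2]
  have key : ∀ q ∈ 𝒰, ∀ v ∈ q.1, v ≠ x → v ≠ z →
      JoinedWithin U.spanningCoe (U.verts \ {v | v ∈ s(x, z)}) w v := by
    intro q hq
    refine ((hconn t htU q hq).mem_of_closed (C := {q | q ∈ 𝒰 ∧ ∀ v ∈ q.1, v ≠ x → v ≠ z →
      JoinedWithin U.spanningCoe (U.verts \ {v | v ∈ s(x, z)}) w v}) ⟨htU, ?_⟩ ?_).2
    · intro v hv h1 h2
      obtain rfl : v = w := by
        have := (hw v).1 hv
        tauto
      exact .refl (hmem t htU v hwt h1 h2)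
    · rintro p q ⟨hpU, hp⟩ hqU hpq
      refine ⟨hqU, fun v hv h1 h2 => ?_⟩
      obtain ⟨-, p₁, p₂, hne, ⟨hp₁, hp₂⟩, hq₁, hq₂⟩ := dualTree_adj_iff.1 hpq
      have hstep : ∀ p₀ ∈ p.1, p₀ ∈ q.1 → p₀ ≠ x → p₀ ≠ z →
          JoinedWithin U.spanningCoe (U.verts \ {v | v ∈ s(x, z)}) w v := by
        intro p₀ hp₀ hq₀ h3 h4
        have hj := hp p₀ hp₀ h3 h4
        by_cases he : p₀ = v
        · exact he ▸ hj
        · exact hj.trans (.of_adj hj.right_mem (hmem q hqU v hv h1 h2)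
            (hadj q hqU p₀ hq₀ v hv he))
      -- Two different faces on the same side of `xz` cannot both contain it, so the edge that they
      -- share has an end other than `x` and `z`, through which the connection to `w` continues.
      by_cases h3 : p₁ ≠ x ∧ p₁ ≠ z
      · exact hstep p₁ hp₁ hq₁ h3.1 h3.2
      by_cases h4 : p₂ ≠ x ∧ p₂ ≠ z
      · exact hstep p₂ hp₂ hq₂ h4.1 h4.2
      refine absurd ?_ hpq.ne
      have h5 : (x ∈ p.1 ∧ z ∈ p.1) ∧ x ∈ q.1 ∧ z ∈ q.1 := by
        by_cases e1 : p₁ = x <;> by_cases e2 : p₂ = x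
        · exact absurd (e1.trans e2.symm) hne
        · obtain rfl : p₂ = z := by tauto
          subst e1
          exact ⟨⟨hp₁, hp₂⟩, hq₁, hq₂⟩
        · obtain rfl : p₁ = z := by tauto
          subst e2
          exact ⟨⟨hp₂, hp₁⟩, hq₂, hq₁⟩
        · exact absurd ((by tauto : p₁ = z).trans (by tauto : p₂ = z).symm) hne
      exact h.eq_of_notMem_facesWithin hlt h5.1.1 h5.1.2 (hside p hpU) h5.2.1 h5.2.2 (hside q hqU)
  refine fun hcut => (isCuttingEdge_iff.1 hcut).2 fun u hu v hv => ?_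
  have hj : ∀ u ∈ U.verts \ {v | v ∈ s(x, z)},
      JoinedWithin U.spanningCoe (U.verts \ {v | v ∈ s(x, z)}) w u := by
    rintro u ⟨hu, hu'⟩
    obtain ⟨q, hq, huq⟩ := hcov u hu
    simp only [Set.mem_ofPred_eq, Sym2.mem_iff, not_or] at hu'
    exact key q hq u huq hu'.1 hu'.2
  exact (hj u hu).symm.trans (hj v hv)

/-- The ribbon is an induced subgraph containing `a`, `b` and their only common neighbour in the
interval, so it contains the root face `t₀`. The faces of the ribbon and the fans form a connected
set. Each component of the other faces lies under an edge of this set, which is an anchor-edge, so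
`hd` bounds it. The ribbon and the fans cost one level each. -/
theorem pathwidthOn_facesWithin_le_of_isBonnet {a b w : V} {t₀ : Face G}
    (ht₀ : IsFaceTriple f t₀ a w b) {U : G.Subgraph}
    (hU : IsBonnet (intervalSubgraph G f a b) s(a, b) U) {d : ℕ}
    (hd : ∀ x z, IsHangingSubgraph (intervalSubgraph G f a b) s(a, b) U s(x, z)
      (intervalSubgraph G f x z) → ∀ s y, IsFaceTriple (G := G) f s x y z →
      pathwidthOn (dualTree G) (facesWithin G f x z) ≤ d) :
    pathwidthOn (dualTree G) (facesWithin G f a b) ≤ (d + 1 + 1 : ℕ) := by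
  obtain ⟨-, u, v, P, huv, hPH, ⟨-, -, -, -, -, hP, k, φ, -, -⟩, ⟨w', hw'⟩, F₁, F₂, rfl, hF₁, hF₂,
    hdF, -⟩ := hU
  have hcap : (intervalSubgraph G f a b).Adj a w' ∧ (intervalSubgraph G f a b).Adj b w' ∧
      a ∈ P.verts ∧ b ∈ P.verts ∧ w' ∈ P.verts := by
    obtain ⟨h1, h2, h3⟩ := hw'
    have hu : u ∈ P.verts := h3 (by simp)
    have hv : v ∈ P.verts := h3 (by simp)
    have hw : w' ∈ P.verts := h3 (by simp)
    rcases Sym2.eq_iff.1 huv with ⟨rfl, rfl⟩ | ⟨rfl, rfl⟩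
    exacts [⟨h1, h2, hu, hv, hw⟩, ⟨h2, h1, hv, hu, hw⟩]
  obtain ⟨haw, hbw, haP, hbP, hwP⟩ := hcap
  obtain ⟨-, hw1, haw⟩ := intervalSubgraph_adj.1 haw
  obtain ⟨-, hw2, hbw⟩ := intervalSubgraph_adj.1 hbw
  have h1 := h.inj.ne haw.ne
  have h2 := h.inj.ne hbw.ne
  obtain rfl : w = w' := h.mid_unique ht₀.lt_right ht₀.left_lt ht₀.adj_left ht₀.adj_right
    (by omega) (by omega) haw hbw.symm
  have hind := fun x y => adj_of_isMaximalOuterplanar_coe h.isOuterplanar hP (x := x) (y := y)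
  have ht₀P : t₀ ∈ faceSet P := by
    obtain ⟨t, ht, hmem⟩ := exists_mem_faceSet (hind _ _ haP hwP haw)
      (hind _ _ hwP hbP hbw.symm) (hind _ _ haP hbP ht₀.adj)
    have : t₀ = t := Face.ext_iff_mem.2 fun v => (ht₀.mem_iff v).trans (hmem v).symm
    exact this ▸ ht
  obtain ⟨s₁, s₂, hPpath⟩ := exists_isPathSet_faceSet φ
  obtain ⟨hcov₁, hspec₁⟩ := hF₁.spec hP (φ 0)
  obtain ⟨hcov₂, hspec₂⟩ := hF₂.spec hP (φ 0)
  have hfan : ∀ F : G.Subgraph, (faceSet F = ∅ ∨ F ≤ intervalSubgraph G f a b ∧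
      Disjoint (faceSet F) (faceSet P) ∧
        ∃ a b, IsPathSet (dualTree G) Set.univ (faceSet F) a b ∧
        ∃ s ∈ faceSet F, ∃ t ∈ faceSet P, (dualTree G).Adj t s) →
      faceSet F = ∅ ∨ ∃ s t, IsPathSet (dualTree G) (facesWithin G f a b \ faceSet P)
        (faceSet F) s t ∧ ∃ s ∈ faceSet F, ∃ t ∈ faceSet P, (dualTree G).Adj t s := by
    intro F hF
    refine hF.imp_right ?_
    rintro ⟨hFH, hdis, p, q, hpath, hadj⟩
    refine ⟨p, q, hpath.mono fun t ht => ⟨faceSet_subset_facesWithin hFH ht, ?_⟩, hadj⟩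
    exact hdis.notMem_of_mem_left ht
  have hunion : ∀ (F : G.Subgraph) (𝒰 : Set (Face G)), ConnectedSet (dualTree G) 𝒰 →
      faceSet P ⊆ 𝒰 → (faceSet F = ∅ ∨ ∃ s t, IsPathSet (dualTree G)
        (facesWithin G f a b \ faceSet P) (faceSet F) s t ∧
        ∃ s ∈ faceSet F, ∃ t ∈ faceSet P, (dualTree G).Adj t s) →
      ConnectedSet (dualTree G) (𝒰 ∪ faceSet F) := by
    rintro F 𝒰 h𝒰 hsub (hF | ⟨p, q, hpath, s, hs, t, ht, hts⟩)
    · rwa [hF, Set.union_empty]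
    · exact h𝒰.union_of_adj hpath.connectedSet (hsub ht) hs hts
  have hconn := hunion F₂ _ (hunion F₁ _ hPpath.connectedSet subset_rfl (hfan F₁ hspec₁))
    Set.subset_union_left (hfan F₂ hspec₂)
  refine pathwidthOn_le_of_two_fans h.dualTree_isAcyclic
    (hPpath.mono (faceSet_subset_facesWithin hPH)) (hfan F₁ hspec₁) (hfan F₂ hspec₂) ?_ ?_
  -- Edge-disjoint fans share no face at all; the exceptional vertex `c` plays no role.
  · exact disjoint_faceSet (c := a) fun x y hx hy =>
      absurd hy (Set.disjoint_left.1 hdF (show s(x, y) ∈ F₁.edgeSet from hx))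
  · intro C hC
    obtain ⟨x, z, hax, hlt, hzb, hne, hCsub, ⟨s, hsU, y, hs⟩, t, htU, htn, hxt, hzt⟩ :=
      h.exists_edge_of_component ht₀ (.inl (.inl ht₀P)) hC
    have hadj : ∀ t ∈ faceSet P ∪ faceSet F₁ ∪ faceSet F₂, ∀ x ∈ t.1, ∀ y ∈ t.1, x ≠ y →
        (P ⊔ F₁ ⊔ F₂).Adj x y := by
      rintro t ((ht | ht) | ht) x hx y hy hne
      exacts [.inl (.inl (adj_of_mem_faceSet ht hx hy hne)),
        .inl (.inr (adj_of_mem_faceSet ht hx hy hne)), .inr (adj_of_mem_faceSet ht hx hy hne)]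
    have hcov : ∀ v ∈ (P ⊔ F₁ ⊔ F₂).verts, ∃ t ∈ faceSet P ∪ faceSet F₁ ∪ faceSet F₂,
        v ∈ t.1 := by
      rintro v ((hv | hv) | hv)
      · obtain ⟨t, ht, hvt⟩ := exists_face_of_mem_verts hP (φ 0) hv
        exact ⟨t, .inl (.inl ht), hvt⟩
      · obtain ⟨t, ht, hvt⟩ := hcov₁ v hv
        exact ⟨t, .inl (.inr ht), hvt⟩
      · obtain ⟨t, ht, hvt⟩ := hcov₂ v hv
        exact ⟨t, .inr ht, hvt⟩
    have hbet : ∃ y, f x < f y ∧ f y < f z := ⟨y, hs.left_lt, hs.lt_right⟩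
    refine pathwidthOn_mono h.dualTree_isAcyclic hC.connectedSet hCsub (hd x z ⟨⟨?_, ?_, ?_⟩, ?_,
      h.root_notMem_edgeSet hax hzb hne⟩ s y hs)
    · exact hadj t htU x hxt z hzt hs.adj.ne
    · exact (h.isCuttingEdge_intervalSubgraph_iff ht₀.adj hs.adj hax hlt hzb).2 ⟨hbet, hne⟩
    · exact h.not_isCuttingEdge_of_connectedSet hconn hadj hcov hs hsU htU htn hxt hzt
    · exact h.isCutComponent_intervalSubgraph hs.adj hax hlt hzb hbet

/-- Two levels per bonnet add up to `2 * d`. The indices `H` and `c` enter through equations so that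
the induction over the system can vary them. The case `d = 0` does not occur, as a depth is at least
one. -/
theorem pathwidthOn_facesWithin_le_of_depth_le {H : G.Subgraph} {c : Sym2 V}
    (ℬ : BonnetSystem H c) {d : ℕ} (hd : ℬ.depth ≤ d) {a b w : V} {t₀ : Face G}
    (hH : H = intervalSubgraph G f a b) (hc : c = s(a, b)) (ht₀ : IsFaceTriple f t₀ a w b) :
    pathwidthOn (dualTree G) (facesWithin G f a b) ≤ (2 * d : ℕ) := by
  induction ℬ generalizing d a b w t₀ with
  | mk H c U hU sub ih =>
    subst hH hc
    cases d with
    | zero =>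
      rw [CapSystem.depth_mk] at hd
      simp at hd
    | succ d =>
      rw [CapSystem.depth_mk_le_iff] at hd
      exact h.pathwidthOn_facesWithin_le_of_isBonnet ht₀ hU fun x z hS s y hs =>
        ih _ _ hS (hd _ _ hS) rfl rfl hs

end IsTriangulation

end BonnetBound

/-! ### The main theorem -/

section Main

variable {V : Type*} {G : SimpleGraph V}

/-- An umbrella is a bonnet. -/
theorem IsUmbrella.isBonnet {H : G.Subgraph} {c : Sym2 V} {U : G.Subgraph}
    (hU : IsUmbrella H c U) : IsBonnet H c U := by
  obtain ⟨hc, u, v, P, rfl, hPH, ⟨e, hne, he, hconn⟩, hU⟩ := hU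
  -- The cap itself is the first of the two edges connected by the ribbon, and the third vertex of
  -- the first face is the common neighbour.
  refine ⟨hc, u, v, P, rfl, hPH, ⟨_, e, hne.symm, hc, he, hconn⟩, ?_, hU⟩
  obtain ⟨-, k, φ, ⟨huv, hmem⟩, -⟩ := hconn
  have hu := hmem u (by simp)
  have hv := hmem v (by simp)
  have huv' : P.Adj u v := huv
  obtain ⟨w, hwu, hwv, hw⟩ := (φ 0).exists_third hu hv huv'.ne
  have h1 : P.Adj u w := (φ 0).adj hu ((hw w).2 (by simp)) hwu.symm
  have h2 : P.Adj v w := (φ 0).adj hv ((hw w).2 (by simp)) hwv.symm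
  refine ⟨w, hPH.2 h1, hPH.2 h2, ?_⟩
  rintro x (rfl | rfl | rfl)
  exacts [P.edge_vert h1, P.edge_vert h2, P.edge_vert h1.symm]

/-- Anchor-edges and hanging subgraphs depend on the piece, not on its kind, so the same pieces form
a bonnet system. -/
theorem bonnetDepth_le_umbrellaDepth (H : G.Subgraph) (c : Sym2 V) :
    bonnetDepth H c ≤ umbrellaDepth H c := by
  have key : ∀ 𝒰 : UmbrellaSystem H c, ∃ ℬ : BonnetSystem H c, ℬ.depth ≤ 𝒰.depth := by
    intro 𝒰
    induction 𝒰 with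
    | mk H c U hU sub ih =>
      choose sub' hsub' using ih
      refine ⟨.mk H c U hU.isBonnet sub', ?_⟩
      rw [CapSystem.depth_mk, CapSystem.depth_mk]
      gcongr with e S hS
      exact hsub' e S hS
  refine le_iInf fun 𝒰 => ?_
  obtain ⟨ℬ, hℬ⟩ := key 𝒰
  exact iInf_le_of_le ℬ hℬ

theorem freeBonnetDepth_le_freeUmbrellaDepth (G : SimpleGraph V) :
    freeBonnetDepth G ≤ freeUmbrellaDepth G :=
  iInf_mono fun _ => bonnetDepth_le_umbrellaDepth _ _

theorem facesWithin_eq_univ {f : V → ℤ} {a b : V} (h : ∀ v, f a ≤ f v ∧ f v ≤ f b) :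
    facesWithin G f a b = Set.univ :=
  Set.eq_univ_of_forall fun _ v _ => h v

theorem exists_between_of_extreme [Fintype V] (hn : 3 ≤ Fintype.card V) {f : V → ℤ}
    (hf : Function.Injective f) {a b : V} (h : ∀ v, f a ≤ f v ∧ f v ≤ f b) :
    ∃ y, f a < f y ∧ f y < f b := by
  classical
  obtain ⟨y, hy⟩ : ∃ y, y ∉ ({a, b} : Finset V) := by
    by_contra! hcon
    have h1 := Finset.card_le_card (fun v _ => hcon v : (Finset.univ : Finset V) ⊆ {a, b})
    have h2 := Finset.card_le_two (a := a) (b := b)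
    rw [Finset.card_univ] at h1
    omega
  simp only [Finset.mem_insert, Finset.mem_singleton, not_or] at hy
  have h1 := hf.ne hy.1
  have h2 := hf.ne hy.2
  have h3 := h y
  exact ⟨y, by omega, by omega⟩

theorem freeUmbrellaDepth_le_of_strahlerLE [Finite V] (hG : IsMaximalOuterplanar G) {f : V → ℤ}
    (h : IsTriangulation G f) {a b : V} (hall : ∀ v, f a ≤ f v ∧ f v ≤ f b)
    (hy : ∃ y, f a < f y ∧ f y < f b) {k : ℕ} (hs : StrahlerLE G f a b k) :
    freeUmbrellaDepth G ≤ k := by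
  have hlt : f a < f b := hy.elim fun y hy => hy.1.trans hy.2
  have hab := h.adj_of_extreme a b hlt hall
  have hdepth := hs.umbrellaDepth_le hG h hab hy
  have hnc := h.isNonCuttingEdge_root hab hlt
  rw [intervalSubgraph_eq_top hall] at hnc hdepth
  exact iInf_le_of_le ⟨_, hnc⟩ (iInf_le_natCast_iff.2 hdepth)

/-- At a leaf face one of the two lower edges has nothing under it, since otherwise there would be a
neighbour under each. Rotated to the top, this outer edge has the whole dual tree under it, with the
leaf as root face, so the Strahler bound applies. -/
theorem freeUmbrellaDepth_le_of_freeRootedPathwidth_le [Finite V] (hG : IsMaximalOuterplanar G)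
    {k : ℕ} (hk : freeRootedPathwidth (dualTree G) ≤ k) : freeUmbrellaDepth G ≤ k := by
  obtain ⟨f, hf⟩ := IsOuterplanar.exists_isNoncrossing hG.1
  have h := hG.isTriangulation hf
  obtain ⟨r₀, hr₀⟩ := iInf_le_natCast_iff.1 hk
  obtain ⟨r, hr, hleaf⟩ := exists_leaf_rootedPathwidthOn_le h.dualTree_isAcyclic hr₀
  obtain ⟨x, y, z, ht⟩ := hf.exists_isFaceTriple r
  have key : ∀ p q w, p ∈ r.1 → q ∈ r.1 → w ∈ r.1 → w ≠ p → w ≠ q → f p < f q →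
      (∀ v, ¬(f p < f v ∧ f v < f q)) → freeUmbrellaDepth G ≤ k := by
    intro p q w hp hq hw hwp hwq hlt hcons
    obtain ⟨g, hg, hlt', hall⟩ := hG.exists_rotation hf hlt hcons
    have h1 := hg.inj.ne hwp
    have h2 := hg.inj.ne hwq
    have h3 := hall w
    have hpq : q ≠ p := by
      rintro rfl
      exact hlt.false
    obtain ⟨t, hrt⟩ : ∃ w, IsFaceTriple g r q w p := by
      refine hg.isFaceTriple_of_mem_facesWithin hlt' hq hp ?_
      rw [facesWithin_eq_univ hall]
      trivial
    refine freeUmbrellaDepth_le_of_strahlerLE hG hg hall ⟨w, by omega, by omega⟩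
      (hg.strahlerLE_of_rootedPathwidthOn_le hrt ?_)
    rwa [facesWithin_eq_univ hall]
  by_cases h1 : ∃ v, f x < f v ∧ f v < f y
  · by_cases h2 : ∃ v, f y < f v ∧ f v < f z
    · obtain ⟨v, hv⟩ := h1
      obtain ⟨v', hv'⟩ := h2
      obtain ⟨s, w, hs⟩ := h.exists_faceTriple_of_between ht.adj_left hv.1 hv.2
      obtain ⟨t, w', ht'⟩ := h.exists_faceTriple_of_between ht.adj_right hv'.1 hv'.2
      obtain rfl := hleaf s t (ht.adj_of_left hs) (ht.adj_of_right ht')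
      have h3 := (ht'.mem_facesWithin x hs.left_mem).1
      have h4 := ht.left_lt
      omega
    · exact key y z x ht.mid_mem ht.right_mem ht.left_mem ht.adj_left.ne ht.adj.ne ht.lt_right
        fun v hv => h2 ⟨v, hv⟩
  · exact key x y z ht.left_mem ht.mid_mem ht.right_mem ht.adj.ne' ht.adj_right.ne' ht.left_lt
      fun v hv => h1 ⟨v, hv⟩

/-- The root edge of an optimal bonnet system is made outermost; then the faces under it are all
faces. -/
theorem pathwidth_le_of_freeBonnetDepth_le [Fintype V] (hn : 3 ≤ Fintype.card V)
    (hG : IsMaximalOuterplanar G) {d : ℕ} (hd : freeBonnetDepth G ≤ d) :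
    pathwidth (dualTree G) ≤ (2 * d : ℕ) := by
  obtain ⟨⟨c, hc⟩, hd⟩ := iInf_le_natCast_iff.1 hd
  obtain ⟨ℬ, hd⟩ := iInf_le_natCast_iff.1 hd
  obtain ⟨f, a, b, h, hcab, hlt, hall⟩ := hG.exists_extreme hc
  obtain ⟨y, hy⟩ := exists_between_of_extreme hn h.inj hall
  obtain ⟨t, w, ht⟩ := h.exists_faceTriple_of_between (h.adj_of_extreme a b hlt hall) hy.1 hy.2
  have := h.pathwidthOn_facesWithin_le_of_depth_le ℬ hd (intervalSubgraph_eq_top hall).symm hcab ht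
  rwa [facesWithin_eq_univ hall] at this

end Main

theorem mainTheorem5 {V : Type*} [Fintype V] (G : SimpleGraph V) (hn : 3 ≤ Fintype.card V)
    (hG : IsMaximalOuterplanar G) :
    ∃ p b u r : ℕ,
      pathwidth (dualTree G) = p ∧ freeBonnetDepth G = b ∧
      freeUmbrellaDepth G = u ∧ freeRootedPathwidth (dualTree G) = r ∧
      (1 / 2 : ℝ) * p ≤ b ∧ b ≤ u ∧ u ≤ r ∧ r ≤ max 1 (2 * p) ∧
      (b : ℝ) ≤ Real.logb 2 (Fintype.card V + 1) := by
  obtain ⟨f, hf⟩ := IsOuterplanar.exists_isNoncrossing hG.1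
  have h := hG.isTriangulation hf
  have : Nonempty V := Fintype.card_pos_iff.1 (by omega)
  obtain ⟨b₀, hb₀⟩ := Finite.exists_max f
  obtain ⟨a₀, ha₀⟩ := Finite.exists_min f
  have hall : ∀ v, f a₀ ≤ f v ∧ f v ≤ f b₀ := fun v => ⟨ha₀ v, hb₀ v⟩
  obtain ⟨y, hy⟩ : ∃ y, f a₀ < f y ∧ f y < f b₀ := exists_between_of_extreme hn hf.inj hall
  have hab := h.adj_of_extreme a₀ b₀ (hy.1.trans hy.2) hall
  obtain ⟨t, w, ht⟩ := h.exists_faceTriple_of_between hab hy.1 hy.2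
  have : Nonempty (Face G) := ⟨t⟩
  have hconn : ConnectedSet (dualTree G) Set.univ := by
    rw [← facesWithin_eq_univ hall]
    exact h.connectedSet_facesWithin hab
  -- The outer edges under the root edge are at most as many as the vertices. This bound is finite,
  -- and the finiteness of the other parameters is derived from it along the chain of inequalities.
  have hlog : freeUmbrellaDepth G ≤ (Nat.log 2 (Fintype.card V) : ℕ) := by
    refine freeUmbrellaDepth_le_of_strahlerLE hG h hall ⟨y, hy⟩ (h.strahlerLE_of_ncard_lt hab ?_)
    refine lt_of_le_of_lt ?_ (Nat.lt_pow_succ_log_self (by norm_num) _)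
    rw [← Nat.card_eq_fintype_card, ← Set.ncard_univ]
    exact Set.ncard_le_ncard (Set.subset_univ _)
  have hbu := freeBonnetDepth_le_freeUmbrellaDepth G
  obtain ⟨u, hu⟩ := ENat.ne_top_iff_exists.1 (ne_top_of_le_ne_top (ENat.natCast_ne_top _) hlog)
  rw [← hu] at hlog hbu
  obtain ⟨b, hb⟩ := ENat.ne_top_iff_exists.1 (ne_top_of_le_ne_top (ENat.natCast_ne_top _) hbu)
  rw [← hb] at hbu
  have hpb := pathwidth_le_of_freeBonnetDepth_le hn hG hb.ge
  obtain ⟨p, hp⟩ := ENat.ne_top_iff_exists.1 (ne_top_of_le_ne_top (ENat.natCast_ne_top _) hpb)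
  have hrp := freeRootedPathwidth_le h.dualTree_isAcyclic hconn hp.ge
  obtain ⟨r, hr⟩ := ENat.ne_top_iff_exists.1 (ne_top_of_le_ne_top (ENat.natCast_ne_top _) hrp)
  have hur := freeUmbrellaDepth_le_of_freeRootedPathwidth_le hG hr.ge
  rw [← hp] at hpb
  rw [← hr] at hrp
  rw [← hu] at hur
  norm_cast at hlog hbu hpb hrp hur
  refine ⟨p, b, u, r, hp.symm, hb.symm, hu.symm, hr.symm, ?_, hbu, hur, hrp, ?_⟩
  · have : (p : ℝ) ≤ 2 * b := by exact_mod_cast hpb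
    linarith
  -- The argument even gives `2 ^ b ≤ Fintype.card V`.
  · rw [Real.le_logb_iff_rpow_le (by norm_num) (by positivity), Real.rpow_natCast]
    have h1 : 2 ^ b ≤ Fintype.card V + 1 :=
      ((Nat.pow_le_pow_right (by norm_num) (hbu.trans hlog)).trans
        (Nat.pow_log_le_self 2 (by omega))).trans (Nat.le_succ _)
    exact_mod_cast h1
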